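/- **Proposition 3.1.** Let $X=V(F)\subset\mathbf P^4_{\mathbf C}$ be a quintic threefold ($F\in\mathbf C[x_0,\dots,x_4]$ nonzero and homogeneous of degree $5$) with only finitely many singular points $P_1,\dots,P_t$, all of which are ordinary triple points, i.e. points of multiplicity $3$ at which the tangent cone of $X$ is a cone over a smooth cubic surface. Then the following hold. 1. If $j_1\neq j_2$, then the line $\langle P_{j_1},P_{j_2}\rangle$ is contained in $X$. 2. No three triple points of $X$ are collinear. 3. A $2$-plane in $\mathbf P^4$ contains at most four triple points of $X$. 4. A $2$-plane $\Pi$ contains exactly four triple points of $X$ if and only if $\Pi\subset X$. 5. A hyperplane $H$ contains at most $6$ triple points of $X$. If it contains exactly $6$, then $X\cap H$ contains a $2$-plane. 6. If $\Pi_1,\Pi_2,\Pi_3\subset X$ are distinct $2$-planes, then $\Pi_1\cap\Pi_2\cap\Pi_3$ is finite. 7. If $X$ contains an irreducible quadric surface $S_2$ (a quadric of a hyperplane of $\mathbf P^4$, given there by an irreducible quadratic form), then precisely $6$ triple points of $X$ lie on $S_2$. In particular, $X$ then contains a $2$-plane. 8. If $H$ is a hyperplane, then the scheme-theoretic intersection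 $X\cap H$ is reduced. If $X\cap H$ is reducible, then it contains at least one and at most three $2$-planes. -/

import Mathlib

open scoped LinearAlgebra.Projectivization

namespace TripleQuintic

/-- The complex projective space of dimension four. -/
abbrev P4 : Type := ℙ ℂ (Fin 5 → ℂ)

/-- The polynomial ring in the five homogeneous coordinates. -/
abbrev Poly : Type := MvPolynomial (Fin 5) ℂ

/-- The points of projective space at which all polynomials in `T` vanish. Vanishing is tested on
the whole line in affine space that corresponds to the point. -/
def zeroSet (T : Set Poly) : Set P4 :=
  {P | ∀ v ∈ P.submodule, ∀ f ∈ T, MvPolynomial.eval v f = 0}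

/-- The hypersurface with equation `F = 0`. -/
def hypersurface (F : Poly) : Set P4 := zeroSet {F}

/-- The projective linear subspace that belongs to a linear subspace `W` of the affine space.
It is a line, a plane or a hyperplane if `W` has dimension 2, 3 or 4. -/
def linearSet (W : Submodule ℂ (Fin 5 → ℂ)) : Set P4 := {P | P.submodule ≤ W}

/-- The set `S` is a projective linear subspace of dimension `d`. -/
def IsLinearOfDim (d : ℕ) (S : Set P4) : Prop :=
  ∃ W : Submodule ℂ (Fin 5 → ℂ), Module.finrank ℂ W = d + 1 ∧ S = linearSet W

/-- The line that joins two (distinct) points. -/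
def lineThrough (P Q : P4) : Set P4 := linearSet (P.submodule ⊔ Q.submodule)

/-- The singular points of the hypersurface `F = 0`: all partial derivatives of `F` vanish. -/
def singularLocus (F : Poly) : Set P4 :=
  {P | P ∈ hypersurface F ∧
    ∀ v ∈ P.submodule, ∀ i : Fin 5, MvPolynomial.eval v (MvPolynomial.pderiv i F) = 0}

/-- The homogeneous part of degree `k` of the expansion of `F` around `v`, that is, of the
polynomial `F (v + x)` in `x`. -/
noncomputable def taylorForm (F : Poly) (v : Fin 5 → ℂ) (k : ℕ) : Poly :=
  MvPolynomial.homogeneousComponent k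
    (MvPolynomial.aeval (fun i => MvPolynomial.C (v i) + MvPolynomial.X i : Fin 5 → Poly) F)

/-- `P = [v]` is an ordinary triple point of the hypersurface with homogeneous equation `F = 0`.
The multiplicity is three: the expansion of `F` around `v` starts in degree three. Its leading
cubic form `taylorForm F v 3` is then invariant under translation by multiples of `v`, hence it is
a cubic form on the four-dimensional space `ℂ⁵ / ℂ v`, the tangent space of projective
space at `P` (up to a twist); it is the equation of the tangent cone. The tangent cone is a cone
over the cubic surface which this form defines in `ℙ(ℂ⁵ / ℂ v)`, and this surface is smooth when
the partial derivatives of the form have no common zero outside `ℂ v`. -/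
def IsOrdinaryTriplePoint (F : Poly) (P : P4) : Prop :=
  ∀ v ∈ P.submodule, v ≠ 0 →
    (∀ k < 3, taylorForm F v k = 0) ∧
    taylorForm F v 3 ≠ 0 ∧
    ∀ x : Fin 5 → ℂ,
      (∀ i : Fin 5, MvPolynomial.eval x (MvPolynomial.pderiv i (taylorForm F v 3)) = 0) →
        x ∈ P.submodule

/-- Zariski closed subsets of projective space. -/
def IsZariskiClosed (S : Set P4) : Prop :=
  ∃ T : Set Poly, (∀ f ∈ T, ∃ d : ℕ, f.IsHomogeneous d) ∧ S = zeroSet T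

/-- A set is reducible if it is the union of two proper closed subsets. -/
def IsReducible (S : Set P4) : Prop :=
  ∃ A B : Set P4, IsZariskiClosed A ∧ IsZariskiClosed B ∧ A ≠ S ∧ B ≠ S ∧ S = A ∪ B

/-- The ideal generated by `F` and by the linear forms vanishing on `W`: the homogeneous ideal of
the scheme-theoretic intersection of `F = 0` with the linear subspace given by `W`. -/
noncomputable def sectionIdeal (F : Poly) (W : Submodule ℂ (Fin 5 → ℂ)) : Ideal Poly :=
  Ideal.span {F} ⊔ MvPolynomial.vanishingIdeal ℂ (W : Set (Fin 5 → ℂ))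

/-- The intersection of `F = 0` with the hyperplane given by `W`, taken as a scheme, is reduced.
The hyperplane is a projective space, and the ideal generated by a single form in its coordinate
ring is saturated, so this means that the homogeneous ideal of the intersection is radical. -/
def IsReducedSection (F : Poly) (W : Submodule ℂ (Fin 5 → ℂ)) : Prop :=
  (sectionIdeal F W).IsRadical

/-- An irreducible (and reduced) quadric surface: inside some hyperplane, the zero set of a
quadratic form that is irreducible on this hyperplane. Smooth quadrics and quadric cones are
allowed, pairs of planes and double planes are not. -/
def IsIrreducibleQuadricSurface (S : Set P4) : Prop :=
  ∃ (W : Submodule ℂ (Fin 5 → ℂ)) (q : Poly), Module.finrank ℂ W = 4 ∧ q.IsHomogeneous 2 ∧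
    q ∉ MvPolynomial.vanishingIdeal ℂ (W : Set (Fin 5 → ℂ)) ∧
    (sectionIdeal q W).IsPrime ∧ S = hypersurface q ∩ linearSet W

/-- The planes contained in the set `S`. -/
def planesIn (S : Set P4) : Set (Set P4) := {E | IsLinearOfDim 2 E ∧ E ⊆ S}

end TripleQuintic

open TripleQuintic

/-! At a triple point `F` lies in the cube of the ideal of the point, and each partial derivative of
`F` is a quartic in its square. In coordinates whose basis vectors are triple points, both
restricted forms therefore have all exponents at most 2 (`add_le_of_mem_support`). On a line with
two triple points nothing of degree 5 survives, and of degree 4 only `y₀²y₁²`; a third triple point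
would make the whole line singular. On a plane with three triple points a quintic has three
coefficients left, which a fourth triple point kills.

The upper bounds use the standard Cremona involution, which sends a form of degree `d` in `n`
variables with exponents at most 2 to one of degree `2n - d`. With five coplanar triple points, the
quartic derivatives become conics with two double points; these vanish on the joining line, so `X`
is singular along a curve. With six triple points in a hyperplane, no four of them coplanar, the
quintic becomes a cubic with two triple points, hence a binary cubic. It vanishes at four distinct
points, so it is zero (`eq_zero_of_six_triple_points`).

The lower bounds use Bézout's theorem. Let `w` be a basis of a hyperplane `W` and `u` a vector
outside it. If `F` restricts to `q c` on `W`, then the common zeros of `q`, `c` and the derivative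
of `F` along `u` are singular points. For a quadric `q` the degrees multiply to `2 · 3 · 4 = 24`.
For a plane, the hyperplane coordinate cutting it out and two derivatives transversal to it give `1
· 4 · 4 = 16`. Smoothness of the tangent cone makes every local multiplicity at most 4: modulo one
linear leading form, two binary quadratic leading forms without common zero remain. Hence there are
at least 6, respectively 4, triple points. The inequality itself, `mul_le_four_mul_card`, is a
dimension count in large degrees.

Two planes of one hyperplane section share two triple points: on their common line the transversal
derivative is a quartic whose zeros are triple points, each of order exactly two. Counting then
excludes a seventh triple point in a hyperplane, a fourth plane in a section, and three planes
through a line. A multiple factor of a section would produce a curve of singular points, so sections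
are reduced. A reducible section has a factor of degree 1 or 2, and a quadric factor carries six
triple points, which force a plane. -/

open scoped LinearAlgebra.Projectivization

namespace TripleQuintic

open MvPolynomial

/-! ### Linear substitutions, derivatives and Taylor forms -/

section Substitution

variable {m n : Type*}

/-- The pull-back of a polynomial along the linear map that sends the `j`-th unit vector to
`A j`. -/
noncomputable def pull [Fintype m] (A : m → n → ℂ) : MvPolynomial n ℂ →ₐ[ℂ] MvPolynomial m ℂ :=
  aeval fun i => ∑ j, C (A j i) * X j

/-- The derivative in the direction of a vector. -/
noncomputable def dirDeriv [Fintype n] (w : n → ℂ) (f : MvPolynomial n ℂ) : MvPolynomial n ℂ :=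
  ∑ i, C (w i) * pderiv i f

/-- The translation `f (v + x)` of a polynomial. -/
noncomputable def translate (v : n → ℂ) : MvPolynomial n ℂ →ₐ[ℂ] MvPolynomial n ℂ :=
  aeval fun i => C (v i) + X i

/-- The homogeneous part of degree `k` of the expansion around `v`. -/
noncomputable def taylor (v : n → ℂ) (k : ℕ) (f : MvPolynomial n ℂ) : MvPolynomial n ℂ :=
  homogeneousComponent k (translate v f)

/-- The ideal of a point of affine space. -/
noncomputable def pointIdeal (v : n → ℂ) : Ideal (MvPolynomial n ℂ) :=
  Ideal.span (Set.range fun i => X i - C (v i))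

theorem eval_pull [Fintype m] (A : m → n → ℂ) (y : m → ℂ) (f : MvPolynomial n ℂ) :
    eval y (pull A f) = eval (∑ j, y j • A j) f := by
  have : (aeval y).comp (pull A) = aeval (R := ℂ) (∑ j, y j • A j) := by
    ext i
    simp [pull, Finset.sum_apply, mul_comm]
  simpa [aeval_eq_eval] using DFunLike.congr_fun this f

theorem isHomogeneous_pull [Fintype m] (A : m → n → ℂ) {f : MvPolynomial n ℂ} {d : ℕ}
    (hf : f.IsHomogeneous d) : (pull A f).IsHomogeneous d := by
  rw [← one_mul d]
  exact hf.aeval _ fun i => IsHomogeneous.sum _ _ _ fun j _ => isHomogeneous_C_mul_X _ _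

theorem pull_eq_zero_iff [Fintype m] (A : m → n → ℂ) (f : MvPolynomial n ℂ) :
    pull A f = 0 ↔ ∀ y : m → ℂ, eval (∑ j, y j • A j) f = 0 := by
  constructor
  · intro h y
    rw [← eval_pull, h, map_zero]
  · intro h
    refine MvPolynomial.funext fun y => ?_
    rw [eval_pull, h, map_zero]

theorem homogeneousComponent_aeval {g : n → MvPolynomial m ℂ} (hg : ∀ i, (g i).IsHomogeneous 1)
    (k : ℕ) (f : MvPolynomial n ℂ) :
    homogeneousComponent k (aeval g f) = aeval g (homogeneousComponent k f) := by
  conv_lhs => rw [← sum_homogeneousComponent f, map_sum, map_sum]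
  have h : ∀ i, (aeval g (homogeneousComponent i f)).IsHomogeneous i := fun i => by
    simpa using (homogeneousComponent_isHomogeneous i f).aeval g hg
  simp_rw [fun i => homogeneousComponent_of_mem (m := k) (h i)]
  rw [Finset.sum_ite_eq]
  split_ifs with hk
  · rfl
  · rw [homogeneousComponent_eq_zero, map_zero]
    simpa using hk

theorem pderiv_aeval {m n : Type*} [Fintype n] (g : n → MvPolynomial m ℂ) (j : m)
    (f : MvPolynomial n ℂ) :
    pderiv j (aeval g f) = ∑ i, pderiv j (g i) * aeval g (pderiv i f) := by
  classical
  induction f using MvPolynomial.induction_on with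
  | C a => simp
  | add p q hp hq => simp only [map_add, hp, hq, mul_add, Finset.sum_add_distrib]
  | mul_X p i hp =>
    simp only [map_mul, aeval_X, Derivation.leibniz, hp, smul_eq_mul, pderiv_X, map_add, mul_add,
      Finset.sum_add_distrib, Finset.mul_sum]
    congr 1
    · rw [Finset.sum_eq_single i]
      · simp [mul_comm]
      · intro b _ hb
        simp [Ne.symm hb]
      · simp
    · exact Finset.sum_congr rfl fun _ _ => by ring

theorem pderiv_pull [Fintype m] [Fintype n] (A : m → n → ℂ) (j : m) (f : MvPolynomial n ℂ) :
    pderiv j (pull A f) = pull A (dirDeriv (A j) f) := by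
  classical
  rw [pull, pderiv_aeval, dirDeriv, map_sum]
  refine Finset.sum_congr rfl fun i _ => ?_
  have : pderiv j (∑ k, C (A k i) * X k : MvPolynomial m ℂ) = C (A j i) := by
    simp [pderiv_X, Pi.single_apply]
  rw [this]
  simp

theorem isHomogeneous_dirDeriv [Fintype n] (w : n → ℂ) {f : MvPolynomial n ℂ} {d : ℕ}
    (hf : f.IsHomogeneous d) : (dirDeriv w f).IsHomogeneous (d - 1) :=
  IsHomogeneous.sum _ _ _ fun _ _ => hf.pderiv.C_mul _

theorem translate_pull [Fintype m] (A : m → n → ℂ) (u : m → ℂ) (f : MvPolynomial n ℂ) :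
    translate u (pull A f) = pull A (translate (∑ j, u j • A j) f) := by
  have : (translate u).comp (pull A) = (pull A).comp (translate (∑ j, u j • A j)) := by
    ext1 i
    simp [pull, translate, Finset.sum_apply, mul_add, Finset.sum_add_distrib, mul_comm]
  exact DFunLike.congr_fun this f

theorem taylor_pull [Fintype m] (A : m → n → ℂ) (u : m → ℂ) (k : ℕ) (f : MvPolynomial n ℂ) :
    taylor u k (pull A f) = pull A (taylor (∑ j, u j • A j) k f) := by
  rw [taylor, translate_pull]
  refine homogeneousComponent_aeval ?_ _ _
  exact fun i => IsHomogeneous.sum _ _ _ fun j _ => isHomogeneous_C_mul_X _ _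

theorem pderiv_translate [Fintype n] (v : n → ℂ) (j : n) (f : MvPolynomial n ℂ) :
    pderiv j (translate v f) = translate v (pderiv j f) := by
  classical
  rw [translate, pderiv_aeval, Finset.sum_eq_single j]
  · simp
  · intro i _ hi
    simp [pderiv_X, hi]
  · simp

theorem pderiv_homogeneousComponent (k : ℕ) (j : n) (f : MvPolynomial n ℂ) :
    homogeneousComponent k (pderiv j f) = pderiv j (homogeneousComponent (k + 1) f) := by
  ext d
  rw [coeff_homogeneousComponent, coeff_pderiv, coeff_pderiv, coeff_homogeneousComponent]
  have : (d + Finsupp.single j 1).degree = d.degree + 1 := by simp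
  rw [this]
  simp only [add_left_inj]
  split_ifs <;> simp

/-- Differentiation commutes with translation and lowers degrees by one. This links the quadratic
leading forms of the derivatives of `F` to the derivatives of the cubic tangent cone. -/
theorem taylor_dirDeriv [Fintype n] (v w : n → ℂ) (k : ℕ) (f : MvPolynomial n ℂ) :
    taylor v k (dirDeriv w f) = dirDeriv w (taylor v (k + 1) f) := by
  simp only [taylor, dirDeriv, map_sum, map_mul]
  refine Finset.sum_congr rfl fun j _ => ?_
  rw [← pderiv_homogeneousComponent, pderiv_translate, ← homogeneousComponent_C_mul]
  simp

theorem isHomogeneous_taylor (v : n → ℂ) (k : ℕ) (f : MvPolynomial n ℂ) :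
    (taylor v k f).IsHomogeneous k :=
  homogeneousComponent_isHomogeneous _ _

theorem eval_translate (v x : n → ℂ) (f : MvPolynomial n ℂ) :
    eval x (translate v f) = eval (v + x) f := by
  have : (aeval x).comp (translate v) = aeval (R := ℂ) (v + x) := by
    ext i
    simp [translate]
  simpa [aeval_eq_eval] using DFunLike.congr_fun this f

theorem IsHomogeneous.eval_smul {f : MvPolynomial n ℂ} {d : ℕ} (hf : f.IsHomogeneous d)
    (c : ℂ) (x : n → ℂ) : eval (c • x) f = c ^ d * eval x f := by
  rw [eval_eq, eval_eq, Finset.mul_sum]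
  refine Finset.sum_congr rfl fun e he => ?_
  have : ∑ i ∈ e.support, e i = d := by
    rw [← hf.degree_eq_sum_deg_support he]
  simp only [Pi.smul_apply, smul_eq_mul, mul_pow, Finset.prod_mul_distrib, Finset.prod_pow_eq_pow_sum,
    this]
  ring

theorem totalDegree_translate_le (v : n → ℂ) (f : MvPolynomial n ℂ) :
    (translate v f).totalDegree ≤ f.totalDegree := by
  rw [translate, aeval_def, eval₂_eq]
  refine (totalDegree_finsetSum _ _).trans (Finset.sup_le fun e he => ?_)
  refine (totalDegree_mul _ _).trans ?_
  rw [algebraMap_eq, totalDegree_C, zero_add]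
  refine (totalDegree_finsetProd _ _).trans ?_
  refine le_trans (Finset.sum_le_sum fun i _ => ?_) (le_totalDegree he)
  refine (totalDegree_pow _ _).trans ?_
  refine le_trans (Nat.mul_le_mul_left _ ((totalDegree_add _ _).trans ?_)) (mul_one _).le
  simp

theorem eval_add_eq_sum_taylor (v x : n → ℂ) {f : MvPolynomial n ℂ} {d : ℕ}
    (hf : f.totalDegree ≤ d) :
    eval (v + x) f = ∑ k ∈ Finset.range (d + 1), eval x (taylor v k f) := by
  rw [← eval_translate, ← sum_homogeneousComponent (translate v f), map_sum]
  refine Finset.sum_subset ?_ fun k _ hk => ?_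
  · intro k hk
    have := totalDegree_translate_le v f
    simp only [Finset.mem_range] at hk ⊢
    omega
  · rw [homogeneousComponent_eq_zero, map_zero]
    simpa using hk

end Substitution

/-! ### Order of vanishing at a point -/

section PointIdeal

variable {m n : Type*}

/-- Used for translations, dehomogenization and the Cremona map alike: only the images of the
generators of the point ideal have to be checked. -/
theorem map_mem_pow_of_mem_pointIdeal_pow {A : Type*} [CommRing A] [Algebra ℂ A]
    (φ : MvPolynomial n ℂ →ₐ[ℂ] A) {v : n → ℂ} {J : Ideal A}
    (hφ : ∀ i, φ (X i - C (v i)) ∈ J) {k : ℕ} {f : MvPolynomial n ℂ}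
    (hf : f ∈ pointIdeal v ^ k) : φ f ∈ J ^ k := by
  have h1 : (pointIdeal v).map φ ≤ J := by
    rw [pointIdeal, Ideal.map_span, Ideal.span_le]
    rintro _ ⟨_, ⟨i, rfl⟩, rfl⟩
    exact hφ i
  have h2 := Ideal.mem_map_of_mem φ hf
  rw [Ideal.map_pow] at h2
  exact Ideal.pow_right_mono h1 k h2

theorem translate_mem_iff (v : n → ℂ) (k : ℕ) (f : MvPolynomial n ℂ) :
    translate v f ∈ idealOfVars n ℂ ^ k ↔ f ∈ pointIdeal v ^ k := by
  constructor
  · intro h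
    have h0 : idealOfVars n ℂ = pointIdeal (0 : n → ℂ) := by simp [pointIdeal, idealOfVars]
    rw [h0] at h
    have := map_mem_pow_of_mem_pointIdeal_pow (translate (-v)) (J := pointIdeal v)
      (fun i => ?_) h
    · have h2 : (translate (-v)).comp (translate v) = AlgHom.id ℂ (MvPolynomial n ℂ) := by
        ext1 i
        simp [translate]
      rwa [show translate (-v) (translate v f) = f from DFunLike.congr_fun h2 f] at this
    · have : translate (-v) (X i - C ((0 : n → ℂ) i)) = X i - C (v i) := by
        simp [translate, sub_eq_add_neg, add_comm]
      rw [this]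
      exact Ideal.subset_span ⟨i, rfl⟩
  · intro h
    refine map_mem_pow_of_mem_pointIdeal_pow (translate v) (fun i => ?_) h
    have : translate v (X i - C (v i)) = X i := by
      simp [translate]
    rw [this]
    exact Ideal.subset_span ⟨i, rfl⟩

theorem mem_idealOfVars_pow_iff_homogeneousComponent (k : ℕ) (f : MvPolynomial n ℂ) :
    f ∈ idealOfVars n ℂ ^ k ↔ ∀ j < k, homogeneousComponent j f = 0 := by
  rw [mem_pow_idealOfVars_iff']
  constructor
  · intro h j hj
    ext d
    rw [coeff_homogeneousComponent, coeff_zero]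
    split_ifs with hd
    · exact h d (hd ▸ hj)
    · rfl
  · intro h d hd
    have := congrArg (coeff d) (h _ hd)
    simpa [coeff_homogeneousComponent] using this

/-- Translation to the origin turns order of vanishing into membership in a power of the ideal of
the variables. The ideal side behaves well under substitutions and products, the Taylor side under
differentiation. -/
theorem mem_pointIdeal_pow_iff (v : n → ℂ) (k : ℕ) (f : MvPolynomial n ℂ) :
    f ∈ pointIdeal v ^ k ↔ ∀ j < k, taylor v j f = 0 := by
  rw [← translate_mem_iff, mem_idealOfVars_pow_iff_homogeneousComponent]
  rfl

theorem mem_pointIdeal_iff (v : n → ℂ) (f : MvPolynomial n ℂ) :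
    f ∈ pointIdeal v ↔ eval v f = 0 := by
  rw [← pow_one (pointIdeal v), mem_pointIdeal_pow_iff]
  have h : taylor v 0 f = C (eval v f) := by
    rw [taylor, homogeneousComponent_zero, ← constantCoeff_eq, ← eval_zero, eval_translate,
      add_zero]
  simp [h]

theorem pull_mem_pointIdeal_pow [Fintype m] (A : m → n → ℂ) (u : m → ℂ) {k : ℕ}
    {f : MvPolynomial n ℂ} (hf : f ∈ pointIdeal (∑ j, u j • A j) ^ k) :
    pull A f ∈ pointIdeal u ^ k := by
  rw [mem_pointIdeal_pow_iff] at hf ⊢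
  intro j hj
  rw [taylor_pull, hf j hj, map_zero]

theorem dirDeriv_mem_pointIdeal_pow [Fintype n] (v w : n → ℂ) {k : ℕ} {f : MvPolynomial n ℂ}
    (hf : f ∈ pointIdeal v ^ (k + 1)) : dirDeriv w f ∈ pointIdeal v ^ k := by
  rw [mem_pointIdeal_pow_iff] at hf ⊢
  intro j hj
  rw [taylor_dirDeriv, hf (j + 1) (by omega)]
  simp [dirDeriv]

/-- A polynomial that does not vanish at `v` is a unit modulo every power of the ideal of `v`. -/
theorem mem_pointIdeal_pow_of_mul_mem {v : n → ℂ} {k : ℕ} {u f : MvPolynomial n ℂ}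
    (hu : eval v u ≠ 0) (h : u * f ∈ pointIdeal v ^ k) : f ∈ pointIdeal v ^ k := by
  have h1 : C (eval v u) - u ∈ pointIdeal v := by
    rw [mem_pointIdeal_iff]
    simp
  have h2 := Ideal.pow_mem_pow h1 k
  -- The geometric sum supplies an inverse of `u` up to a nonzero constant, modulo the `k`-th power.
  obtain ⟨r, hr⟩ : u ∣ C (eval v u) ^ k - (C (eval v u) - u) ^ k := by
    have := sub_dvd_pow_sub_pow (C (eval v u)) (C (eval v u) - u) k
    rwa [sub_sub_cancel] at this
  have h3 : C (eval v u ^ k) * f ∈ pointIdeal v ^ k := by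
    have : C (eval v u ^ k) * f = r * (u * f) + f * (C (eval v u) - u) ^ k := by
      rw [C_pow]
      linear_combination f * hr
    rw [this]
    exact add_mem (Ideal.mul_mem_left _ _ h) (Ideal.mul_mem_left _ _ h2)
  have h4 := Ideal.mul_mem_left (pointIdeal v ^ k) (C (eval v u ^ k)⁻¹) h3
  rwa [← mul_assoc, ← C_mul, inv_mul_cancel₀ (pow_ne_zero _ hu), C_1, one_mul] at h4

theorem sub_taylor_mem (v : n → ℂ) {k : ℕ} {f : MvPolynomial n ℂ}
    (hf : f ∈ pointIdeal v ^ k) :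
    translate v f - taylor v k f ∈ idealOfVars n ℂ ^ (k + 1) := by
  rw [mem_idealOfVars_pow_iff_homogeneousComponent]
  rw [mem_pointIdeal_pow_iff] at hf
  intro j hj
  rw [map_sub, homogeneousComponent_of_mem (isHomogeneous_taylor v k f)]
  split_ifs with h
  · subst h
    exact sub_self _
  · rw [sub_zero]
    exact hf j (by omega)

/-- Leading forms multiply: replacing each factor by its leading form changes the product only in
order `k + l + 1`. -/
theorem taylor_mul {v : n → ℂ} {k l : ℕ} {f g : MvPolynomial n ℂ}
    (hf : f ∈ pointIdeal v ^ k) (hg : g ∈ pointIdeal v ^ l) :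
    taylor v (k + l) (f * g) = taylor v k f * taylor v l g := by
  have h1 := sub_taylor_mem v hf
  have h2 := sub_taylor_mem v hg
  have h3 := (translate_mem_iff v k f).2 hf
  have h4 : taylor v l g ∈ idealOfVars n ℂ ^ l := by
    rw [mem_pow_idealOfVars_iff']
    intro x hx
    exact (isHomogeneous_taylor v l g).coeff_eq_zero hx.ne
  have h5 : translate v (f * g) - taylor v k f * taylor v l g ∈
      idealOfVars n ℂ ^ (k + l + 1) := by
    have : translate v (f * g) - taylor v k f * taylor v l g =
        translate v f * (translate v g - taylor v l g) +
          (translate v f - taylor v k f) * taylor v l g := by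
      rw [map_mul]; ring
    rw [this]
    refine add_mem ?_ ?_
    · rw [add_assoc, pow_add]
      exact Ideal.mul_mem_mul h3 h2
    · rw [add_right_comm, pow_add]
      exact Ideal.mul_mem_mul h1 h4
  rw [mem_idealOfVars_pow_iff_homogeneousComponent] at h5
  have h6 := h5 (k + l) (by omega)
  rw [map_sub, sub_eq_zero, homogeneousComponent_of_mem
    ((isHomogeneous_taylor v k f).mul (isHomogeneous_taylor v l g)), if_pos rfl] at h6
  exact h6

theorem degree_eq_of_mem_support {f : MvPolynomial n ℂ} {d : ℕ} (hf : f.IsHomogeneous d)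
    {e : n →₀ ℕ} (he : e ∈ f.support) : e.degree = d := by
  by_contra h
  exact mem_support_iff.1 he (hf.coeff_eq_zero h)

/-- Setting the `i`-th variable to one. -/
noncomputable def dehomogenize [DecidableEq n] (i : n) : MvPolynomial n ℂ →ₐ[ℂ] MvPolynomial n ℂ :=
  aeval fun j => if j = i then 1 else X j

theorem dehomogenize_monomial [DecidableEq n] (i : n) (a : n →₀ ℕ) (c : ℂ) :
    dehomogenize i (monomial a c) = monomial (a.erase i) c := by
  rw [dehomogenize, aeval_monomial, algebraMap_eq, monomial_eq]
  congr 1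
  rw [Finsupp.prod_of_support_subset (s := a.support) _ Finset.Subset.rfl _ (by simp),
    Finsupp.prod_of_support_subset (s := a.support) _ (by simp [Finset.erase_subset]) _ (by simp)]
  refine Finset.prod_congr rfl fun j _ => ?_
  by_cases hj : j = i
  · subst hj; simp
  · simp [hj]

theorem degree_erase_add (a : n →₀ ℕ) (i : n) : (a.erase i).degree + a i = a.degree := by
  conv_rhs => rw [← Finsupp.erase_add_single i a]
  rw [map_add, Finsupp.degree_single]

/-- Nothing is lost by setting a variable to one in a form, since the degree recovers the missing
exponent. -/
theorem coeff_dehomogenize [DecidableEq n] {f : MvPolynomial n ℂ} {d : ℕ}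
    (hf : f.IsHomogeneous d) (i : n) {e : n →₀ ℕ} (he : e.degree = d) :
    coeff (e.erase i) (dehomogenize i f) = coeff e f := by
  conv_lhs => rw [f.as_sum, map_sum, coeff_sum]
  rw [Finset.sum_eq_single e]
  · rw [dehomogenize_monomial, coeff_monomial, if_pos rfl]
  · intro b hb hbe
    rw [dehomogenize_monomial, coeff_monomial, if_neg]
    intro hbe'
    refine hbe ?_
    have h5 := degree_eq_of_mem_support hf hb
    have h6 := degree_erase_add b i
    have h7 := degree_erase_add e i
    rw [hbe'] at h6
    rw [← Finsupp.erase_add_single i b, ← Finsupp.erase_add_single i e, hbe',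
      show b i = e i by omega]
  · intro h
    simp [notMem_support_iff.1 h]

/-- With `X i = 1` the point becomes the origin and the monomial `e` gets degree `d - e i`, which
must be at least `k`. For quintics with triple points and quartics with double points this is the
bound `e i ≤ 2`. -/
theorem add_le_of_mem_support [DecidableEq n] {f : MvPolynomial n ℂ} {d k : ℕ}
    (hf : f.IsHomogeneous d) {i : n}
    (h : f ∈ pointIdeal (Pi.single i 1 : n → ℂ) ^ k) {e : n →₀ ℕ} (he : e ∈ f.support) :
    e i + k ≤ d := by
  have h1 : dehomogenize i f ∈ idealOfVars n ℂ ^ k := by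
    refine map_mem_pow_of_mem_pointIdeal_pow (dehomogenize i) (fun j => ?_) h
    by_cases hj : j = i
    · subst hj
      simp [dehomogenize]
    · simp only [aeval_X, hj, if_false, dehomogenize, Pi.single_eq_of_ne hj, map_zero, sub_zero]
      exact Ideal.subset_span ⟨j, rfl⟩
  have h8 : e.degree = d := degree_eq_of_mem_support hf he
  have h2 := coeff_dehomogenize hf i h8
  rw [mem_pow_idealOfVars_iff'] at h1
  by_contra hlt
  have h7 := degree_erase_add e i
  exact (mem_support_iff.1 he) (h2 ▸ h1 _ (by omega))

end PointIdeal

/-! ### Factors of forms are forms -/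

section Factors

variable {n : Type*}

/-- The substitution `X i ↦ X i * T` with values in polynomials in a new variable `T`. -/
noncomputable def dilate : MvPolynomial n ℂ →ₐ[ℂ] Polynomial (MvPolynomial n ℂ) :=
  aeval fun i => Polynomial.C (X i) * Polynomial.X

theorem dilate_of_isHomogeneous {p : MvPolynomial n ℂ} {k : ℕ} (hp : p.IsHomogeneous k) :
    dilate p = Polynomial.monomial k p := by
  have hmon : ∀ (a : n →₀ ℕ) (c : ℂ), a.degree = k →
      dilate (monomial a c) = Polynomial.monomial k (monomial a c) := by
    intro a c ha
    rw [dilate, aeval_monomial, monomial_eq, ← Polynomial.C_mul_X_pow_eq_monomial,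
      Polynomial.C_mul, Finsupp.prod, Finsupp.prod, map_prod, mul_assoc]
    congr 1
    simp_rw [mul_pow]
    rw [Finset.prod_mul_distrib, Finset.prod_pow_eq_pow_sum, ← ha]
    simp [Finsupp.degree_apply]
  conv_lhs => rw [p.as_sum]
  conv_rhs => rw [p.as_sum]
  rw [map_sum, map_sum]
  exact Finset.sum_congr rfl fun a ha => hmon a _ (degree_eq_of_mem_support hp ha)

theorem coeff_dilate (p : MvPolynomial n ℂ) (k : ℕ) :
    (dilate p).coeff k = homogeneousComponent k p := by
  conv_lhs => rw [← sum_homogeneousComponent p, map_sum, Polynomial.finsetSum_coeff]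
  simp_rw [fun i => dilate_of_isHomogeneous (homogeneousComponent_isHomogeneous i p),
    Polynomial.coeff_monomial]
  rw [Finset.sum_ite_eq']
  split_ifs with hk
  · rfl
  · rw [homogeneousComponent_eq_zero]
    simpa using hk

theorem isHomogeneous_of_natDegree_dilate_le {g : MvPolynomial n ℂ}
    (h : (dilate g).natDegree ≤ (dilate g).natTrailingDegree) :
    g.IsHomogeneous (dilate g).natDegree := by
  have h6 : g = homogeneousComponent (dilate g).natDegree g := by
    conv_lhs => rw [← sum_homogeneousComponent g]
    have h7 : ∀ i, i ≠ (dilate g).natDegree → homogeneousComponent i g = 0 := by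
      intro i hi
      rw [← coeff_dilate]
      rcases lt_or_gt_of_ne hi with hi | hi
      · exact Polynomial.coeff_eq_zero_of_lt_natTrailingDegree (by omega)
      · exact Polynomial.coeff_eq_zero_of_natDegree_lt hi
    rw [Finset.sum_eq_single (dilate g).natDegree (fun i _ hi => h7 i hi)]
    intro hk
    refine homogeneousComponent_eq_zero _ _ ?_
    simpa using hk
  have h7 := homogeneousComponent_isHomogeneous (dilate g).natDegree g
  rwa [← h6] at h7

/-- Highest and lowest degrees are both additive on products in a domain. They agree for the
product, hence for each factor. -/
theorem exists_isHomogeneous_of_dvd {f g : MvPolynomial n ℂ} {d : ℕ} (hf : f.IsHomogeneous d)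
    (hf0 : f ≠ 0) (hg : g ∣ f) : ∃ e, g.IsHomogeneous e := by
  obtain ⟨h, rfl⟩ := hg
  have h1 : dilate g * dilate h = Polynomial.monomial d (g * h) := by
    rw [← map_mul, dilate_of_isHomogeneous hf]
  have hne : dilate g * dilate h ≠ 0 := by
    rw [h1, Ne, Polynomial.monomial_eq_zero_iff]
    exact hf0
  have hg0 : dilate g ≠ 0 := left_ne_zero_of_mul hne
  have hh0 : dilate h ≠ 0 := right_ne_zero_of_mul hne
  have h2 := Polynomial.natDegree_mul hg0 hh0
  rw [h1, Polynomial.natDegree_monomial_eq _ hf0] at h2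
  have h3 := Polynomial.natTrailingDegree_mul hg0 hh0
  rw [h1, Polynomial.natTrailingDegree_monomial hf0] at h3
  have h4 := Polynomial.natTrailingDegree_le_natDegree (dilate g)
  have h5 := Polynomial.natTrailingDegree_le_natDegree (dilate h)
  exact ⟨_, isHomogeneous_of_natDegree_dilate_le (by omega)⟩

theorem exists_isHomogeneous_of_mul {f g h : MvPolynomial n ℂ} {d : ℕ} (hf : f.IsHomogeneous d)
    (hf0 : f ≠ 0) (hgh : f = g * h) :
    ∃ a b, a + b = d ∧ g.IsHomogeneous a ∧ h.IsHomogeneous b := by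
  obtain ⟨a, ha⟩ := exists_isHomogeneous_of_dvd hf hf0 ⟨h, hgh⟩
  obtain ⟨b, hb⟩ := exists_isHomogeneous_of_dvd hf hf0 ⟨g, hgh.trans (mul_comm _ _)⟩
  exact ⟨a, b, (hgh ▸ ha.mul hb).inj_right hf hf0, ha, hb⟩

end Factors

/-! ### Hilbert function of an ideal generated by three forms -/

section HilbertFunction

theorem finrank_homogeneousSubmodule (d : ℕ) :
    Module.finrank ℂ (homogeneousSubmodule (Fin 4) ℂ d) = (d + 3).choose 3 := by
  have h1 : homogeneousSubmodule (Fin 4) ℂ d = restrictSupport ℂ {e | e.degree = d} :=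
    homogeneousSubmodule_eq_finsupp_supported _ _ _
  rw [h1, Module.finrank_eq_nat_card_basis (basisRestrictSupport ℂ {e : Fin 4 →₀ ℕ | e.degree = d})]
  have h2 : {e : Fin 4 →₀ ℕ | e.degree = d} =
      ((Finset.univ : Finset (Fin 4)).finsuppAntidiag d : Set (Fin 4 →₀ ℕ)) := by
    ext e
    simp [Finset.mem_finsuppAntidiag, Finsupp.degree_eq_sum]
  rw [h2, Nat.card_eq_fintype_card]
  simp only [Finset.coe_sort_coe, Fintype.card_coe]
  rw [Finset.card_finsuppAntidiag_nat_eq_choose, Finset.card_univ, Fintype.card_fin]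
  rw [show 4 + d - 1 = d + 3 by omega, Nat.choose_symm_add]

instance (d : ℕ) : FiniteDimensional ℂ (homogeneousSubmodule (Fin 4) ℂ d) :=
  Module.Finite.iff_fg.2 (homogeneousSubmodule_fg _ _ _)

theorem six_mul_finrank_homogeneousSubmodule (d : ℕ) :
    6 * Module.finrank ℂ (homogeneousSubmodule (Fin 4) ℂ d) = (d + 1) * (d + 2) * (d + 3) := by
  rw [finrank_homogeneousSubmodule]
  have h := Nat.descFactorial_eq_factorial_mul_choose (d + 3) 3
  rw [show Nat.factorial 3 = 6 from rfl] at h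
  rw [← h]
  simp [Nat.descFactorial]
  ring

/-- The products of `f` with all forms of degree `k`. -/
noncomputable def multiples (f : MvPolynomial (Fin 4) ℂ) (k : ℕ) :
    Submodule ℂ (MvPolynomial (Fin 4) ℂ) :=
  (homogeneousSubmodule (Fin 4) ℂ k).map (LinearMap.mulLeft ℂ f)

instance (f : MvPolynomial (Fin 4) ℂ) (k : ℕ) : FiniteDimensional ℂ (multiples f k) := by
  unfold multiples; infer_instance

theorem mem_multiples {f x : MvPolynomial (Fin 4) ℂ} {k : ℕ} :
    x ∈ multiples f k ↔ ∃ y : MvPolynomial (Fin 4) ℂ, y.IsHomogeneous k ∧ f * y = x := by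
  simp [multiples, Submodule.mem_map]

theorem multiples_le {f : MvPolynomial (Fin 4) ℂ} {d : ℕ} (hf : f.IsHomogeneous d) {k D : ℕ}
    (h : D = d + k) : multiples f k ≤ homogeneousSubmodule (Fin 4) ℂ D := by
  intro x hx
  obtain ⟨y, hy, rfl⟩ := mem_multiples.1 hx
  rw [mem_homogeneousSubmodule, h]
  exact hf.mul hy

theorem finrank_map_mulLeft {f : MvPolynomial (Fin 4) ℂ} (hf : f ≠ 0)
    (U : Submodule ℂ (MvPolynomial (Fin 4) ℂ)) :
    Module.finrank ℂ (U.map (LinearMap.mulLeft ℂ f)) = Module.finrank ℂ U :=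
  (Submodule.equivMapOfInjective _ (mul_right_injective₀ hf) U).symm.finrank_eq

theorem finrank_multiples {f : MvPolynomial (Fin 4) ℂ} (hf : f ≠ 0) (k : ℕ) :
    Module.finrank ℂ (multiples f k) =
      Module.finrank ℂ (homogeneousSubmodule (Fin 4) ℂ k) :=
  finrank_map_mulLeft hf _

/-- Since `q` is prime and does not divide `c`, the only relation between the two is the obvious
one. -/
theorem multiples_inf_multiples {q c : MvPolynomial (Fin 4) ℂ} {d₁ d₂ : ℕ}
    (hqh : q.IsHomogeneous d₁) (hch : c.IsHomogeneous d₂) (hq : Prime q) (hqc : ¬ q ∣ c) (k : ℕ) :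
    multiples q (k + d₂) ⊓ multiples c (k + d₁) = multiples (q * c) k := by
  have hc0 : c ≠ 0 := fun h => hqc (h ▸ dvd_zero q)
  ext x
  simp only [Submodule.mem_inf, mem_multiples]
  constructor
  · rintro ⟨⟨y, hy, rfl⟩, z, hz, hzy⟩
    obtain ⟨w, rfl⟩ : q ∣ z := (hq.dvd_or_dvd ⟨y, hzy⟩).resolve_left hqc
    have h1 : q * c * w = q * y := by rw [← hzy]; ring
    refine ⟨w, ?_, h1⟩
    by_cases hw : w = 0
    · exact hw ▸ isHomogeneous_zero _ _ _
    · obtain ⟨a, b, hab, ha, hb⟩ := exists_isHomogeneous_of_mul hz (mul_ne_zero hq.ne_zero hw) rfl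
      have := ha.inj_right hqh hq.ne_zero
      rwa [show b = k by omega] at hb
  · rintro ⟨w, hw, rfl⟩
    exact ⟨⟨c * w, by simpa [add_comm] using hch.mul hw, by ring⟩,
      ⟨q * w, by simpa [add_comm] using hqh.mul hw, by ring⟩⟩

theorem finrank_multiples_sup {q c : MvPolynomial (Fin 4) ℂ} {d₁ d₂ : ℕ}
    (hqh : q.IsHomogeneous d₁) (hch : c.IsHomogeneous d₂) (hq : Prime q) (hqc : ¬ q ∣ c) (k : ℕ) :
    Module.finrank ℂ ↥(multiples q (k + d₂) ⊔ multiples c (k + d₁)) +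
      Module.finrank ℂ (homogeneousSubmodule (Fin 4) ℂ k) =
    Module.finrank ℂ (homogeneousSubmodule (Fin 4) ℂ (k + d₂)) +
      Module.finrank ℂ (homogeneousSubmodule (Fin 4) ℂ (k + d₁)) := by
  have hc0 : c ≠ 0 := fun h => hqc (h ▸ dvd_zero q)
  have h := Submodule.finrank_sup_add_finrank_inf_eq (multiples q (k + d₂)) (multiples c (k + d₁))
  rwa [multiples_inf_multiples hqh hch hq hqc, finrank_multiples hq.ne_zero, finrank_multiples hc0,
    finrank_multiples (mul_ne_zero hq.ne_zero hc0)] at h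

/-- The dimension of the degree `k + d₁ + d₂ + d₃` part of the ideal `(q, c, g)`. -/
theorem finrank_sup_multiples_add_le {q c g : MvPolynomial (Fin 4) ℂ} {d₁ d₂ d₃ : ℕ}
    (hqh : q.IsHomogeneous d₁) (hch : c.IsHomogeneous d₂) (hgh : g.IsHomogeneous d₃)
    (hq : Prime q) (hqc : ¬ q ∣ c) (k : ℕ) :
    Module.finrank ℂ ↥(multiples q (k + d₃ + d₂) ⊔ multiples c (k + d₃ + d₁) ⊔
        multiples g (k + d₁ + d₂)) + d₁ * d₂ * d₃ ≤
      Module.finrank ℂ (homogeneousSubmodule (Fin 4) ℂ (k + d₁ + d₂ + d₃)) := by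
  set A := multiples q (k + d₃ + d₂) ⊔ multiples c (k + d₃ + d₁)
  set B := multiples q (k + d₂) ⊔ multiples c (k + d₁)
  have hA := finrank_multiples_sup hqh hch hq hqc (k + d₃)
  have hB := finrank_multiples_sup hqh hch hq hqc k
  -- Multiplication by `g` embeds `B`, the part of `(q, c)` of degree lower by `d₃`, into the
  -- intersection of `A` with the multiples of `g`. Only an inequality results, as `g` may be a zero
  -- divisor modulo `(q, c)`.
  have key : Module.finrank ℂ ↥(A ⊔ multiples g (k + d₁ + d₂)) + Module.finrank ℂ B ≤
      Module.finrank ℂ A + Module.finrank ℂ (homogeneousSubmodule (Fin 4) ℂ (k + d₁ + d₂)) := by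
    have hBle : B ≤ homogeneousSubmodule (Fin 4) ℂ (k + d₁ + d₂) :=
      sup_le (multiples_le hqh (by omega)) (multiples_le hch (by omega))
    by_cases hg : g = 0
    · have : multiples g (k + d₁ + d₂) = ⊥ := by
        rw [eq_bot_iff]
        intro x hx
        obtain ⟨y, _, rfl⟩ := mem_multiples.1 hx
        simp [hg]
      rw [this, sup_bot_eq]
      exact Nat.add_le_add_left (Submodule.finrank_mono hBle) _
    · have h := Submodule.finrank_sup_add_finrank_inf_eq A (multiples g (k + d₁ + d₂))
      rw [finrank_multiples hg] at h
      rw [← h, ← finrank_map_mulLeft hg B]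
      refine Nat.add_le_add_left (Submodule.finrank_mono (le_inf ?_ (Submodule.map_mono hBle))) _
      rw [Submodule.map_sup]
      refine sup_le_sup ?_ ?_
      · rintro _ ⟨_, hy, rfl⟩
        obtain ⟨y, hy', rfl⟩ := mem_multiples.1 hy
        refine mem_multiples.2 ⟨g * y, ?_, by simp [mul_left_comm]⟩
        simpa [add_comm, add_left_comm] using hgh.mul hy'
      · rintro _ ⟨_, hy, rfl⟩
        obtain ⟨y, hy', rfl⟩ := mem_multiples.1 hy
        refine mem_multiples.2 ⟨g * y, ?_, by simp [mul_left_comm]⟩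
        simpa [add_comm, add_left_comm] using hgh.mul hy'
  -- The remaining alternating sum is a third difference, with steps `d₁`, `d₂`, `d₃`, of the cubic
  -- polynomial `(d+1)(d+2)(d+3)/6`, so it equals `d₁ d₂ d₃`.
  have e := fun d => six_mul_finrank_homogeneousSubmodule d
  have e0 := e k
  have e1 := e (k + d₁)
  have e2 := e (k + d₂)
  have e3 := e (k + d₃)
  have e12 := e (k + d₁ + d₂)
  have e13 := e (k + d₃ + d₁)
  have e23 := e (k + d₃ + d₂)
  have e123 := e (k + d₁ + d₂ + d₃)
  zify at *
  nlinarith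

theorem homogeneousComponent_mul_of_isHomogeneous {n : Type*} {f : MvPolynomial n ℂ} {d : ℕ}
    (hf : f.IsHomogeneous d) (a : MvPolynomial n ℂ) (k : ℕ) :
    homogeneousComponent (d + k) (f * a) = f * homogeneousComponent k a := by
  conv_lhs => rw [← sum_homogeneousComponent a, Finset.mul_sum, map_sum]
  have h : ∀ i, (f * homogeneousComponent i a).IsHomogeneous (d + i) := fun i =>
    hf.mul (homogeneousComponent_isHomogeneous i a)
  simp_rw [fun i => homogeneousComponent_of_mem (m := d + k) (h i), Nat.add_left_cancel_iff]
  rw [Finset.sum_ite_eq]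
  split_ifs with hk
  · rfl
  · rw [homogeneousComponent_eq_zero, mul_zero]
    simpa using hk

theorem mem_sup_multiples {q c g : MvPolynomial (Fin 4) ℂ} {d₁ d₂ d₃ : ℕ}
    (hqh : q.IsHomogeneous d₁) (hch : c.IsHomogeneous d₂) (hgh : g.IsHomogeneous d₃) (k : ℕ)
    {f : MvPolynomial (Fin 4) ℂ} (hf : f.IsHomogeneous (k + d₁ + d₂ + d₃))
    (hfI : f ∈ Ideal.span {q, c, g}) :
    f ∈ multiples q (k + d₃ + d₂) ⊔ multiples c (k + d₃ + d₁) ⊔ multiples g (k + d₁ + d₂) := by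
  obtain ⟨x, y, z, rfl⟩ : ∃ x y z, f = q * x + c * y + g * z := by
    obtain ⟨x, b, hb, h₁⟩ := Ideal.mem_span_insert.1 hfI
    obtain ⟨y, b', hb', h₂⟩ := Ideal.mem_span_insert.1 hb
    obtain ⟨z, h₃⟩ := Ideal.mem_span_singleton'.1 hb'
    exact ⟨x, y, z, by rw [h₁, h₂, ← h₃]; ring⟩
  have h := homogeneousComponent_of_mem (m := k + d₁ + d₂ + d₃) hf
  rw [if_pos rfl, map_add, map_add] at h
  rw [← h]
  refine Submodule.add_mem_sup (Submodule.add_mem_sup ?_ ?_) ?_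
  · rw [show k + d₁ + d₂ + d₃ = d₁ + (k + d₃ + d₂) by omega,
      homogeneousComponent_mul_of_isHomogeneous hqh]
    exact mem_multiples.2 ⟨_, homogeneousComponent_isHomogeneous _ _, rfl⟩
  · rw [show k + d₁ + d₂ + d₃ = d₂ + (k + d₃ + d₁) by omega,
      homogeneousComponent_mul_of_isHomogeneous hch]
    exact mem_multiples.2 ⟨_, homogeneousComponent_isHomogeneous _ _, rfl⟩
  · rw [show k + d₁ + d₂ + d₃ = d₃ + (k + d₁ + d₂) by omega,
      homogeneousComponent_mul_of_isHomogeneous hgh]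
    exact mem_multiples.2 ⟨_, homogeneousComponent_isHomogeneous _ _, rfl⟩

end HilbertFunction

/-! ### Local algebra of the leading forms -/

section LocalAlgebra

-- If, up to the factor `t` that is a unit at `m`, the leading forms of `I` include `z`, `x²` and
-- `y²`, they include all cubic monomials. Nakayama's lemma then puts `p ^ 3` into `I` after
-- localization at `m`; the element `r` is the denominator.
open scoped Pointwise in
theorem exists_mul_mem_of_leading_forms {R : Type*} [CommRing R] {I p m : Ideal R} {t x y z : R}
    (hpm : p ≤ m) (ht : 1 - t ∈ m) (hp : p = Ideal.span {x, y, z})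
    (hz : t * z ∈ I ⊔ p ^ 2) (hx : t * x ^ 2 ∈ I ⊔ p ^ 3) (hy : t * y ^ 2 ∈ I ⊔ p ^ 3) :
    ∃ r, r - 1 ∈ m ∧ ∀ f ∈ I ⊔ p ^ 3, r * f ∈ I := by
  have hmul : ∀ (k l : ℕ) (a b : R), t * a ∈ I ⊔ p ^ k → b ∈ p ^ l → t * (a * b) ∈ I ⊔ p ^ (k + l) := by
    intro k l a b ha hb
    obtain ⟨i, hi, j, hj, hij⟩ := Submodule.mem_sup.1 ha
    rw [← mul_assoc, ← hij, add_mul, pow_add]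
    exact Submodule.add_mem_sup (Ideal.mul_mem_right _ _ hi) (Ideal.mul_mem_mul hj hb)
  have hxp : x ∈ p := hp ▸ Ideal.subset_span (by simp)
  have hyp : y ∈ p := hp ▸ Ideal.subset_span (by simp)
  have hzp : z ∈ p := hp ▸ Ideal.subset_span (by simp)
  have hz' : ∀ a ∈ p, ∀ b ∈ p, t * (z * (a * b)) ∈ I ⊔ p ^ (2 + 2) := fun a ha b hb =>
    hmul 2 2 z (a * b) hz (pow_two p ▸ Ideal.mul_mem_mul ha hb)
  have hx' : ∀ a ∈ p, t * (x ^ 2 * a) ∈ I ⊔ p ^ (3 + 1) := fun a ha =>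
    hmul 3 1 _ a hx ((pow_one p).symm ▸ ha)
  have hy' : ∀ a ∈ p, t * (y ^ 2 * a) ∈ I ⊔ p ^ (3 + 1) := fun a ha =>
    hmul 3 1 _ a hy ((pow_one p).symm ▸ ha)
  -- A cubic monomial in `x, y, z` contains `z`, or is a binary one and contains `x²` or `y²`.
  have h3 : ∀ f ∈ p ^ 3, t * f ∈ I ⊔ p ^ 4 := by
    have hle : p ^ 3 ≤ Submodule.comap (LinearMap.mulLeft R t) (I ⊔ p ^ 4) := by
      have : p ^ 3 = Ideal.span (({x, y, z} : Set R) * (({x, y, z} : Set R) * ({x, y, z} : Set R))) := by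
        rw [← Ideal.span_mul_span', ← Ideal.span_mul_span', ← hp]
        ring
      rw [this, Ideal.span_le]
      rintro _ ⟨a, ha, _, ⟨b, hb, c, hc, rfl⟩, rfl⟩
      simp only [SetLike.mem_coe, Submodule.mem_comap, LinearMap.mulLeft_apply]
      simp only [Set.mem_insert_iff, Set.mem_singleton_iff] at ha hb hc
      rcases ha with rfl | rfl | rfl
      · rcases hb with rfl | rfl | rfl
        · rcases hc with rfl | rfl | rfl
          · convert! hx' _ hxp using 2; ring
          · convert! hx' _ hyp using 2; ring
          · convert! hx' _ hzp using 2; ring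
        · rcases hc with rfl | rfl | rfl
          · convert! hx' _ hyp using 2; ring
          · convert! hy' _ hxp using 2; ring
          · convert! hz' _ hxp _ hyp using 2; ring
        · convert! hz' _ hxp _ (show c ∈ p by rcases hc with rfl | rfl | rfl <;> assumption) using 2
          ring
      · rcases hb with rfl | rfl | rfl
        · rcases hc with rfl | rfl | rfl
          · convert! hx' _ hyp using 2; ring
          · convert! hy' _ hxp using 2; ring
          · convert! hz' _ hxp _ hyp using 2; ring
        · convert! hy' _ (show c ∈ p by rcases hc with rfl | rfl | rfl <;> assumption) using 2
          ring
        · convert! hz' _ hyp _ (show c ∈ p by rcases hc with rfl | rfl | rfl <;> assumption) using 2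
          ring
      · exact hz' _ (by rcases hb with rfl | rfl | rfl <;> assumption) _
          (by rcases hc with rfl | rfl | rfl <;> assumption)
    exact fun f hf => hle hf
  have hfg : p.FG := hp ▸ Submodule.fg_span (Set.toFinite _)
  obtain ⟨r, hr, hrI⟩ := Submodule.exists_sub_one_mem_and_smul_le_of_fg_of_le_sup (I := m)
    (N := I) (N' := p ^ 3) (P := p ^ 3) (Ideal.FG.pow hfg) le_rfl (by
      intro f hf
      have : f = t * f + (1 - t) * f := by ring
      rw [this]
      refine add_mem ?_ (Submodule.mem_sup_right (Submodule.smul_mem_smul ht hf))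
      have h4 := h3 f hf
      refine sup_le_sup_left ?_ I h4
      rw [pow_succ' p 3, ← smul_eq_mul]
      exact Submodule.smul_mono_left hpm)
  refine ⟨r, hr, fun f hf => ?_⟩
  obtain ⟨i, hi, j, hj, rfl⟩ := Submodule.mem_sup.1 hf
  rw [mul_add]
  exact add_mem (Ideal.mul_mem_left _ _ hi) (hrI (Submodule.smul_mem_pointwise_smul _ _ _ hj))

/-- A pencil of binary quadratic forms without base points is spanned by two squares. -/
theorem exists_squares_of_pencil {α β γ α' β' γ' : ℂ}
    (h : ∀ x y : ℂ, α * x ^ 2 + β * x * y + γ * y ^ 2 = 0 →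
      α' * x ^ 2 + β' * x * y + γ' * y ^ 2 = 0 → x = 0 ∧ y = 0) :
    ∃ a b a' b' s t s' t' : ℂ, a * b' - a' * b ≠ 0 ∧
      (a ^ 2 = s * α + t * α' ∧ 2 * a * b = s * β + t * β' ∧ b ^ 2 = s * γ + t * γ') ∧
      (a' ^ 2 = s' * α + t' * α' ∧ 2 * a' * b' = s' * β + t' * β' ∧
        b' ^ 2 = s' * γ + t' * γ') := by
  have hquad : ∀ A B C : ℂ, ∃ x y : ℂ, ¬ (x = 0 ∧ y = 0) ∧ A * x ^ 2 + B * x * y + C * y ^ 2 = 0 := by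
    intro A B C
    by_cases hA : A = 0
    · exact ⟨1, 0, by simp, by simp [hA]⟩
    · obtain ⟨d, hd⟩ := IsAlgClosed.exists_pow_nat_eq (B ^ 2 - 4 * A * C) (n := 2) (by norm_num)
      refine ⟨(-B + d) / (2 * A), 1, by simp, ?_⟩
      field_simp
      linear_combination hd
  have hsq : ∀ A B C : ℂ, B ^ 2 = 4 * A * C → ∃ a b : ℂ, a ^ 2 = A ∧ 2 * a * b = B ∧ b ^ 2 = C := by
    intro A B C hABC
    by_cases hA : A = 0
    · obtain ⟨b, hb⟩ := IsAlgClosed.exists_pow_nat_eq C (n := 2) (by norm_num)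
      refine ⟨0, b, by simp [hA], ?_, hb⟩
      have : B = 0 := by simpa [hA] using hABC
      simp [this]
    · obtain ⟨a, ha⟩ := IsAlgClosed.exists_pow_nat_eq A (n := 2) (by norm_num)
      have ha0 : a ≠ 0 := by rintro rfl; exact hA (by simpa using ha.symm)
      refine ⟨a, B / (2 * a), ha, by field_simp, ?_⟩
      field_simp
      rw [hABC, ← ha]
      ring
  -- The discriminant is a binary quadratic form in the pencil parameters, so some member `(s, t)`
  -- is the square of a linear form `a x + b y`.
  obtain ⟨s, t, hst, hdisc⟩ := hquad (β ^ 2 - 4 * α * γ) (2 * β * β' - 4 * α * γ' - 4 * α' * γ)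
    (β' ^ 2 - 4 * α' * γ')
  obtain ⟨a, b, ha, hab, hb⟩ := hsq (s * α + t * α') (s * β + t * β') (s * γ + t * γ')
    (by linear_combination hdisc)
  have hL : s * (α * b ^ 2 - β * a * b + γ * a ^ 2) +
      t * (α' * b ^ 2 - β' * a * b + γ' * a ^ 2) = 0 := by
    linear_combination (-b ^ 2) * ha + a * b * hab - a ^ 2 * hb
  -- If this square were zero, the two forms would be proportional and have a common zero.
  have hLne : ¬ (a = 0 ∧ b = 0) := by
    rintro ⟨rfl, rfl⟩
    by_cases hs : s = 0
    · have ht : t ≠ 0 := fun ht => hst ⟨hs, ht⟩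
      have e1 : α' = 0 := by simpa [hs, ht] using ha.symm
      have e2 : β' = 0 := by simpa [hs, ht] using hab.symm
      have e3 : γ' = 0 := by simpa [hs, ht] using hb.symm
      obtain ⟨x, y, hxy, h0⟩ := hquad α β γ
      exact hxy (h x y h0 (by simp [e1, e2, e3]))
    · obtain ⟨x, y, hxy, h0⟩ := hquad α' β' γ'
      refine hxy (h x y ?_ h0)
      have : s * (α * x ^ 2 + β * x * y + γ * y ^ 2) = 0 := by
        linear_combination (-x ^ 2) * ha - x * y * hab - y ^ 2 * hb - t * h0
      simpa [hs] using this
  -- The zero `(b, -a)` of the first square is not a base point, so another member takes a nonzero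
  -- value `Q` there.
  obtain ⟨s₁, t₁, hQ⟩ : ∃ s₁ t₁ : ℂ, (s₁ * α + t₁ * α') * b ^ 2 - (s₁ * β + t₁ * β') * a * b +
      (s₁ * γ + t₁ * γ') * a ^ 2 ≠ 0 := by
    by_contra! hcon
    have h1 := hcon 1 0
    have h2 := hcon 0 1
    have := h b (-a) (by linear_combination h1) (by linear_combination h2)
    exact hLne ⟨by simpa using this.2, this.1⟩
  set A := s₁ * α + t₁ * α'
  set B := s₁ * β + t₁ * β'
  set C := s₁ * γ + t₁ * γ'
  set Q := A * b ^ 2 - B * a * b + C * a ^ 2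
  -- Adding `k (a x + b y)²` lowers the discriminant by `4 k Q`; this `k` makes it zero and yields
  -- the second square.
  set k := (B ^ 2 - 4 * A * C) / (4 * Q)
  have hk : 4 * Q * k = B ^ 2 - 4 * A * C := by
    simp only [k]; field_simp
  obtain ⟨a', b', ha', hab', hb'⟩ := hsq (A + k * a ^ 2) (B + k * (2 * a * b)) (C + k * b ^ 2)
    (by linear_combination -hk)
  refine ⟨a, b, a', b', s, t, s₁ + k * s, t₁ + k * t, ?_, ⟨ha, hab, hb⟩, ?_, ?_, ?_⟩
  · intro h0
    apply hQ
    have : Q = (a * b' - a' * b) ^ 2 := by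
      simp only [Q]
      linear_combination (-b ^ 2) * ha' + a * b * hab' - a ^ 2 * hb'
    rw [this, h0]; ring
  · rw [ha', ha]; simp only [A]; ring
  · rw [hab', hab]; simp only [B]; ring
  · rw [hb', hb]; simp only [C]; ring

end LocalAlgebra

/-! ### Local multiplicity at most four: leading monomials -/

section LocalBound

/-- An ideal that contains the homogeneous components of its elements. -/
def ContainsComponents {n : Type*} (I : Ideal (MvPolynomial n ℂ)) : Prop :=
  ∀ f ∈ I, ∀ k, homogeneousComponent k f ∈ I

/-- The local multiplicity at `v` of the projective scheme defined by `I` is at most four: there is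
a homogeneous ideal `J` that agrees with `I` near `v` and has codimension at most four in large
degrees. -/
def MultiplicityLeFour (I : Ideal (MvPolynomial (Fin 4) ℂ)) (v : Fin 4 → ℂ) : Prop :=
  ∃ J : Ideal (MvPolynomial (Fin 4) ℂ), I ≤ J ∧ ContainsComponents J ∧
    (∃ r, eval v r ≠ 0 ∧ ∀ f ∈ J, r * f ∈ I) ∧
    ∃ E, ∀ D ≥ E, ∃ w : Fin 4 → MvPolynomial (Fin 4) ℂ,
      homogeneousSubmodule (Fin 4) ℂ D ≤ J.restrictScalars ℂ ⊔ Submodule.span ℂ (Set.range w)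

theorem containsComponents_of_isHomogeneous {n : Type*} {I : Ideal (MvPolynomial n ℂ)}
    (h : letI := MvPolynomial.gradedAlgebra (σ := n) (R := ℂ)
      I.IsHomogeneous (homogeneousSubmodule n ℂ)) : ContainsComponents I :=
  fun _ hf k => homogeneousComponent_mem_of_mem h hf k

theorem containsComponents_span_pow {n : Type*} {s : Set (MvPolynomial n ℂ)}
    (hs : ∀ f ∈ s, ∃ d, f.IsHomogeneous d) (k : ℕ) : ContainsComponents (Ideal.span s ^ k) := by
  let := MvPolynomial.gradedAlgebra (σ := n) (R := ℂ)
  apply containsComponents_of_isHomogeneous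
  induction k with
  | zero =>
    rw [pow_zero, Ideal.one_eq_top]
    exact Ideal.IsHomogeneous.top _
  | succ k ih =>
    rw [pow_succ]
    exact Ideal.IsHomogeneous.mul ih (Ideal.homogeneous_span _ _ fun f hf => hs f hf)

theorem ContainsComponents.sup {n : Type*} {I J : Ideal (MvPolynomial n ℂ)}
    (hI : ContainsComponents I) (hJ : ContainsComponents J) : ContainsComponents (I ⊔ J) := by
  intro f hf k
  obtain ⟨a, ha, b, hb, rfl⟩ := Submodule.mem_sup.1 hf
  rw [map_add]
  exact Submodule.add_mem_sup (hI a ha k) (hJ b hb k)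

/-- The ideal of the first coordinate point of projective space. -/
noncomputable def coordIdeal : Ideal (MvPolynomial (Fin 4) ℂ) := Ideal.span {X 1, X 2, X 3}

/-- The exponent of a monomial in four variables. -/
noncomputable def expo (a b c d : ℕ) : Fin 4 →₀ ℕ := Finsupp.equivFunOnFinite.symm ![a, b, c, d]

theorem expo_eta (e : Fin 4 →₀ ℕ) : e = expo (e 0) (e 1) (e 2) (e 3) := by
  ext i
  fin_cases i <;> simp [expo]

theorem degree_fin_four (e : Fin 4 →₀ ℕ) : e.degree = e 0 + e 1 + e 2 + e 3 := by
  simp [Finsupp.degree_eq_sum, Fin.sum_univ_four]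

theorem monomial_expo (a b c d : ℕ) (r : ℂ) :
    (monomial (expo a b c d) r : MvPolynomial (Fin 4) ℂ) =
      C r * (X 0 ^ a * X 1 ^ b * X 2 ^ c * X 3 ^ d) := by
  rw [monomial_eq, Finsupp.prod_fintype _ _ (by simp), Fin.prod_univ_four]
  simp [expo]

theorem monomial_mem_coordIdeal_pow {e : Fin 4 →₀ ℕ} {k : ℕ} (h : k ≤ e 1 + e 2 + e 3) (r : ℂ) :
    monomial e r ∈ coordIdeal ^ k := by
  rw [expo_eta e, monomial_expo]
  refine Ideal.mul_mem_left _ _ (Ideal.pow_le_pow_right h ?_)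
  rw [pow_add, pow_add]
  have hX : ∀ i : Fin 4, i ∈ ({1, 2, 3} : Set (Fin 4)) →
      (X i : MvPolynomial (Fin 4) ℂ) ∈ coordIdeal := by
    intro i hi
    apply Ideal.subset_span
    simp only [Set.mem_insert_iff, Set.mem_singleton_iff] at hi
    rcases hi with rfl | rfl | rfl <;> simp
  rw [show (X 0 : MvPolynomial (Fin 4) ℂ) ^ e 0 * X 1 ^ e 1 * X 2 ^ e 2 * X 3 ^ e 3 =
    X 0 ^ e 0 * (X 1 ^ e 1 * X 2 ^ e 2 * X 3 ^ e 3) by ring]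
  refine Ideal.mul_mem_left _ _ (Ideal.mul_mem_mul (Ideal.mul_mem_mul ?_ ?_) ?_)
  all_goals exact Ideal.pow_mem_pow (hX _ (by simp)) _

theorem mem_of_support {U : Submodule ℂ (MvPolynomial (Fin 4) ℂ)} {f : MvPolynomial (Fin 4) ℂ}
    (h : ∀ e ∈ f.support, monomial e (1 : ℂ) ∈ U) : f ∈ U := by
  rw [f.as_sum]
  refine U.sum_mem fun e he => ?_
  have := U.smul_mem (coeff e f) (h e he)
  rwa [smul_monomial, smul_eq_mul, mul_one] at this

/-- The only monomials of order less than two at the first coordinate point are `X 0 ^ d` and `X 0 ^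
(d - 1) * X i`. Vanishing at the point excludes the former, and the prescribed coefficients cancel
the latter. -/
theorem support_of_leading_linear {u : MvPolynomial (Fin 4) ℂ} {d : ℕ} (hd : 1 ≤ d)
    (hu : u.IsHomogeneous d)
    (hord : u ∈ pointIdeal (Pi.single 0 1 : Fin 4 → ℂ) ^ 1)
    (h1 : coeff (expo (d - 1) 1 0 0) u = 0) (h2 : coeff (expo (d - 1) 0 1 0) u = 0)
    (h3 : coeff (expo (d - 1) 0 0 1) u = 1) {e : Fin 4 →₀ ℕ}
    (he : e ∈ (u - X 0 ^ (d - 1) * X 3).support) :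
    e.degree = d ∧ 2 ≤ e 1 + e 2 + e 3 := by
  have hmon : (X 0 ^ (d - 1) * X 3 : MvPolynomial (Fin 4) ℂ) = monomial (expo (d - 1) 0 0 1) 1 := by
    rw [monomial_expo]; simp
  have hhom : (u - X 0 ^ (d - 1) * X 3 : MvPolynomial (Fin 4) ℂ).IsHomogeneous d := by
    refine hu.sub ?_
    simpa [Nat.sub_add_cancel hd] using (isHomogeneous_X_pow (R := ℂ) (0 : Fin 4) (d - 1)).mul (isHomogeneous_X ℂ 3)
  have hdeg := degree_eq_of_mem_support hhom he
  refine ⟨hdeg, ?_⟩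
  by_contra hlt
  rw [mem_support_iff, coeff_sub, hmon, coeff_monomial] at he
  rw [degree_fin_four] at hdeg
  have h0 := mt (add_le_of_mem_support hu hord (e := e))
  have hcases : (e 0 = d ∧ e 1 = 0 ∧ e 2 = 0 ∧ e 3 = 0) ∨
      (e 0 = d - 1 ∧ e 1 = 1 ∧ e 2 = 0 ∧ e 3 = 0) ∨ (e 0 = d - 1 ∧ e 1 = 0 ∧ e 2 = 1 ∧ e 3 = 0) ∨
      (e 0 = d - 1 ∧ e 1 = 0 ∧ e 2 = 0 ∧ e 3 = 1) := by omega
  rcases hcases with ⟨e0, e1, e2, e3⟩ | ⟨e0, e1, e2, e3⟩ | ⟨e0, e1, e2, e3⟩ | ⟨e0, e1, e2, e3⟩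
  · apply he
    rw [if_neg, sub_zero]
    · exact notMem_support_iff.1 (h0 (by omega))
    · intro h
      have := DFunLike.congr_fun h 3
      simp [expo, e3] at this
  · apply he
    rw [expo_eta e, e0, e1, e2, e3, h1, if_neg, sub_zero]
    intro h
    have := DFunLike.congr_fun h 3
    simp [expo] at this
  · apply he
    rw [expo_eta e, e0, e1, e2, e3, h2, if_neg, sub_zero]
    intro h
    have := DFunLike.congr_fun h 3
    simp [expo] at this
  · apply he
    rw [expo_eta e, e0, e1, e2, e3, h3, if_pos rfl, sub_self]

/-- Only the leading terms free of `X 3` are subtracted. The others remain, because a second form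
with linear leading term `X 3` will absorb them. -/
theorem support_of_leading_quadratic {u : MvPolynomial (Fin 4) ℂ} {d : ℕ} (hd : 2 ≤ d)
    (hu : u.IsHomogeneous d)
    (hord : u ∈ pointIdeal (Pi.single 0 1 : Fin 4 → ℂ) ^ 2) {e : Fin 4 →₀ ℕ}
    (he : e ∈ (u - X 0 ^ (d - 2) * (C (coeff (expo (d - 2) 2 0 0) u) * X 1 ^ 2 +
      C (coeff (expo (d - 2) 1 1 0) u) * X 1 * X 2 +
      C (coeff (expo (d - 2) 0 2 0) u) * X 2 ^ 2)).support) :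
    3 ≤ e 1 + e 2 + e 3 ∨ 2 ≤ e 1 + e 2 + e 3 ∧ 1 ≤ e 3 := by
  have hmon : (X 0 ^ (d - 2) * (C (coeff (expo (d - 2) 2 0 0) u) * X 1 ^ 2 +
      C (coeff (expo (d - 2) 1 1 0) u) * X 1 * X 2 +
      C (coeff (expo (d - 2) 0 2 0) u) * X 2 ^ 2) : MvPolynomial (Fin 4) ℂ) =
      monomial (expo (d - 2) 2 0 0) (coeff (expo (d - 2) 2 0 0) u) +
      monomial (expo (d - 2) 1 1 0) (coeff (expo (d - 2) 1 1 0) u) +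
      monomial (expo (d - 2) 0 2 0) (coeff (expo (d - 2) 0 2 0) u) := by
    rw [monomial_expo, monomial_expo, monomial_expo]; ring
  have hne : ∀ {a b c d a' b' c' d' : ℕ}, expo a b c d = expo a' b' c' d' →
      a = a' ∧ b = b' ∧ c = c' ∧ d = d' := by
    intro a b c d a' b' c' d' h
    have h0 := DFunLike.congr_fun h 0
    have h1 := DFunLike.congr_fun h 1
    have h2 := DFunLike.congr_fun h 2
    have h3 := DFunLike.congr_fun h 3
    simp [expo] at h0 h1 h2 h3
    exact ⟨h0, h1, h2, h3⟩
  rw [mem_support_iff, hmon, coeff_sub, coeff_add, coeff_add, coeff_monomial, coeff_monomial,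
    coeff_monomial] at he
  by_contra hcon
  by_cases hdeg : e.degree = d
  · rw [degree_fin_four] at hdeg
    have h0 := mt (add_le_of_mem_support hu hord (e := e))
    by_cases hlt : e 1 + e 2 + e 3 < 2
    · apply he
      rw [notMem_support_iff.1 (h0 (by omega)), expo_eta e]
      rw [if_neg (fun h => by have := hne h; omega), if_neg (fun h => by have := hne h; omega),
        if_neg (fun h => by have := hne h; omega)]
      simp
    · have hcases : (e 0 = d - 2 ∧ e 1 = 2 ∧ e 2 = 0 ∧ e 3 = 0) ∨
        (e 0 = d - 2 ∧ e 1 = 1 ∧ e 2 = 1 ∧ e 3 = 0) ∨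
        (e 0 = d - 2 ∧ e 1 = 0 ∧ e 2 = 2 ∧ e 3 = 0) := by omega
      apply he
      rw [expo_eta e]
      rcases hcases with ⟨e0, e1, e2, e3⟩ | ⟨e0, e1, e2, e3⟩ | ⟨e0, e1, e2, e3⟩
      · rw [e0, e1, e2, e3, if_pos rfl, if_neg (fun h => by have := hne h; omega),
          if_neg (fun h => by have := hne h; omega)]
        simp
      · rw [e0, e1, e2, e3, if_neg (fun h => by have := hne h; omega), if_pos rfl,
          if_neg (fun h => by have := hne h; omega)]
        simp
      · rw [e0, e1, e2, e3, if_neg (fun h => by have := hne h; omega),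
          if_neg (fun h => by have := hne h; omega), if_pos rfl]
        simp
  · apply he
    rw [hu.coeff_eq_zero hdeg]
    rw [expo_eta e] at hdeg ⊢
    rw [degree_fin_four] at hdeg
    simp only [expo, Finsupp.equivFunOnFinite_symm_apply_apply, Matrix.cons_val] at hdeg
    rw [if_neg (fun h => by have := hne h; omega), if_neg (fun h => by have := hne h; omega),
      if_neg (fun h => by have := hne h; omega)]
    simp

end LocalBound

/-! ### The multiplicity bound at a coordinate point -/

section LocalBound

theorem coordIdeal_eq_span {a b a' b' : ℂ} (hdet : a * b' - a' * b ≠ 0) :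
    coordIdeal = Ideal.span {C a * X 1 + C b * X 2, C a' * X 1 + C b' * X 2, X 3} := by
  apply le_antisymm
  · rw [coordIdeal, Ideal.span_le]
    have h1 : ∀ r s : MvPolynomial (Fin 4) ℂ, r * (C a * X 1 + C b * X 2) +
        s * (C a' * X 1 + C b' * X 2) ∈
        Ideal.span {C a * X 1 + C b * X 2, C a' * X 1 + C b' * X 2, X 3} := fun r s =>
      add_mem (Ideal.mul_mem_left _ _ (Ideal.subset_span (by simp)))
        (Ideal.mul_mem_left _ _ (Ideal.subset_span (by simp)))
    have hd : C ((a * b' - a' * b)⁻¹) * C (a * b' - a' * b) = (1 : MvPolynomial (Fin 4) ℂ) := by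
      rw [← C_mul, inv_mul_cancel₀ hdet, C_1]
    simp only [C_sub, C_mul] at hd
    rintro _ (rfl | rfl | rfl)
    · convert! h1 (C ((a * b' - a' * b)⁻¹) * C b') (-(C ((a * b' - a' * b)⁻¹) * C b)) using 1
      linear_combination (-X 1) * hd
    · convert! h1 (-(C ((a * b' - a' * b)⁻¹) * C a')) (C ((a * b' - a' * b)⁻¹) * C a) using 1
      linear_combination (-X 2) * hd
    · exact Ideal.subset_span (by simp)
  · rw [Ideal.span_le]
    have h1 : ∀ r s : MvPolynomial (Fin 4) ℂ, r * X 1 + s * X 2 ∈ coordIdeal := fun r s =>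
      add_mem (Ideal.mul_mem_left _ _ (Ideal.subset_span (by simp)))
        (Ideal.mul_mem_left _ _ (Ideal.subset_span (by simp)))
    rintro _ (rfl | rfl | rfl)
    · exact h1 _ _
    · exact h1 _ _
    · exact Ideal.subset_span (by simp)

theorem containsComponents_coordIdeal_pow (k : ℕ) : ContainsComponents (coordIdeal ^ k) := by
  refine containsComponents_span_pow ?_ k
  rintro _ (rfl | rfl | rfl)
  all_goals exact ⟨1, isHomogeneous_X _ _⟩

theorem mul_mem_sup_of_mem {I p : Ideal (MvPolynomial (Fin 4) ℂ)} {x y : MvPolynomial (Fin 4) ℂ}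
    {k l : ℕ} (hx : x ∈ I ⊔ p ^ k) (hy : y ∈ p ^ l) : x * y ∈ I ⊔ p ^ (k + l) := by
  obtain ⟨i, hi, j, hj, rfl⟩ := Submodule.mem_sup.1 hx
  rw [add_mul, pow_add]
  exact Submodule.add_mem_sup (Ideal.mul_mem_right _ _ hi) (Ideal.mul_mem_mul hj hy)

theorem homogeneousSubmodule_le_of_expo {U : Submodule ℂ (MvPolynomial (Fin 4) ℂ)} {D : ℕ}
    (h : ∀ a b c d, a + b + c + d = D →
      (X 0 ^ a * X 1 ^ b * X 2 ^ c * X 3 ^ d : MvPolynomial (Fin 4) ℂ) ∈ U) :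
    homogeneousSubmodule (Fin 4) ℂ D ≤ U := by
  intro f hf
  refine mem_of_support fun e he => ?_
  have := degree_eq_of_mem_support hf he
  rw [expo_eta e, monomial_expo, C_1, one_mul]
  exact h _ _ _ _ (by rw [← this, degree_fin_four])

/-- With `x`, `y` the two linear forms in `X 1`, `X 2` and `z = X 3`, the local ring modulo `z + …`,
`x² + …`, `y² + …` is spanned by `1, x, y, xy`. -/
theorem multiplicityLeFour_coord {I : Ideal (MvPolynomial (Fin 4) ℂ)} (hI : ContainsComponents I)
    {E : ℕ} {a b a' b' : ℂ} (hdet : a * b' - a' * b ≠ 0)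
    {u : MvPolynomial (Fin 4) ℂ} (huI : u ∈ I) {d : ℕ} (hd : 1 ≤ d) (hdE : d ≤ E)
    (hu : ∀ e ∈ (u - X 0 ^ (d - 1) * X 3).support, e.degree = d ∧ 2 ≤ e 1 + e 2 + e 3)
    (hx : X 0 ^ E * (C a * X 1 + C b * X 2) ^ 2 ∈ I ⊔ coordIdeal ^ 3)
    (hy : X 0 ^ E * (C a' * X 1 + C b' * X 2) ^ 2 ∈ I ⊔ coordIdeal ^ 3) :
    MultiplicityLeFour I (Pi.single 0 1) := by
  have hp := coordIdeal_eq_span hdet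
  have hz : X 0 ^ E * X 3 ∈ I ⊔ coordIdeal ^ 2 := by
    have h1 : u - X 0 ^ (d - 1) * X 3 ∈ coordIdeal ^ 2 :=
      mem_of_support (U := (coordIdeal ^ 2).restrictScalars ℂ) fun e he =>
        (Submodule.restrictScalars_mem ℂ _ _).2 (monomial_mem_coordIdeal_pow (hu e he).2 1)
    have h2 : X 0 ^ (d - 1) * X 3 ∈ I ⊔ coordIdeal ^ 2 := by
      have := Submodule.add_mem_sup huI (neg_mem h1)
      rwa [neg_sub, add_sub_cancel] at this
    have := Ideal.mul_mem_left _ (X 0 ^ (E - (d - 1))) h2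
    rwa [← mul_assoc, ← pow_add, Nat.sub_add_cancel (by omega)] at this
  have hX : ∀ i : Fin 4, i ≠ 0 → (X i : MvPolynomial (Fin 4) ℂ) ∈ coordIdeal := by
    intro i hi
    fin_cases i
    · exact absurd rfl hi
    all_goals exact Ideal.subset_span (by simp)
  have hpm : coordIdeal ≤ pointIdeal (Pi.single 0 1 : Fin 4 → ℂ) := by
    rw [coordIdeal, Ideal.span_le]
    rintro _ (rfl | rfl | rfl)
    all_goals
      rw [SetLike.mem_coe, mem_pointIdeal_iff]
      simp
  obtain ⟨r, hr, hrI⟩ := exists_mul_mem_of_leading_forms hpm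
    (t := X 0 ^ E) (by rw [mem_pointIdeal_iff]; simp) hp hz hx hy
  -- Adding the cube of the ideal of the point does not change `I` near the point. The threshold `E
  -- + 2` lets `X 0 ^ (D - 2)` absorb the factor `X 0 ^ E` of the hypotheses.
  refine ⟨I ⊔ coordIdeal ^ 3, le_sup_left, hI.sup (containsComponents_coordIdeal_pow 3), ⟨r, ?_, hrI⟩,
    E + 2, fun D hD => ⟨![X 0 ^ D, X 0 ^ (D - 1) * X 1, X 0 ^ (D - 1) * X 2,
      X 0 ^ (D - 2) * ((C a * X 1 + C b * X 2) * (C a' * X 1 + C b' * X 2))], ?_⟩⟩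
  · rw [mem_pointIdeal_iff, map_sub, map_one, sub_eq_zero] at hr
    rw [hr]
    exact one_ne_zero
  set w : Fin 4 → MvPolynomial (Fin 4) ℂ := ![X 0 ^ D, X 0 ^ (D - 1) * X 1, X 0 ^ (D - 1) * X 2,
      X 0 ^ (D - 2) * ((C a * X 1 + C b * X 2) * (C a' * X 1 + C b' * X 2))] with hw
  set U := (I ⊔ coordIdeal ^ 3).restrictScalars ℂ ⊔ Submodule.span ℂ (Set.range w) with hU
  have hJU : ∀ f ∈ I ⊔ coordIdeal ^ 3, f ∈ U := fun f hf => Submodule.mem_sup_left hf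
  have hwU : ∀ i, w i ∈ U := fun i => Submodule.mem_sup_right (Submodule.subset_span ⟨i, rfl⟩)
  have hx' : X 0 ^ (D - 2) * (C a * X 1 + C b * X 2) ^ 2 ∈ U := by
    apply hJU
    have := Ideal.mul_mem_left _ (X 0 ^ (D - 2 - E)) hx
    rwa [← mul_assoc, ← pow_add, Nat.sub_add_cancel (by omega)] at this
  have hy' : X 0 ^ (D - 2) * (C a' * X 1 + C b' * X 2) ^ 2 ∈ U := by
    apply hJU
    have := Ideal.mul_mem_left _ (X 0 ^ (D - 2 - E)) hy
    rwa [← mul_assoc, ← pow_add, Nat.sub_add_cancel (by omega)] at this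
  have hz' : ∀ i : Fin 4, i ≠ 0 → X 0 ^ (D - 2) * (X 3 * X i) ∈ U := by
    intro i hi
    apply hJU
    have h1 := mul_mem_sup_of_mem hz ((pow_one coordIdeal).symm ▸ hX i hi)
    have := Ideal.mul_mem_left _ (X 0 ^ (D - 2 - E)) h1
    rwa [mul_assoc, ← mul_assoc, ← pow_add, Nat.sub_add_cancel (by omega)] at this
  -- The coefficients express a quadratic form in `X 1`, `X 2` in the basis `x², xy, y²`, by
  -- inverting the substitution of determinant `δ`.
  have hquad : ∀ α β γ : ℂ, X 0 ^ (D - 2) * (C α * X 1 ^ 2 + C β * X 1 * X 2 + C γ * X 2 ^ 2) ∈ U := by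
    intro α β γ
    set δ := a * b' - a' * b with hδ
    have hδ2 : (δ ^ 2)⁻¹ * δ ^ 2 = 1 := inv_mul_cancel₀ (pow_ne_zero 2 hdet)
    have h1 := U.smul_mem ((δ ^ 2)⁻¹ * (α * b' ^ 2 - β * a' * b' + γ * a' ^ 2)) hx'
    have h2 := U.smul_mem ((δ ^ 2)⁻¹ * (-2 * α * b * b' + β * (a * b' + a' * b) - 2 * γ * a * a'))
      (hwU 3)
    have h3 := U.smul_mem ((δ ^ 2)⁻¹ * (α * b ^ 2 - β * a * b + γ * a ^ 2)) hy'
    convert! U.add_mem (U.add_mem h1 h2) h3 using 1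
    simp only [hw, smul_eq_C_mul, Matrix.cons_val, C_mul, C_add, C_sub, C_pow, C_neg]
    have hC : C (δ ^ 2)⁻¹ * (C a * C b' - C a' * C b) ^ 2 = (1 : MvPolynomial (Fin 4) ℂ) := by
      rw [← C_mul, ← C_mul, ← C_sub, ← hδ, ← C_pow, ← C_mul, hδ2, C_1]
    have h2' : (C 2 : MvPolynomial (Fin 4) ℂ) = 2 := rfl
    rw [h2']
    linear_combination (-(X 0 ^ (D - 2) * (C α * X 1 ^ 2 + C β * X 1 * X 2 + C γ * X 2 ^ 2))) * hC
  have htwo : ∀ p q r s, p + q + r + s = D → 2 ≤ q + r + s →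
      (X 0 ^ p * X 1 ^ q * X 2 ^ r * X 3 ^ s : MvPolynomial (Fin 4) ℂ) ∈ U := by
    intro p q r s hs hsum
    by_cases h3 : 3 ≤ q + r + s
    · apply hJU
      have h4 : monomial (expo p q r s) (1 : ℂ) ∈ coordIdeal ^ 3 :=
        monomial_mem_coordIdeal_pow (by simpa [expo] using h3) 1
      rw [monomial_expo, C_1, one_mul] at h4
      exact Submodule.mem_sup_right h4
    · obtain rfl : p = D - 2 := by omega
      have hc : (q = 2 ∧ r = 0 ∧ s = 0) ∨ (q = 1 ∧ r = 1 ∧ s = 0) ∨ (q = 0 ∧ r = 2 ∧ s = 0) ∨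
        (q = 1 ∧ r = 0 ∧ s = 1) ∨ (q = 0 ∧ r = 1 ∧ s = 1) ∨ (q = 0 ∧ r = 0 ∧ s = 2) := by omega
      rcases hc with ⟨rfl, rfl, rfl⟩ | ⟨rfl, rfl, rfl⟩ | ⟨rfl, rfl, rfl⟩ | ⟨rfl, rfl, rfl⟩ |
        ⟨rfl, rfl, rfl⟩ | ⟨rfl, rfl, rfl⟩
      · convert! hquad 1 0 0 using 1; simp
      · convert! hquad 0 1 0 using 1; simp [mul_assoc]
      · convert! hquad 0 0 1 using 1; simp
      · convert! hz' 1 (by decide) using 1; ring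
      · convert! hz' 2 (by decide) using 1; ring
      · convert! hz' 3 (by decide) using 1; ring
  -- Modulo `u ∈ I`, this monomial is a combination of monomials of order at least two, which are
  -- already covered.
  have hone : X 0 ^ (D - 1) * X 3 ∈ U := by
    have h1 : X 0 ^ (D - d) * (u - X 0 ^ (d - 1) * X 3) ∈ U := by
      have : u - X 0 ^ (d - 1) * X 3 ∈ U.comap (LinearMap.mulLeft ℂ (X 0 ^ (D - d))) := by
        refine mem_of_support fun e he => ?_
        rw [Submodule.mem_comap, LinearMap.mulLeft_apply, expo_eta e, monomial_expo, C_1, one_mul]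
        obtain ⟨h2, h3⟩ := hu e he
        rw [degree_fin_four] at h2
        convert! htwo (D - d + e 0) (e 1) (e 2) (e 3) (by omega) h3 using 1
        ring
      exact this
    have h2 : X 0 ^ (D - d) * u ∈ U := hJU _ (Submodule.mem_sup_left (Ideal.mul_mem_left _ _ huI))
    have h3 := U.sub_mem h2 h1
    rwa [← mul_sub, sub_sub_cancel, ← mul_assoc, ← pow_add,
      show D - d + (d - 1) = D - 1 by omega] at h3
  refine homogeneousSubmodule_le_of_expo fun p q r s hs => ?_
  by_cases h2 : 2 ≤ q + r + s
  · exact htwo p q r s hs h2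
  · have hc : (p = D ∧ q = 0 ∧ r = 0 ∧ s = 0) ∨ (p = D - 1 ∧ q = 1 ∧ r = 0 ∧ s = 0) ∨
      (p = D - 1 ∧ q = 0 ∧ r = 1 ∧ s = 0) ∨ (p = D - 1 ∧ q = 0 ∧ r = 0 ∧ s = 1) := by omega
    rcases hc with ⟨rfl, rfl, rfl, rfl⟩ | ⟨rfl, rfl, rfl, rfl⟩ | ⟨rfl, rfl, rfl, rfl⟩ |
      ⟨rfl, rfl, rfl, rfl⟩
    · simpa [hw] using hwU 0
    · simpa [hw] using hwU 1
    · simpa [hw] using hwU 2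
    · simpa using hone

end LocalBound

/-! ### From Taylor forms to leading monomials -/

section LocalBound

/-- Translation by the coordinate vector substitutes `1 + X 0` for `X 0`; putting `X 0 = 0`
afterwards is dehomogenization, and it leaves coefficients of monomials without `X 0` alone. -/
theorem coeff_translate_coord {u : MvPolynomial (Fin 4) ℂ} {d : ℕ} (hu : u.IsHomogeneous d)
    {a b c g : ℕ} (h : a + b + c + g = d) :
    coeff (expo 0 b c g) (translate (Pi.single 0 1) u) = coeff (expo a b c g) u := by
  have h1 : (expo a b c g).degree = d := by
    rw [degree_fin_four, ← h]
    simp [expo]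
  rw [← coeff_dehomogenize hu 0 h1]
  have h2 : (expo a b c g).erase 0 = expo 0 b c g := by
    ext i
    fin_cases i <;> simp [expo]
  rw [h2]
  let ψ : MvPolynomial (Fin 4) ℂ →ₐ[ℂ] MvPolynomial (Fin 4) ℂ :=
    aeval fun j => if j = 0 then 0 else X j
  have h3 : dehomogenize 0 u = ψ (translate (Pi.single 0 1) u) := by
    have : dehomogenize (0 : Fin 4) = ψ.comp (translate (Pi.single 0 1)) := by
      ext1 i
      fin_cases i <;> simp [dehomogenize, ψ, translate]
    rw [this]; rfl
  have h4 : ∀ p : MvPolynomial (Fin 4) ℂ,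
      coeff (expo 0 b c g) (ψ p) = coeff (expo 0 b c g) p := by
    intro p
    induction p using MvPolynomial.induction_on' with
    | monomial e r =>
      by_cases he : e 0 = 0
      · congr 1
        rw [expo_eta e, he, monomial_expo]
        simp [ψ, algHom_C]
      · have : ψ (monomial e r) = 0 := by
          rw [expo_eta e, monomial_expo]
          simp [ψ, he]
        rw [this, coeff_zero, coeff_monomial, if_neg]
        intro h
        exact he (by rw [h]; simp [expo])
    | add p q hp hq => simp only [map_add, coeff_add, hp, hq]
  rw [h3, h4]

theorem coeff_taylor_coord {u : MvPolynomial (Fin 4) ℂ} {d : ℕ} (hu : u.IsHomogeneous d)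
    {a b c g k : ℕ} (h : a + b + c + g = d) (hk : b + c + g = k) :
    coeff (expo 0 b c g) (taylor (Pi.single 0 1) k u) = coeff (expo a b c g) u := by
  rw [taylor, coeff_homogeneousComponent, if_pos, coeff_translate_coord hu h]
  rw [degree_fin_four, ← hk]
  simp [expo]

theorem eval_of_isHomogeneous_two {p : MvPolynomial (Fin 4) ℂ} (hp : p.IsHomogeneous 2) (x y : ℂ) :
    eval ![0, x, y, 0] p = coeff (expo 0 2 0 0) p * x ^ 2 + coeff (expo 0 1 1 0) p * x * y +
      coeff (expo 0 0 2 0) p * y ^ 2 := by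
  have key : ∀ r : MvPolynomial (Fin 4) ℂ, r.IsHomogeneous 2 → coeff (expo 0 2 0 0) r = 0 →
      coeff (expo 0 1 1 0) r = 0 → coeff (expo 0 0 2 0) r = 0 → eval ![0, x, y, 0] r = 0 := by
    intro r hr h1 h2 h3
    rw [eval_eq']
    refine Finset.sum_eq_zero fun e he => ?_
    have hdeg := degree_eq_of_mem_support hr he
    rw [degree_fin_four] at hdeg
    rw [Fin.prod_univ_four]
    have hc : e 0 ≠ 0 ∨ e 3 ≠ 0 ∨ (e 0 = 0 ∧ e 1 = 2 ∧ e 2 = 0 ∧ e 3 = 0) ∨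
      (e 0 = 0 ∧ e 1 = 1 ∧ e 2 = 1 ∧ e 3 = 0) ∨ (e 0 = 0 ∧ e 1 = 0 ∧ e 2 = 2 ∧ e 3 = 0) := by omega
    rcases hc with h | h | ⟨e0, e1, e2, e3⟩ | ⟨e0, e1, e2, e3⟩ | ⟨e0, e1, e2, e3⟩
    · simp [h]
    · simp [h]
    · rw [expo_eta e, e0, e1, e2, e3, h1, zero_mul]
    · rw [expo_eta e, e0, e1, e2, e3, h2, zero_mul]
    · rw [expo_eta e, e0, e1, e2, e3, h3, zero_mul]
  have hne : ∀ {a b c d a' b' c' d' : ℕ}, expo a b c d = expo a' b' c' d' → b = b' := by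
    intro a b c d a' b' c' d' h
    simpa [expo] using DFunLike.congr_fun h 1
  have hm : ∀ a b c d (r : ℂ), a + b + c + d = 2 →
      (monomial (expo a b c d) r : MvPolynomial (Fin 4) ℂ).IsHomogeneous 2 := by
    intro a b c d r h
    refine isHomogeneous_monomial r ?_
    rw [degree_fin_four, ← h]
    simp [expo]
  have h := key (p - monomial (expo 0 2 0 0) (coeff (expo 0 2 0 0) p) -
    monomial (expo 0 1 1 0) (coeff (expo 0 1 1 0) p) -
    monomial (expo 0 0 2 0) (coeff (expo 0 0 2 0) p))
    (((hp.sub (hm _ _ _ _ _ rfl)).sub (hm _ _ _ _ _ rfl)).sub (hm _ _ _ _ _ rfl)) ?_ ?_ ?_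
  · rw [map_sub, map_sub, map_sub, monomial_expo, monomial_expo, monomial_expo] at h
    simp at h
    linear_combination h
  all_goals
    simp only [coeff_sub, coeff_monomial, if_true]
    repeat rw [if_neg (fun h => by have := hne h; omega)]
    simp

/-- On the kernel of the linear leading form, modulo the point itself, the two quadratic leading
forms are a base-point-free binary pencil. It is spanned by two squares, which is the input of
`multiplicityLeFour_coord`. -/
theorem multiplicityLeFour_of_taylor_coord {I : Ideal (MvPolynomial (Fin 4) ℂ)}
    (hI : ContainsComponents I) {u₁ u₂ u₃ : MvPolynomial (Fin 4) ℂ} {d₁ d₂ d₃ : ℕ}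
    (hu₁ : u₁.IsHomogeneous d₁) (hu₂ : u₂.IsHomogeneous d₂) (hu₃ : u₃.IsHomogeneous d₃)
    (hd₁ : 1 ≤ d₁) (hd₂ : 2 ≤ d₂) (hd₃ : 2 ≤ d₃) (hI₁ : u₁ ∈ I) (hI₂ : u₂ ∈ I) (hI₃ : u₃ ∈ I)
    (ho₁ : u₁ ∈ pointIdeal (Pi.single 0 1 : Fin 4 → ℂ) ^ 1)
    (ho₂ : u₂ ∈ pointIdeal (Pi.single 0 1 : Fin 4 → ℂ) ^ 2)
    (ho₃ : u₃ ∈ pointIdeal (Pi.single 0 1 : Fin 4 → ℂ) ^ 2)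
    (hlin : taylor (Pi.single 0 1) 1 u₁ = X 3)
    (hpencil : ∀ x y : ℂ, eval ![0, x, y, 0] (taylor (Pi.single 0 1) 2 u₂) = 0 →
      eval ![0, x, y, 0] (taylor (Pi.single 0 1) 2 u₃) = 0 → x = 0 ∧ y = 0) :
    MultiplicityLeFour I (Pi.single 0 1) := by
  have hX3 : (X 3 : MvPolynomial (Fin 4) ℂ) = monomial (expo 0 0 0 1) 1 := by
    rw [monomial_expo]; simp
  have hne : ∀ {a b c d a' b' c' d' : ℕ}, expo a b c d = expo a' b' c' d' → d = d' := by
    intro a b c d a' b' c' d' h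
    simpa [expo] using DFunLike.congr_fun h 3
  have l1 := coeff_taylor_coord hu₁ (a := d₁ - 1) (b := 1) (c := 0) (g := 0) (k := 1) (by omega) rfl
  have l2 := coeff_taylor_coord hu₁ (a := d₁ - 1) (b := 0) (c := 1) (g := 0) (k := 1) (by omega) rfl
  have l3 := coeff_taylor_coord hu₁ (a := d₁ - 1) (b := 0) (c := 0) (g := 1) (k := 1) (by omega) rfl
  rw [hlin, hX3, coeff_monomial] at l1 l2 l3
  rw [if_neg (fun h => by have := hne h; omega)] at l1 l2
  rw [if_pos rfl] at l3
  have hsupp := fun e (he : e ∈ (u₁ - X 0 ^ (d₁ - 1) * X 3).support) =>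
    support_of_leading_linear hd₁ hu₁ ho₁ l1.symm l2.symm l3.symm he
  have hlead : X 0 ^ (d₁ - 1) * X 3 ∈ I ⊔ coordIdeal ^ 2 := by
    have h1 : u₁ - X 0 ^ (d₁ - 1) * X 3 ∈ coordIdeal ^ 2 :=
      mem_of_support (U := (coordIdeal ^ 2).restrictScalars ℂ) fun e he =>
        (Submodule.restrictScalars_mem ℂ _ _).2 (monomial_mem_coordIdeal_pow (hsupp e he).2 1)
    have := Submodule.add_mem_sup hI₁ (neg_mem h1)
    rwa [neg_sub, add_sub_cancel] at this
  have hquad : ∀ (u : MvPolynomial (Fin 4) ℂ) (d : ℕ), 2 ≤ d → u.IsHomogeneous d → u ∈ I →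
      u ∈ pointIdeal (Pi.single 0 1 : Fin 4 → ℂ) ^ 2 → d ≤ d₁ + d₂ + d₃ - (d₁ - 1) →
      X 0 ^ (d₁ + d₂ + d₃) * (C (coeff (expo (d - 2) 2 0 0) u) * X 1 ^ 2 +
        C (coeff (expo (d - 2) 1 1 0) u) * X 1 * X 2 +
        C (coeff (expo (d - 2) 0 2 0) u) * X 2 ^ 2) ∈ I ⊔ coordIdeal ^ 3 := by
    intro u d hd hu huI ho hle
    set Q : MvPolynomial (Fin 4) ℂ := C (coeff (expo (d - 2) 2 0 0) u) * X 1 ^ 2 +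
        C (coeff (expo (d - 2) 1 1 0) u) * X 1 * X 2 +
        C (coeff (expo (d - 2) 0 2 0) u) * X 2 ^ 2 with hQ
    -- A quadratic leading monomial divisible by `X 3` falls into `I ⊔ coordIdeal ^ 3` after
    -- multiplication by `X 0 ^ (d₁ - 1)`, by means of `u₁`.
    have h1 : X 0 ^ (d₁ - 1) * (u - X 0 ^ (d - 2) * Q) ∈ I ⊔ coordIdeal ^ 3 := by
      have : u - X 0 ^ (d - 2) * Q ∈
          ((I ⊔ coordIdeal ^ 3).restrictScalars ℂ).comap (LinearMap.mulLeft ℂ (X 0 ^ (d₁ - 1))) := by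
        refine mem_of_support fun e he => ?_
        rw [Submodule.mem_comap, LinearMap.mulLeft_apply, Submodule.restrictScalars_mem]
        rcases support_of_leading_quadratic hd hu ho he with h | ⟨h, h'⟩
        · exact Submodule.mem_sup_right (Ideal.mul_mem_left _ _ (monomial_mem_coordIdeal_pow h 1))
        · have h2 : monomial e (1 : ℂ) = X 3 * monomial (expo (e 0) (e 1) (e 2) (e 3 - 1)) 1 := by
            conv_lhs => rw [expo_eta e]
            rw [monomial_expo, monomial_expo]
            obtain ⟨m, hm⟩ := Nat.exists_eq_add_of_le h'
            rw [hm, Nat.add_sub_cancel_left]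
            ring
          have h3 : monomial (expo (e 0) (e 1) (e 2) (e 3 - 1)) (1 : ℂ) ∈ coordIdeal ^ 1 :=
            monomial_mem_coordIdeal_pow (by simp [expo]; omega) 1
          have := mul_mem_sup_of_mem hlead h3
          rw [h2]
          convert! this using 1
          ring
      exact this
    have h2 : X 0 ^ (d₁ - 1) * u ∈ I ⊔ coordIdeal ^ 3 :=
      Submodule.mem_sup_left (Ideal.mul_mem_left _ _ huI)
    have h3 := Ideal.mul_mem_left _ (X 0 ^ (d₁ + d₂ + d₃ - (d₁ - 1) - (d - 2))) (sub_mem h2 h1)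
    rw [← mul_sub, sub_sub_cancel, ← mul_assoc, ← mul_assoc, ← pow_add, ← pow_add] at h3
    convert! h3 using 3
    omega
  have hq₂ := hquad u₂ d₂ hd₂ hu₂ hI₂ ho₂ (by omega)
  have hq₃ := hquad u₃ d₃ hd₃ hu₃ hI₃ ho₃ (by omega)
  have hco : ∀ (u : MvPolynomial (Fin 4) ℂ) (d : ℕ), 2 ≤ d → u.IsHomogeneous d → ∀ x y : ℂ,
      eval ![0, x, y, 0] (taylor (Pi.single 0 1) 2 u) =
        coeff (expo (d - 2) 2 0 0) u * x ^ 2 + coeff (expo (d - 2) 1 1 0) u * x * y +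
        coeff (expo (d - 2) 0 2 0) u * y ^ 2 := by
    intro u d hd hu x y
    rw [eval_of_isHomogeneous_two (isHomogeneous_taylor _ _ _),
      coeff_taylor_coord hu (a := d - 2) (by omega) rfl,
      coeff_taylor_coord hu (a := d - 2) (by omega) rfl,
      coeff_taylor_coord hu (a := d - 2) (by omega) rfl]
  obtain ⟨a, b, a', b', s, t, s', t', hdet, ⟨e1, e2, e3⟩, e1', e2', e3'⟩ :=
    exists_squares_of_pencil fun x y h2 h3 =>
      hpencil x y ((hco u₂ d₂ hd₂ hu₂ x y).trans h2) ((hco u₃ d₃ hd₃ hu₃ x y).trans h3)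
  have hcomb : ∀ a b s t : ℂ,
      a ^ 2 = s * coeff (expo (d₂ - 2) 2 0 0) u₂ + t * coeff (expo (d₃ - 2) 2 0 0) u₃ →
      2 * a * b = s * coeff (expo (d₂ - 2) 1 1 0) u₂ + t * coeff (expo (d₃ - 2) 1 1 0) u₃ →
      b ^ 2 = s * coeff (expo (d₂ - 2) 0 2 0) u₂ + t * coeff (expo (d₃ - 2) 0 2 0) u₃ →
      X 0 ^ (d₁ + d₂ + d₃) * (C a * X 1 + C b * X 2) ^ 2 ∈ I ⊔ coordIdeal ^ 3 := by
    intro a b s t e1 e2 e3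
    convert! add_mem (Ideal.mul_mem_left _ (C s) hq₂) (Ideal.mul_mem_left _ (C t) hq₃) using 1
    have f1 := congrArg (C (σ := Fin 4)) e1
    have f2 := congrArg (C (σ := Fin 4)) e2
    have f3 := congrArg (C (σ := Fin 4)) e3
    have h2 : (C 2 : MvPolynomial (Fin 4) ℂ) = 2 := rfl
    simp only [C_mul, C_add, C_pow, h2] at f1 f2 f3
    linear_combination X 0 ^ (d₁ + d₂ + d₃) * (X 1 ^ 2 * f1 + X 1 * X 2 * f2 + X 2 ^ 2 * f3)
  exact multiplicityLeFour_coord hI hdet hI₁ hd₁ (by omega) hsupp (hcomb a b s t e1 e2 e3)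
    (hcomb a' b' s' t' e1' e2' e3')

end LocalBound

/-! ### Bases and coordinate changes -/

section LinearAlgebra

variable {n : ℕ}

theorem exists_linearIndependent_snoc {k : ℕ} {V : Type*} [AddCommGroup V] [Module ℂ V]
    [FiniteDimensional ℂ V] {A : Fin k → V} (hA : LinearIndependent ℂ A) {W : Submodule ℂ V}
    (h : k < Module.finrank ℂ W) : ∃ x ∈ W, LinearIndependent ℂ (Fin.snoc A x : Fin (k + 1) → V) := by
  obtain ⟨x, hxW, hx⟩ : ∃ x ∈ W, x ∉ Submodule.span ℂ (Set.range A) := by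
    by_contra! hcon
    have := Submodule.finrank_mono (show W ≤ Submodule.span ℂ (Set.range A) from hcon)
    rw [finrank_span_eq_card hA, Fintype.card_fin] at this
    omega
  exact ⟨x, hxW, linearIndependent_finSnoc.2 ⟨hA, hx⟩⟩

theorem exists_inverse_pull {b : Fin n → Fin n → ℂ} (hb : LinearIndependent ℂ b) :
    ∃ φ : Fin n → Fin n → ℂ, (∀ f, pull φ (pull b f) = f) ∧ (∀ f, pull b (pull φ f) = f) ∧
      (∀ y, ∑ j, (∑ i, y i • φ i) j • b j = y) := by
  let B : Module.Basis (Fin n) ℂ (Fin n → ℂ) :=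
    basisOfLinearIndependentOfCardEqFinrank' b hb (by simp)
  have hB : ∀ j, B j = b j := fun j => by simp [B]
  let φ : Fin n → Fin n → ℂ := fun i => ⇑(B.repr (Pi.single i 1))
  have h1 : ∀ y : Fin n → ℂ, ∑ j, (∑ i, y i • φ i) j • b j = y := by
    intro y
    have : (∑ i, y i • φ i) = ⇑(B.repr y) := by
      have hy : y = ∑ i, y i • Pi.single i (1 : ℂ) := by
        ext j
        simp [Finset.sum_apply, Pi.single_apply]
      conv_rhs => rw [hy, map_sum]
      ext j
      simp [φ, Finset.sum_apply, Finsupp.finsetSum_apply]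
    rw [this]
    simp_rw [← hB]
    exact B.sum_repr y
  have h2 : ∀ y : Fin n → ℂ, ∑ i, (∑ j, y j • b j) i • φ i = y := by
    intro y
    apply hb.fintypeLinearCombination_injective
    simp only [Fintype.linearCombination_apply]
    exact h1 _
  refine ⟨φ, fun f => MvPolynomial.funext fun y => ?_, fun f => MvPolynomial.funext fun y => ?_, h1⟩
  · rw [eval_pull, eval_pull, h1]
  · rw [eval_pull, eval_pull, h2]

theorem exists_eq_sum_of_isHomogeneous_one {p : MvPolynomial (Fin n) ℂ} (hp : p.IsHomogeneous 1) :
    ∃ c : Fin n → ℂ, p = ∑ i, C (c i) * X i := by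
  rw [← mem_homogeneousSubmodule, homogeneousSubmodule_one_eq_span_X,
    Submodule.mem_span_range_iff_exists_fun] at hp
  obtain ⟨c, rfl⟩ := hp
  exact ⟨c, Finset.sum_congr rfl fun i _ => smul_eq_C_mul _ _⟩

theorem homogeneousComponent_pull {m n : Type*} [Fintype m] (A : m → n → ℂ) (k : ℕ)
    (f : MvPolynomial n ℂ) :
    homogeneousComponent k (pull A f) = pull A (homogeneousComponent k f) :=
  homogeneousComponent_aeval
    (fun _ => IsHomogeneous.sum _ _ _ fun _ _ => isHomogeneous_C_mul_X _ _) _ _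

/-- `f` vanishes on the whole line `v + t v`, hence so does each coefficient of its expansion in
`t`. -/
theorem eval_taylor_self {v : Fin n → ℂ} {d : ℕ} {f : MvPolynomial (Fin n) ℂ}
    (hf : f.IsHomogeneous d) (hv : eval v f = 0) (k : ℕ) : eval v (taylor v k f) = 0 := by
  let p : Polynomial ℂ :=
    ∑ j ∈ Finset.range (d + 1), Polynomial.monomial j (eval v (taylor v j f))
  have hp : p = 0 := by
    refine Polynomial.funext fun t => ?_
    have h1 := eval_add_eq_sum_taylor v (t • v) (d := d) hf.totalDegree_le
    have h2 : eval (v + t • v) f = 0 := by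
      rw [show v + t • v = (1 + t) • v by rw [add_smul, one_smul], IsHomogeneous.eval_smul hf, hv,
        mul_zero]
    rw [h2] at h1
    rw [Polynomial.eval_finsetSum, Polynomial.eval_zero, h1]
    refine Finset.sum_congr rfl fun j _ => ?_
    rw [Polynomial.eval_monomial, IsHomogeneous.eval_smul (isHomogeneous_taylor v j f), mul_comm]
  by_cases hk : k ≤ d
  · have := congrArg (fun q => Polynomial.coeff q k) hp
    simpa [p, Polynomial.finsetSum_coeff, Polynomial.coeff_monomial, Finset.sum_ite_eq', Nat.lt_succ_iff, hk] using this
  · rw [taylor, homogeneousComponent_eq_zero, map_zero]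
    have := totalDegree_translate_le v f
    have := hf.totalDegree_le
    omega

end LinearAlgebra

/-! ### The multiplicity bound at an arbitrary point -/

section LocalBound

theorem MultiplicityLeFour.of_comap {I : Ideal (MvPolynomial (Fin 4) ℂ)} {b φ : Fin 4 → Fin 4 → ℂ}
    (h1 : ∀ f, pull φ (pull b f) = f) (h2 : ∀ f, pull b (pull φ f) = f)
    {v : Fin 4 → ℂ} (h : MultiplicityLeFour (I.comap (pull φ)) v) :
    MultiplicityLeFour I (∑ j, v j • b j) := by
  obtain ⟨J, hIJ, hJ, ⟨r, hr, hrJ⟩, E, hE⟩ := h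
  refine ⟨J.comap (pull b), ?_, ?_, ⟨pull φ r, ?_, ?_⟩, E, fun D hD => ?_⟩
  · intro f hf
    refine hIJ ?_
    rw [Ideal.mem_comap, h1]
    exact hf
  · intro f hf k
    rw [Ideal.mem_comap, ← homogeneousComponent_pull]
    exact hJ _ hf k
  · rwa [← eval_pull, h2]
  · intro f hf
    have := hrJ _ hf
    rwa [Ideal.mem_comap, map_mul, h1] at this
  · obtain ⟨w, hw⟩ := hE D hD
    refine ⟨fun i => pull φ (w i), fun f hf => ?_⟩
    have hf' : pull b f ∈ J.restrictScalars ℂ ⊔ Submodule.span ℂ (Set.range w) :=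
      hw (isHomogeneous_pull b hf)
    obtain ⟨x, hx, y, hy, hxy⟩ := Submodule.mem_sup.1 hf'
    rw [← h1 f, ← hxy, map_add]
    refine Submodule.add_mem_sup ?_ ?_
    · rw [Submodule.restrictScalars_mem, Ideal.mem_comap, h2]
      exact hx
    · have := Submodule.mem_map_of_mem (f := (pull φ).toLinearMap) hy
      rw [Submodule.map_span, ← Set.range_comp] at this
      exact this

/-- In a basis `v, e₁, e₂, e₃`, where the first three span the kernel of the linear leading form and
that form is 1 on `e₃`, this is the coordinate version. -/
theorem multiplicityLeFour_of_taylor {I : Ideal (MvPolynomial (Fin 4) ℂ)}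
    (hI : ContainsComponents I) {v : Fin 4 → ℂ} (hv : v ≠ 0)
    {u₁ u₂ u₃ : MvPolynomial (Fin 4) ℂ} {d₁ d₂ d₃ : ℕ}
    (hu₁ : u₁.IsHomogeneous d₁) (hu₂ : u₂.IsHomogeneous d₂) (hu₃ : u₃.IsHomogeneous d₃)
    (hd₁ : 1 ≤ d₁) (hd₂ : 2 ≤ d₂) (hd₃ : 2 ≤ d₃) (hI₁ : u₁ ∈ I) (hI₂ : u₂ ∈ I) (hI₃ : u₃ ∈ I)
    (ho₁ : u₁ ∈ pointIdeal v ^ 1) (ho₂ : u₂ ∈ pointIdeal v ^ 2) (ho₃ : u₃ ∈ pointIdeal v ^ 2)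
    (hlin : taylor v 1 u₁ ≠ 0)
    (hzero : ∀ x, eval x (taylor v 1 u₁) = 0 → eval x (taylor v 2 u₂) = 0 →
      eval x (taylor v 2 u₃) = 0 → x ∈ Submodule.span ℂ {v}) :
    MultiplicityLeFour I v := by
  obtain ⟨c, hc⟩ := exists_eq_sum_of_isHomogeneous_one (isHomogeneous_taylor v 1 u₁)
  have hce : ∀ x, eval x (taylor v 1 u₁) = ∑ i, x i * c i := fun x => by
    rw [hc]; simp [mul_comm]
  let L : (Fin 4 → ℂ) →ₗ[ℂ] ℂ := Fintype.linearCombination ℂ c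
  have hL : ∀ x, L x = eval x (taylor v 1 u₁) := fun x => by
    rw [hce]; simp [L, Fintype.linearCombination_apply]
  have hLv : L v = 0 := by
    rw [hL]
    exact eval_taylor_self hu₁ ((mem_pointIdeal_iff v u₁).1 (by simpa using ho₁)) 1
  have hL0 : L ≠ 0 := by
    intro h
    refine hlin (MvPolynomial.funext fun x => ?_)
    rw [← hL, h]
    simp
  have hker : Module.finrank ℂ (LinearMap.ker L) = 3 := by
    have h1 := LinearMap.finrank_range_add_finrank_ker L
    rw [LinearMap.range_eq_top.2 (LinearMap.surjective hL0), finrank_top, Module.finrank_self] at h1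
    simp only [Module.finrank_fintype_fun_eq_card, Fintype.card_fin] at h1
    omega
  obtain ⟨e₁, he₁, hi₁⟩ := exists_linearIndependent_snoc (A := ![v])
    (linearIndependent_unique_iff.2 hv) (W := LinearMap.ker L) (by omega)
  obtain ⟨e₂, he₂, hi₂⟩ := exists_linearIndependent_snoc hi₁ (W := LinearMap.ker L) (by omega)
  obtain ⟨e₃, he₃⟩ := LinearMap.surjective hL0 1
  have hi₃ : LinearIndependent ℂ
      (Fin.snoc (Fin.snoc (Fin.snoc ![v] e₁ : Fin 2 → Fin 4 → ℂ) e₂ : Fin 3 → Fin 4 → ℂ) e₃ :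
        Fin 4 → Fin 4 → ℂ) := by
    rw [linearIndependent_finSnoc]
    refine ⟨hi₂, fun h => ?_⟩
    have : Submodule.span ℂ (Set.range (Fin.snoc (Fin.snoc ![v] e₁ : Fin 2 → Fin 4 → ℂ) e₂ :
        Fin 3 → Fin 4 → ℂ)) ≤ LinearMap.ker L := by
      rw [Submodule.span_le]
      rintro _ ⟨i, rfl⟩
      fin_cases i
      · exact hLv
      · exact he₁
      · exact he₂
    have := this h
    rw [LinearMap.mem_ker, he₃] at this
    exact one_ne_zero this
  have hb : (Fin.snoc (Fin.snoc (Fin.snoc ![v] e₁ : Fin 2 → Fin 4 → ℂ) e₂ : Fin 3 → Fin 4 → ℂ) e₃ :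
        Fin 4 → Fin 4 → ℂ) = ![v, e₁, e₂, e₃] := by
    funext i
    fin_cases i <;> rfl
  rw [hb] at hi₃
  set b : Fin 4 → Fin 4 → ℂ := ![v, e₁, e₂, e₃] with hbdef
  obtain ⟨φ, h1, h2, -⟩ := exists_inverse_pull hi₃
  have hbv : ∑ j, (Pi.single 0 1 : Fin 4 → ℂ) j • b j = v := by
    simp [hbdef]
  have hmem : ∀ {u}, u ∈ I → pull b u ∈ I.comap (pull φ) := fun hu => by
    rw [Ideal.mem_comap, h1]; exact hu
  have hord : ∀ {u k}, u ∈ pointIdeal v ^ k →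
      pull b u ∈ pointIdeal (Pi.single 0 1 : Fin 4 → ℂ) ^ k := fun hu =>
    pull_mem_pointIdeal_pow b _ (by rw [hbv]; exact hu)
  have ht : ∀ k u, taylor (Pi.single 0 1) k (pull b u) = pull b (taylor v k u) := fun k u => by
    rw [taylor_pull, hbv]
  rw [← hbv]
  refine MultiplicityLeFour.of_comap h1 h2 (multiplicityLeFour_of_taylor_coord ?_
    (isHomogeneous_pull b hu₁) (isHomogeneous_pull b hu₂) (isHomogeneous_pull b hu₃) hd₁ hd₂ hd₃
    (hmem hI₁) (hmem hI₂) (hmem hI₃) (hord ho₁) (hord ho₂) (hord ho₃) ?_ ?_)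
  · intro f hf k
    rw [Ideal.mem_comap, ← homogeneousComponent_pull]
    exact hI _ hf k
  · rw [ht]
    refine MvPolynomial.funext fun x => ?_
    rw [eval_pull, ← hL, map_sum, Fin.sum_univ_four]
    rw [LinearMap.mem_ker] at he₁ he₂
    simp [hbdef, hLv, he₁, he₂, he₃]
  · intro x y hx hy
    rw [ht, eval_pull] at hx hy
    have hlin0 : eval (∑ j, (![0, x, y, 0] : Fin 4 → ℂ) j • b j) (taylor v 1 u₁) = 0 := by
      rw [LinearMap.mem_ker] at he₁ he₂
      rw [← hL, map_sum, Fin.sum_univ_four]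
      simp [hbdef, he₁, he₂]
    obtain ⟨s, hs⟩ := Submodule.mem_span_singleton.1 (hzero _ hlin0 hx hy)
    have := Fintype.linearIndependent_iff.1 hi₃ ![-s, x, y, 0] (by
      rw [Fin.sum_univ_four] at hs ⊢
      simp only [hbdef, Matrix.cons_val, zero_smul, zero_add, add_zero, neg_smul] at hs ⊢
      rw [hs, add_assoc, neg_add_cancel])
    exact ⟨this 1, this 2⟩

end LocalBound

/-! ### A weak form of Bézout's theorem -/

section Bezout

theorem finrank_le_finrank_inf_add {V : Type*} [AddCommGroup V] [Module ℂ V]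
    {U J : Submodule ℂ V} [FiniteDimensional ℂ U] {m : ℕ} {w : Fin m → V}
    (h : U ≤ J ⊔ Submodule.span ℂ (Set.range w)) :
    Module.finrank ℂ U ≤ Module.finrank ℂ ↥(U ⊓ J) + m := by
  let f : U →ₗ[ℂ] V ⧸ J := J.mkQ.comp U.subtype
  have h1 := LinearMap.finrank_range_add_finrank_ker f
  have h2 : Module.finrank ℂ (LinearMap.ker f) = Module.finrank ℂ ↥(U ⊓ J) := by
    have : LinearMap.ker f = J.comap U.subtype := by
      rw [LinearMap.ker_comp, Submodule.ker_mkQ]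
    rw [this]
    rw [(Submodule.equivMapOfInjective U.subtype U.injective_subtype _).finrank_eq,
      Submodule.map_comap_subtype]
  have h3 : LinearMap.range f ≤ Submodule.span ℂ (Set.range (J.mkQ ∘ w)) := by
    rintro _ ⟨⟨x, hx⟩, rfl⟩
    obtain ⟨a, ha, b, hb, rfl⟩ := Submodule.mem_sup.1 (h hx)
    have h4 : f ⟨a + b, hx⟩ = J.mkQ b := by
      simp [f, (Submodule.Quotient.mk_eq_zero J).2 ha]
    rw [h4, Set.range_comp, ← Submodule.map_span]
    exact Submodule.mem_map_of_mem hb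
  have h5 : Module.finrank ℂ (LinearMap.range f) ≤ m := by
    have h6 := finrank_range_le_card (R := ℂ) (J.mkQ ∘ w)
    rw [Fintype.card_fin] at h6
    have : FiniteDimensional ℂ (Submodule.span ℂ (Set.range (J.mkQ ∘ w))) :=
      FiniteDimensional.span_of_finite ℂ (Set.finite_range _)
    exact (Submodule.finrank_mono h3).trans h6
  omega

/-- If `r * J ⊆ I` for enough elements `r`, then `I` and `J` agree in large degrees. -/
theorem exists_homogeneous_mem_of_pow_mul_mem {n : Type*} [Finite n]
    {I J : Ideal (MvPolynomial n ℂ)} (hJ : ContainsComponents J) {N : ℕ}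
    (h : ∀ r ∈ idealOfVars n ℂ ^ N, ∀ f ∈ J, r * f ∈ I) :
    ∃ E, ∀ D ≥ E, ∀ f ∈ J, homogeneousComponent D f ∈ I := by
  obtain ⟨G, hG⟩ := (isNoetherianRing_iff_ideal_fg _).1 inferInstance J
  obtain ⟨e, he⟩ : ∃ e, ∀ g ∈ G, g.totalDegree ≤ e :=
    ⟨G.sup totalDegree, fun g hg => Finset.le_sup hg⟩
  -- With generators of degree at most `e`, every cofactor in degree `D ≥ N + e` has degree at least
  -- `N`.
  refine ⟨N + e, fun D hD f hf => ?_⟩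
  rw [← hG] at hf
  suffices ∀ a, homogeneousComponent D (a * f) ∈ I by simpa using this 1
  induction hf using Submodule.span_induction with
  | mem g hg =>
    intro a
    rw [← sum_homogeneousComponent g, Finset.mul_sum, map_sum]
    refine I.sum_mem fun j hj => ?_
    have hje : j ≤ e := by
      have := he g hg
      simp only [Finset.mem_range] at hj
      omega
    rw [mul_comm, show D = j + (D - j) by omega,
      homogeneousComponent_mul_of_isHomogeneous (homogeneousComponent_isHomogeneous j g), mul_comm]
    refine h _ ?_ _ (hJ g (hG ▸ Ideal.subset_span hg) j)
    rw [mem_pow_idealOfVars_iff']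
    intro x hx
    exact (homogeneousComponent_isHomogeneous _ _).coeff_eq_zero (by omega)
  | zero => simp
  | add x y _ _ hx hy =>
    intro a
    rw [mul_add, map_add]
    exact add_mem (hx a) (hy a)
  | smul b x _ hx =>
    intro a
    rw [smul_eq_mul, ← mul_assoc]
    exact hx _

/-- The projective Nullstellensatz: an ideal with no zero other than the origin contains a power of
the irrelevant ideal. -/
theorem exists_pow_le_of_zeros {n : Type*} [Finite n] {K : Ideal (MvPolynomial n ℂ)}
    (h : ∀ y : n → ℂ, (∀ r ∈ K, eval y r = 0) → y = 0) : ∃ N, idealOfVars n ℂ ^ N ≤ K := by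
  refine Ideal.exists_pow_le_of_le_radical_of_fg ?_ (idealOfVars_fg n ℂ)
  rw [← vanishingIdeal_zeroLocus_eq_radical (K := ℂ), idealOfVars, Ideal.span_le]
  rintro _ ⟨i, rfl⟩
  rw [SetLike.mem_coe, mem_vanishingIdeal_iff]
  intro y hy
  have : y = 0 := h y fun r hr => by
    have := (mem_zeroLocus_iff.1 hy) r hr
    simpa [aeval_eq_eval] using this
  simp [this]

theorem containsComponents_span_triple {q c g : MvPolynomial (Fin 4) ℂ} {d₁ d₂ d₃ : ℕ}
    (hqh : q.IsHomogeneous d₁) (hch : c.IsHomogeneous d₂) (hgh : g.IsHomogeneous d₃) :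
    ContainsComponents (Ideal.span {q, c, g}) := by
  have := containsComponents_span_pow (s := {q, c, g}) (by
    rintro _ (rfl | rfl | rfl)
    · exact ⟨_, hqh⟩
    · exact ⟨_, hch⟩
    · exact ⟨_, hgh⟩) 1
  rwa [pow_one] at this

/-- A weak form of the theorem of Bézout in projective three-space: forms of degrees `d₁`, `d₂`,
`d₃` with finitely many common zeros, each of multiplicity at most four, have at least
`d₁ d₂ d₃ / 4` common zeros. -/
theorem mul_le_four_mul_card {q c g : MvPolynomial (Fin 4) ℂ} {d₁ d₂ d₃ : ℕ}
    (hqh : q.IsHomogeneous d₁) (hch : c.IsHomogeneous d₂) (hgh : g.IsHomogeneous d₃)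
    (hq : Prime q) (hqc : ¬ q ∣ c) (s : Finset (Fin 4 → ℂ))
    (hs : ∀ y ≠ 0, eval y q = 0 → eval y c = 0 → eval y g = 0 → ∃ v ∈ s, y ∈ Submodule.span ℂ {v})
    (hloc : ∀ v ∈ s, MultiplicityLeFour (Ideal.span {q, c, g}) v) :
    d₁ * d₂ * d₃ ≤ 4 * s.card := by
  classical
  set I := Ideal.span {q, c, g} with hIdef
  have hI : ContainsComponents I := containsComponents_span_triple hqh hch hgh
  choose! J hJ using hloc
  -- `M` agrees with `I` near every common zero, so it agrees with `I` in large degrees, while its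
  -- codimension there is at most four for each element of `s`.
  set M := ⨅ v ∈ s, J v with hM
  have hMJ : ∀ v ∈ s, M ≤ J v := fun v hv => iInf₂_le v hv
  have hMc : ContainsComponents M := by
    intro f hf k
    simp only [hM, Submodule.mem_iInf] at hf ⊢
    exact fun v hv => (hJ v hv).2.1 f (hf v hv) k
  -- The ideal quotient `(I : M)`, which measures where `I` and `M` differ.
  let K : Ideal (MvPolynomial (Fin 4) ℂ) :=
    { carrier := {r | ∀ f ∈ M, r * f ∈ I}
      add_mem' := fun ha hb f hf => by rw [add_mul]; exact add_mem (ha f hf) (hb f hf)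
      zero_mem' := fun f _ => by rw [zero_mul]; exact zero_mem _
      smul_mem' := fun a r hr f hf => by
        rw [smul_eq_mul, mul_assoc]; exact I.mul_mem_left _ (hr f hf) }
  have hIK : I ≤ K := fun r hr f _ => I.mul_mem_right _ hr
  have hKc : ContainsComponents K := by
    intro r hr k f hf
    rw [← sum_homogeneousComponent f, Finset.mul_sum]
    refine I.sum_mem fun j _ => ?_
    have h1 := hI _ (hr _ (hMc f hf j)) (j + k)
    rwa [mul_comm, homogeneousComponent_mul_of_isHomogeneous
      (homogeneousComponent_isHomogeneous j f), mul_comm] at h1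
  obtain ⟨N, hN⟩ : ∃ N, idealOfVars (Fin 4) ℂ ^ N ≤ K := by
    refine exists_pow_le_of_zeros fun y hy => ?_
    by_contra hy0
    obtain ⟨v, hv, hyv⟩ := hs y hy0 (hy q (hIK (Ideal.subset_span (by simp))))
      (hy c (hIK (Ideal.subset_span (by simp)))) (hy g (hIK (Ideal.subset_span (by simp))))
    obtain ⟨t, rfl⟩ := Submodule.mem_span_singleton.1 hyv
    obtain ⟨-, -, ⟨r, hr, hrJ⟩, -⟩ := hJ v hv
    have hrK : r ∈ K := fun f hf => hrJ f (hMJ v hv hf)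
    apply hr
    -- All components of `r` lie in `K` and vanish at `t • v`. Being homogeneous, they vanish at
    -- `v`, which contradicts the choice of `r`.
    rw [← sum_homogeneousComponent r, map_sum]
    refine Finset.sum_eq_zero fun k _ => ?_
    have h1 := hy _ (hKc r hrK k)
    rw [IsHomogeneous.eval_smul (homogeneousComponent_isHomogeneous k r)] at h1
    refine (mul_eq_zero.1 h1).resolve_left (pow_ne_zero _ ?_)
    rintro rfl
    exact hy0 (zero_smul _ _)
  obtain ⟨E₀, hE₀⟩ := exists_homogeneous_mem_of_pow_mul_mem hMc (I := I) fun r hr f hf => hN hr f hf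
  have hE : ∀ v ∈ s, ∃ E, ∀ D ≥ E, ∃ w : Fin 4 → MvPolynomial (Fin 4) ℂ,
      homogeneousSubmodule (Fin 4) ℂ D ≤
        (J v).restrictScalars ℂ ⊔ Submodule.span ℂ (Set.range w) := fun v hv => (hJ v hv).2.2.2
  choose! E hE using hE
  -- Any `k` that makes the degree `D` exceed all thresholds serves.
  set k := E₀ + ∑ v ∈ s, E v
  set D := k + d₁ + d₂ + d₃ with hD
  have hDE : ∀ v ∈ s, E v ≤ D := fun v hv => by
    have := Finset.single_le_sum (f := E) (fun _ _ => Nat.zero_le _) hv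
    omega
  -- Intersecting with one more `J v` costs at most four dimensions.
  have hcount : ∀ t ⊆ s, Module.finrank ℂ (homogeneousSubmodule (Fin 4) ℂ D) ≤
      Module.finrank ℂ ↥(homogeneousSubmodule (Fin 4) ℂ D ⊓
        (⨅ v ∈ t, J v).restrictScalars ℂ) + 4 * t.card := by
    intro t
    induction t using Finset.induction_on with
    | empty => exact fun _ => Submodule.finrank_mono (le_inf le_rfl fun x _ => by simp)
    | insert v t hvt ih =>
      intro hts
      refine (ih ((Finset.subset_insert v t).trans hts)).trans ?_
      rw [Finset.card_insert_of_notMem hvt, mul_add, mul_one, add_comm (4 * t.card), ← add_assoc]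
      refine Nat.add_le_add_right ?_ _
      have hv : v ∈ s := hts (Finset.mem_insert_self v t)
      obtain ⟨w, hw⟩ := hE v hv D (hDE v hv)
      refine (finrank_le_finrank_inf_add (inf_le_left.trans hw)).trans (Nat.add_le_add_right ?_ _)
      refine Submodule.finrank_mono fun x hx => ?_
      obtain ⟨⟨h1, h2⟩, h3⟩ := hx
      refine ⟨h1, ?_⟩
      rw [SetLike.mem_coe, Submodule.restrictScalars_mem, Finset.iInf_insert]
      exact ⟨h3, h2⟩
  have h1 := hcount s subset_rfl
  have h2 : homogeneousSubmodule (Fin 4) ℂ D ⊓ M.restrictScalars ℂ ≤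
      multiples q (k + d₃ + d₂) ⊔ multiples c (k + d₃ + d₁) ⊔ multiples g (k + d₁ + d₂) := by
    rintro f ⟨hf, hfM⟩
    refine mem_sup_multiples hqh hch hgh k hf ?_
    have h3 := hE₀ D (by omega) f hfM
    rwa [homogeneousComponent_of_mem hf, if_pos rfl] at h3
  have h3 := finrank_sup_multiples_add_le hqh hch hgh hq hqc k
  have h4 := Submodule.finrank_mono h2
  rw [← hM] at h1
  rw [← hD] at h3
  omega

/-- Two forms in projective three-space have infinitely many common zeros. -/
theorem exists_common_zero_notMem {q c : MvPolynomial (Fin 4) ℂ} {d₁ d₂ : ℕ}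
    (hqh : q.IsHomogeneous d₁) (hch : c.IsHomogeneous d₂) (hd₁ : d₁ ≠ 0) (hd₂ : d₂ ≠ 0)
    (hq : Prime q) (s : Finset (Fin 4 → ℂ)) :
    ∃ y ≠ 0, eval y q = 0 ∧ eval y c = 0 ∧ ∀ v ∈ s, v ≠ 0 → y ∉ Submodule.span ℂ {v} := by
  classical
  have key : ∀ (c : MvPolynomial (Fin 4) ℂ) (d : ℕ), c.IsHomogeneous d → d ≠ 0 → ¬ q ∣ c →
      ∃ y ≠ 0, eval y q = 0 ∧ eval y c = 0 ∧ ∀ v ∈ s, v ≠ 0 → y ∉ Submodule.span ℂ {v} := by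
    intro c d hch hd hqc
    -- A plane that avoids the finitely many given points.
    obtain ⟨a, ha⟩ : ∃ a : Fin 4 → ℂ, ∀ v ∈ s, v ≠ 0 → ∑ i, a i * v i ≠ 0 := by
      have hprod : (∏ v ∈ s.filter (· ≠ 0), ∑ i, C (v i) * X i : MvPolynomial (Fin 4) ℂ) ≠ 0 := by
        rw [Finset.prod_ne_zero_iff]
        intro v hv h0
        refine (Finset.mem_filter.1 hv).2 (funext fun i => ?_)
        have := congrArg (eval (Pi.single i 1)) h0
        simpa [Pi.single_apply] using this
      obtain ⟨a, ha⟩ : ∃ a, eval a (∏ v ∈ s.filter (· ≠ 0), ∑ i, C (v i) * X i :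
          MvPolynomial (Fin 4) ℂ) ≠ 0 := by
        by_contra! hcon
        exact hprod (MvPolynomial.funext fun x => by rw [hcon x, map_zero])
      refine ⟨a, fun v hv hv0 => ?_⟩
      rw [map_prod, Finset.prod_ne_zero_iff] at ha
      have := ha v (Finset.mem_filter.2 ⟨hv, hv0⟩)
      simpa [mul_comm] using this
    by_contra! hcon
    -- If the given points were the only common zeros, the three forms would have none. Bézout with
    -- the empty set would then give `d₁ * d₂ ≤ 0`.
    have h := mul_le_four_mul_card (g := ∑ i, C (a i) * X i) (d₃ := 1) hqh hch
      (IsHomogeneous.sum _ _ _ fun i _ => isHomogeneous_C_mul_X _ _) hq hqc ∅ (by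
        intro y hy hyq hyc hyg
        exfalso
        obtain ⟨v, hv, hv0, hyv⟩ := hcon y hy hyq hyc
        obtain ⟨t, rfl⟩ := Submodule.mem_span_singleton.1 hyv
        have ht : t ≠ 0 := by
          rintro rfl
          exact hy (zero_smul _ _)
        refine ha v hv hv0 ?_
        have h1 : t * ∑ i, a i * v i = 0 := by
          rw [← hyg, Finset.mul_sum, map_sum]
          exact Finset.sum_congr rfl fun i _ => by simp; ring
        exact (mul_eq_zero.1 h1).resolve_left ht) (by simp)
    simp at h
    omega
  by_cases hqc : q ∣ c
  -- If `q` divides `c`, a coordinate replaces `c`; the prime `q` cannot divide both `X 0` and `X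
  -- 1`.
  · obtain ⟨i, hi⟩ : ∃ i : Fin 4, ¬ q ∣ X i := by
      by_contra! hcon
      obtain ⟨r, hr⟩ := hcon 0
      have h0 := (MvPolynomial.X_dvd_X (R := ℂ) (i := (0 : Fin 4)) (j := 1))
      have hirr : Irreducible (X 0 : MvPolynomial (Fin 4) ℂ) := X_prime.irreducible
      rcases hirr.isUnit_or_isUnit hr with h | h
      · exact hq.not_isUnit h
      · have h1 : (X 0 : MvPolynomial (Fin 4) ℂ) ∣ q := by
          obtain ⟨u, rfl⟩ := h
          exact ⟨↑u⁻¹, by rw [hr, mul_assoc, Units.mul_inv, mul_one]⟩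
        simpa using h0.1 (h1.trans (hcon 1))
    obtain ⟨y, hy, hyq, -, hys⟩ := key _ 1 (isHomogeneous_X _ i) one_ne_zero hi
    obtain ⟨r, rfl⟩ := hqc
    exact ⟨y, hy, hyq, by rw [map_mul, hyq, zero_mul], hys⟩
  · exact key c d₂ hch hd₂ hqc

end Bezout

/-! ### The Cremona involution and forms with exponents at most two -/

section SmallExponents

variable {n : ℕ}

/-- The standard quadratic Cremona involution, without denominators. -/
def cremona {R : Type*} [CommMonoid R] (y : Fin n → R) (i : Fin n) : R :=
  ∏ j ∈ Finset.univ.erase i, y j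

theorem mul_cremona {R : Type*} [CommMonoid R] (y : Fin n → R) (i : Fin n) :
    y i * cremona y i = ∏ j, y j :=
  Finset.mul_prod_erase _ _ (Finset.mem_univ i)

/-- The exponent of `y j` is the sum of the other `e i`, namely `d - e j = (d - 2) + (2 - e j)`. -/
theorem prod_cremona_pow (y : Fin n → ℂ) (e : Fin n →₀ ℕ) {d : ℕ} (hd : 2 ≤ d)
    (he : e.degree = d) (h2 : ∀ i, e i ≤ 2) :
    ∏ i, cremona y i ^ e i = (∏ i, y i) ^ (d - 2) * ∏ i, y i ^ (2 - e i) := by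
  have h1 : ∀ i, cremona y i ^ e i = ∏ j, if j = i then 1 else y j ^ e i := by
    intro i
    rw [cremona, ← Finset.prod_pow, ← Finset.mul_prod_erase Finset.univ _ (Finset.mem_univ i),
      if_pos rfl, one_mul]
    exact Finset.prod_congr rfl fun j hj => by rw [if_neg (Finset.ne_of_mem_erase hj)]
  simp_rw [h1]
  rw [Finset.prod_comm, ← Finset.prod_pow, ← Finset.prod_mul_distrib]
  refine Finset.prod_congr rfl fun j _ => ?_
  have h3 : ∏ i, (if j = i then 1 else y j ^ e i) = y j ^ ∑ i ∈ Finset.univ.erase j, e i := by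
    rw [← Finset.mul_prod_erase Finset.univ _ (Finset.mem_univ j), if_pos rfl, one_mul,
      ← Finset.prod_pow_eq_pow_sum]
    exact Finset.prod_congr rfl fun i hi => by rw [if_neg (Finset.ne_of_mem_erase hi).symm]
  have h4 := Finset.add_sum_erase Finset.univ e (Finset.mem_univ j)
  rw [← Finsupp.degree_eq_sum, he] at h4
  have := h2 j
  rw [h3, ← pow_add]
  congr 1
  omega

theorem exists_cremona_transform {f : MvPolynomial (Fin n) ℂ} {d : ℕ} (hd : 2 ≤ d)
    (hf : f.IsHomogeneous d) (h2 : ∀ e ∈ f.support, ∀ i, e i ≤ 2) :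
    ∃ g : MvPolynomial (Fin n) ℂ, g.IsHomogeneous (2 * n - d) ∧
      (∀ e ∈ g.support, ∀ i, e i ≤ 2) ∧
      aeval (cremona X) f = (∏ i, X i) ^ (d - 2) * g := by
  classical
  let c : (Fin n →₀ ℕ) → (Fin n →₀ ℕ) := fun e => Finsupp.equivFunOnFinite.symm fun i => 2 - e i
  refine ⟨∑ e ∈ f.support, monomial (c e) (coeff e f), ?_, ?_, ?_⟩
  · refine IsHomogeneous.sum _ _ _ fun e he => isHomogeneous_monomial _ ?_
    have hdeg := degree_eq_of_mem_support hf he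
    rw [Finsupp.degree_eq_sum] at hdeg ⊢
    simp only [c, Finsupp.equivFunOnFinite_symm_apply_apply]
    have h3 : ∑ i, (2 - e i) + ∑ i, e i = 2 * n := by
      rw [← Finset.sum_add_distrib, Finset.sum_congr rfl fun i _ => Nat.sub_add_cancel (h2 e he i)]
      simp [mul_comm]
    omega
  · intro e he i
    obtain ⟨a, ha, hae⟩ := Finset.mem_biUnion.1 (support_sum he)
    have := Finset.mem_singleton.1 (support_monomial_subset hae)
    rw [this]
    simp [c]
  · refine MvPolynomial.funext fun y => ?_
    have h3 : eval y (aeval (cremona X) f) = eval (cremona y) f := by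
      have : (aeval y).comp (aeval (cremona X)) = aeval (R := ℂ) (cremona y) := by
        ext i
        simp [cremona]
      simpa [aeval_eq_eval] using DFunLike.congr_fun this f
    rw [h3, map_mul, map_pow, map_prod, map_sum, Finset.mul_sum, eval_eq']
    refine Finset.sum_congr rfl fun e he => ?_
    rw [prod_cremona_pow y e hd (degree_eq_of_mem_support hf he) (h2 e he), eval_monomial,
      Finsupp.prod_fintype _ _ (by simp)]
    simp only [eval_X, c, Finsupp.equivFunOnFinite_symm_apply_apply]
    ring

theorem eval_cremona {f g : MvPolynomial (Fin n) ℂ} {k : ℕ}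
    (h : aeval (cremona X) f = (∏ i, X i) ^ k * g) (y : Fin n → ℂ) :
    eval (cremona y) f = (∏ i, y i) ^ k * eval y g := by
  have h3 : eval y (aeval (cremona X) f) = eval (cremona y) f := by
    have : (aeval y).comp (aeval (cremona X)) = aeval (R := ℂ) (cremona y) := by
      ext i
      simp [cremona]
    simpa [aeval_eq_eval] using DFunLike.congr_fun this f
  rw [← h3, h]
  simp

/-- Off the coordinate hyperplanes the extracted monomial factor is a unit, so orders of vanishing
carry over to the transform. -/
theorem mem_pointIdeal_pow_of_cremona {f g : MvPolynomial (Fin n) ℂ} {k m : ℕ}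
    (h : aeval (cremona X) f = (∏ i, X i) ^ m * g) {y : Fin n → ℂ} (hy : ∀ i, y i ≠ 0)
    (hf : f ∈ pointIdeal (cremona y) ^ k) : g ∈ pointIdeal y ^ k := by
  have h1 := map_mem_pow_of_mem_pointIdeal_pow (aeval (cremona X)) (J := pointIdeal y)
    (fun i => by
      rw [mem_pointIdeal_iff]
      simp [cremona]) hf
  rw [h] at h1
  refine mem_pointIdeal_pow_of_mul_mem ?_ h1
  rw [map_pow, map_prod]
  exact pow_ne_zero _ (Finset.prod_ne_zero_iff.2 fun i _ => by simpa using hy i)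

/-- The inverse coordinates give a preimage of the projective point `p`. -/
theorem cremona_inv {p : Fin n → ℂ} (hp : ∀ i, p i ≠ 0) :
    cremona (fun i => (p i)⁻¹) = (∏ i, (p i)⁻¹) • p := by
  funext i
  have h := mul_cremona (fun i => (p i)⁻¹) i
  rw [Pi.smul_apply, smul_eq_mul, ← h, mul_comm, ← mul_assoc, mul_inv_cancel₀ (hp i), one_mul]

/-- The map is dominant, because it reaches every point with nonzero coordinates up to a scalar. -/
theorem eq_zero_of_cremona_eq_zero {f : MvPolynomial (Fin n) ℂ} {d : ℕ} (hf : f.IsHomogeneous d)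
    (h : (aeval (cremona X) f : MvPolynomial (Fin n) ℂ) = 0) : f = 0 := by
  have h0 : f * ∏ i, X i = 0 := by
    refine MvPolynomial.funext fun x => ?_
    rw [map_mul, map_zero, map_prod]
    by_cases hx : ∀ i, x i ≠ 0
    · have h1 := eval_cremona (g := 0) (k := 0) (by rw [h, mul_zero]) fun i => (x i)⁻¹
      rw [cremona_inv hx, IsHomogeneous.eval_smul hf, map_zero, mul_zero] at h1
      rw [(mul_eq_zero.1 h1).resolve_left, zero_mul]
      exact pow_ne_zero _ (Finset.prod_ne_zero_iff.2 fun i _ => inv_ne_zero (hx i))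
    · push Not at hx
      obtain ⟨i, hi⟩ := hx
      rw [Finset.prod_eq_zero (Finset.mem_univ i) (by simpa using hi), mul_zero]
  refine (mul_eq_zero.1 h0).resolve_right (Finset.prod_ne_zero_iff.2 fun i _ => X_ne_zero i)

/-- A form of degree `d` with a `d`-fold point is a cone. -/
theorem eval_add_smul_of_mem_pow {f : MvPolynomial (Fin n) ℂ} {d : ℕ} (hf : f.IsHomogeneous d)
    {a : Fin n → ℂ} (ha : f ∈ pointIdeal a ^ d) (w : Fin n → ℂ) (s : ℂ) :
    eval (w + s • a) f = eval w f := by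
  rw [mem_pointIdeal_pow_iff] at ha
  have h1 : ∀ x, eval (a + x) f = eval x (taylor a d f) := by
    intro x
    rw [eval_add_eq_sum_taylor a x hf.totalDegree_le, Finset.sum_range_succ,
      Finset.sum_eq_zero, zero_add]
    intro k hk
    rw [ha k (Finset.mem_range.1 hk), map_zero]
  -- Homogeneity moves `w + s a` to `a + w/s`, where only the degree `d` Taylor form is left. The
  -- value is thus independent of `s ≠ 0`, and a polynomial in `s` extends this to `s = 0`.
  have h2 : ∀ s : ℂ, s ≠ 0 → eval (w + s • a) f = eval w (taylor a d f) := by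
    intro s hs
    have h3 : w + s • a = s • (a + s⁻¹ • w) := by
      rw [smul_add, smul_smul, mul_inv_cancel₀ hs, one_smul, add_comm]
    rw [h3, IsHomogeneous.eval_smul hf, h1, IsHomogeneous.eval_smul (isHomogeneous_taylor a d f),
      ← mul_assoc, ← mul_pow, mul_inv_cancel₀ hs, one_pow, one_mul]
  let p : Polynomial ℂ :=
    ∑ j ∈ Finset.range (d + 1), Polynomial.monomial j (eval a (taylor w j f))
  have hp : ∀ s : ℂ, p.eval s = eval (w + s • a) f := by
    intro s
    rw [eval_add_eq_sum_taylor w (s • a) hf.totalDegree_le, Polynomial.eval_finsetSum]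
    refine Finset.sum_congr rfl fun j _ => ?_
    rw [Polynomial.eval_monomial, IsHomogeneous.eval_smul (isHomogeneous_taylor w j f), mul_comm]
  have hpc : p = Polynomial.C (eval w (taylor a d f)) := by
    refine Polynomial.eq_of_infinite_eval_eq _ _ ((Set.finite_singleton (0 : ℂ)).infinite_compl.mono ?_)
    intro s hs
    rw [Set.mem_ofPred_eq, hp, Polynomial.eval_C]
    exact h2 s hs
  have h4 := hp 0
  rw [zero_smul, add_zero, hpc, Polynomial.eval_C] at h4
  rw [← hp, hpc, Polynomial.eval_C, h4]

/-- There is no quintic surface with six triple points in general position. -/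
theorem eq_zero_of_six_triple_points {f : MvPolynomial (Fin 4) ℂ} (hf : f.IsHomogeneous 5)
    (he : ∀ i, f ∈ pointIdeal (Pi.single i 1 : Fin 4 → ℂ) ^ 3) {p q : Fin 4 → ℂ}
    (hp0 : ∀ i, p i ≠ 0) (hq0 : ∀ i, q i ≠ 0) (hpq : ∀ i j, i ≠ j → p i * q j ≠ p j * q i)
    (hp : ∀ c : ℂ, c ≠ 0 → f ∈ pointIdeal (c • p) ^ 3)
    (hq : ∀ c : ℂ, c ≠ 0 → f ∈ pointIdeal (c • q) ^ 3) : f = 0 := by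
  have hexp : ∀ e ∈ f.support, ∀ i, e i ≤ 2 := fun e h i => by
    have := add_le_of_mem_support hf (he i) h
    omega
  obtain ⟨g, hg, hg2, hfg⟩ := exists_cremona_transform (by norm_num) hf hexp
  norm_num at hg
  set α : Fin 4 → ℂ := fun i => (p i)⁻¹ with hα
  set β : Fin 4 → ℂ := fun i => (q i)⁻¹ with hβ
  have hgα : g ∈ pointIdeal α ^ 3 := by
    refine mem_pointIdeal_pow_of_cremona hfg (fun i => inv_ne_zero (hp0 i)) ?_
    rw [hα, cremona_inv hp0]
    exact hp _ (Finset.prod_ne_zero_iff.2 fun i _ => inv_ne_zero (hp0 i))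
  have hgβ : g ∈ pointIdeal β ^ 3 := by
    refine mem_pointIdeal_pow_of_cremona hfg (fun i => inv_ne_zero (hq0 i)) ?_
    rw [hβ, cremona_inv hq0]
    exact hq _ (Finset.prod_ne_zero_iff.2 fun i _ => inv_ne_zero (hq0 i))
  -- The transformed cubic has triple points at `α` and `β`, so it is constant along their span and
  -- depends on two variables only.
  have htr : ∀ (w : Fin 4 → ℂ) (s t : ℂ), eval (w + s • α + t • β) g = eval w g := fun w s t => by
    rw [eval_add_smul_of_mem_pow hg hgβ, eval_add_smul_of_mem_pow hg hgα]
  have hmin : ∀ i j, i ≠ j → α i * β j - α j * β i ≠ 0 := by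
    intro i j hij h
    apply hpq i j hij
    simp only [hα, hβ] at h
    have := hp0 i
    have := hp0 j
    have := hq0 i
    have := hq0 j
    field_simp at h
    linear_combination -h
  clear_value α β
  -- On the line `y 2 = y 3 = 0` the exponent bound excludes the pure cubes, so two coefficients
  -- remain.
  obtain ⟨A, B, hAB⟩ : ∃ A B : ℂ, ∀ s t : ℂ, eval ![s, t, 0, 0] g = s * t * (A * s + B * t) := by
    refine ⟨∑ e ∈ g.support, if e 0 = 2 ∧ e 1 = 1 then coeff e g else 0,
      ∑ e ∈ g.support, if e 0 = 1 ∧ e 1 = 2 then coeff e g else 0, fun s t => ?_⟩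
    rw [eval_eq', Finset.sum_mul, Finset.sum_mul, ← Finset.sum_add_distrib, Finset.mul_sum]
    refine Finset.sum_congr rfl fun e h => ?_
    have hdeg := degree_eq_of_mem_support hg h
    rw [degree_fin_four] at hdeg
    have e0 := hg2 e h 0
    have e1 := hg2 e h 1
    rw [Fin.prod_univ_four]
    have hc : (e 0 = 2 ∧ e 1 = 1 ∧ e 2 = 0 ∧ e 3 = 0) ∨ (e 0 = 1 ∧ e 1 = 2 ∧ e 2 = 0 ∧ e 3 = 0) ∨
      e 2 ≠ 0 ∨ e 3 ≠ 0 := by omega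
    by_cases h2 : e 2 = 0
    · by_cases h3 : e 3 = 0
      · rcases hc with ⟨h0, h1, -, -⟩ | ⟨h0, h1, -, -⟩ | h' | h'
        · simp [h0, h1, h2, h3]; ring
        · simp [h0, h1, h2, h3]; ring
        · exact absurd h2 h'
        · exact absurd h3 h'
      · rw [if_neg (by omega), if_neg (by omega)]
        simp [h3]
    · rw [if_neg (by omega), if_neg (by omega)]
      simp [h2]
  -- Projection of `y` along the span of `α` and `β` to the line `y 2 = y 3 = 0`, scaled by a minor
  -- to avoid division.
  have hred : ∀ y : Fin 4 → ℂ, (α 2 * β 3 - α 3 * β 2) • y =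
      ![y 0 * (α 2 * β 3 - α 3 * β 2) - y 2 * (α 0 * β 3 - α 3 * β 0) + y 3 * (α 0 * β 2 - α 2 * β 0),
        y 1 * (α 2 * β 3 - α 3 * β 2) - y 2 * (α 1 * β 3 - α 3 * β 1) + y 3 * (α 1 * β 2 - α 2 * β 1),
        0, 0] + (y 2 * β 3 - y 3 * β 2) • α + (y 3 * α 2 - y 2 * α 3) • β := by
    intro y
    ext i
    simp only [Pi.add_apply, Pi.smul_apply, smul_eq_mul]
    fin_cases i <;> simp <;> ring
  have hsingle : ∀ i, eval (Pi.single i 1) g = 0 := by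
    intro i
    rw [eval_eq']
    refine Finset.sum_eq_zero fun e h => ?_
    have hdeg := degree_eq_of_mem_support hg h
    rw [Finsupp.degree_eq_sum, ← Finset.add_sum_erase _ _ (Finset.mem_univ i)] at hdeg
    have h2 := hg2 e h i
    obtain ⟨j, hj, hj0⟩ : ∃ j ∈ Finset.univ.erase i, e j ≠ 0 := by
      by_contra! hcon
      rw [Finset.sum_eq_zero hcon] at hdeg
      omega
    rw [Finset.prod_eq_zero (Finset.mem_univ j), mul_zero]
    rw [Pi.single_eq_of_ne (Finset.ne_of_mem_erase hj), zero_pow hj0]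
  have heval : ∀ y : Fin 4 → ℂ, (α 2 * β 3 - α 3 * β 2) ^ 3 * eval y g = eval ![y 0 * (α 2 * β 3 - α 3 * β 2) - y 2 * (α 0 * β 3 - α 3 * β 0) + y 3 * (α 0 * β 2 - α 2 * β 0),
        y 1 * (α 2 * β 3 - α 3 * β 2) - y 2 * (α 1 * β 3 - α 3 * β 1) + y 3 * (α 1 * β 2 - α 2 * β 1),
        0, 0] g := fun y => by
    rw [← IsHomogeneous.eval_smul hg, hred, htr]
  -- The images of the last two coordinate points are two further zeros of the binary cubic. The
  -- nonvanishing minors make all four zeros distinct.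
  have h2 := heval (Pi.single 2 1)
  have h3 := heval (Pi.single 3 1)
  rw [hsingle, hAB, mul_zero] at h2 h3
  simp only [Pi.single_eq_same, ne_eq, Fin.reduceEq, not_false_eq_true, Pi.single_eq_of_ne] at h2 h3
  have m01 := hmin 0 1 (by decide)
  have m02 := hmin 0 2 (by decide)
  have m03 := hmin 0 3 (by decide)
  have m12 := hmin 1 2 (by decide)
  have m13 := hmin 1 3 (by decide)
  have m23 := hmin 2 3 (by decide)
  have h2' : A * (α 0 * β 3 - α 3 * β 0) + B * (α 1 * β 3 - α 3 * β 1) = 0 := by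
    refine (mul_eq_zero.1 ?_).resolve_left (mul_ne_zero m03 m13)
    linear_combination h2
  have h3' : A * (α 0 * β 2 - α 2 * β 0) + B * (α 1 * β 2 - α 2 * β 1) = 0 := by
    refine (mul_eq_zero.1 ?_).resolve_left (mul_ne_zero m02 m12)
    linear_combination -h3
  have hA : A = 0 := by
    refine (mul_eq_zero.1 ?_).resolve_right (mul_ne_zero m01 m23)
    linear_combination (α 1 * β 3 - α 3 * β 1) * h3' - (α 1 * β 2 - α 2 * β 1) * h2'
  have hB : B = 0 := by
    refine (mul_eq_zero.1 ?_).resolve_right (mul_ne_zero m01 m23)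
    linear_combination (α 0 * β 2 - α 2 * β 0) * h2' - (α 0 * β 3 - α 3 * β 0) * h3'
  have hg0 : g = 0 := by
    refine MvPolynomial.funext fun y => ?_
    have := heval y
    rw [hAB, hA, hB] at this
    simpa [m23] using this
  exact eq_zero_of_cremona_eq_zero hf (by rw [hfg, hg0, mul_zero])

end SmallExponents

/-! ### Differentials of forms vanishing on a subspace -/

section Gradient

variable {n : Type*} [Fintype n]

/-- The differential of a polynomial at a point. -/
noncomputable def gradient (f : MvPolynomial n ℂ) (x : n → ℂ) : (n → ℂ) →ₗ[ℂ] ℂ :=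
  ∑ i, eval x (pderiv i f) • LinearMap.proj i

theorem gradient_apply (f : MvPolynomial n ℂ) (x w : n → ℂ) :
    gradient f x w = eval x (dirDeriv w f) := by
  simp [gradient, dirDeriv, mul_comm]

theorem eval_dirDeriv_eq_zero_of_mem_span {f : MvPolynomial n ℂ} {x : n → ℂ} {S : Set (n → ℂ)}
    (h : ∀ w ∈ S, eval x (dirDeriv w f) = 0) {w : n → ℂ} (hw : w ∈ Submodule.span ℂ S) :
    eval x (dirDeriv w f) = 0 := by
  have : Submodule.span ℂ S ≤ LinearMap.ker (gradient f x) := Submodule.span_le.2 fun w hw => by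
    rw [SetLike.mem_coe, LinearMap.mem_ker, gradient_apply, h w hw]
  rw [← gradient_apply]
  exact this hw

theorem eval_dirDeriv_of_vanishing {f : MvPolynomial n ℂ} {W : Submodule ℂ (n → ℂ)}
    (hW : ∀ x ∈ W, eval x f = 0) {x w : n → ℂ} (hx : x ∈ W) (hw : w ∈ W) :
    eval x (dirDeriv w f) = 0 := by
  have h : pull ![x, w] f = 0 := by
    rw [pull_eq_zero_iff]
    intro y
    refine hW _ ?_
    rw [Fin.sum_univ_two]
    exact W.add_mem (W.smul_mem _ hx) (W.smul_mem _ hw)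
  have h1 := pderiv_pull ![x, w] 1 f
  rw [h, map_zero] at h1
  have h2 := congr_arg (eval ![1, 0]) h1
  rw [eval_pull] at h2
  simpa using h2.symm

theorem eval_taylor_of_vanishing {n : Type*} {f : MvPolynomial n ℂ} {W : Submodule ℂ (n → ℂ)}
    (hW : ∀ x ∈ W, eval x f = 0) {x w : n → ℂ} (hx : x ∈ W) (hw : w ∈ W) (k : ℕ) :
    eval w (taylor x k f) = 0 := by
  have h : pull ![x, w] f = 0 := by
    rw [pull_eq_zero_iff]
    intro y
    refine hW _ ?_
    rw [Fin.sum_univ_two]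
    exact W.add_mem (W.smul_mem _ hx) (W.smul_mem _ hw)
  have h1 := taylor_pull ![x, w] ![1, 0] k f
  rw [h] at h1
  have h2 := congr_arg (eval ![0, 1]) h1
  rw [eval_pull] at h2
  simpa [taylor] using h2.symm

end Gradient

/-! ### Triple points on lines and planes -/

section Triple

/-- The vector `v` spans a singular point of the hypersurface `F = 0`. -/
def IsSing (F : Poly) (v : Fin 5 → ℂ) : Prop := v ≠ 0 ∧ ∀ w, eval v (dirDeriv w F) = 0

/-- A quintic form with finitely many singular points, all of which are ordinary triple points. -/
structure TripleData (F : Poly) : Prop where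
  hom : F.IsHomogeneous 5
  ord : ∀ v, IsSing F v → F ∈ pointIdeal v ^ 3
  smooth : ∀ v, IsSing F v → ∀ x, (∀ w, eval x (dirDeriv w (taylor v 3 F)) = 0) →
    x ∈ Submodule.span ℂ {v}
  fin : ∃ s : Finset (Fin 5 → ℂ), ∀ v, IsSing F v → ∃ u ∈ s, v ∈ Submodule.span ℂ {u}

theorem mem_span_singleton_symm {V : Type*} [AddCommGroup V] [Module ℂ V] {x u : V}
    (hx : x ≠ 0) (h : x ∈ Submodule.span ℂ {u}) : u ∈ Submodule.span ℂ {x} := by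
  obtain ⟨c, rfl⟩ := Submodule.mem_span_singleton.1 h
  refine Submodule.mem_span_singleton.2 ⟨c⁻¹, ?_⟩
  rw [smul_smul, inv_mul_cancel₀, one_smul]
  rintro rfl
  simp at hx

variable {F : Poly}

theorem TripleData.isSing_smul (h : TripleData F) {v : Fin 5 → ℂ} (hv : IsSing F v) {c : ℂ}
    (hc : c ≠ 0) : IsSing F (c • v) := by
  refine ⟨smul_ne_zero hc hv.1, fun w => ?_⟩
  rw [IsHomogeneous.eval_smul (isHomogeneous_dirDeriv w h.hom), hv.2, mul_zero]

/-- Distinctness is measured by spans because `fin` bounds the projective singular points, not their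
representatives. -/
theorem TripleData.not_infinite (h : TripleData F) {ι : Type*} [Infinite ι]
    (c : ι → Fin 5 → ℂ) (hc : ∀ t, IsSing F (c t))
    (hinj : ∀ t t', c t ∈ Submodule.span ℂ {c t'} → t = t') : False := by
  obtain ⟨s, hs⟩ := h.fin
  choose u hus hu using fun t => hs (c t) (hc t)
  obtain ⟨t, t', hne, heq⟩ := Finite.exists_ne_map_eq_of_infinite fun t => (⟨u t, hus t⟩ : s)
  refine hne (hinj t t' ?_)
  have h1 := mem_span_singleton_symm (hc t').1 (hu t')
  have h2 : u t = u t' := congr_arg Subtype.val heq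
  have h3 := hu t
  rw [h2] at h3
  exact (Submodule.span_singleton_le_iff_mem _ _).2 h1 h3

/-- Otherwise `F` would be singular at all points `A i + t • A j` of a line. -/
theorem TripleData.exists_pull_dirDeriv_ne_zero (h : TripleData F) {k : ℕ}
    {A : Fin k → Fin 5 → ℂ} (hA : LinearIndependent ℂ A) (hk : 2 ≤ k) :
    ∃ z, pull A (dirDeriv z F) ≠ 0 := by
  by_contra! hcon
  simp_rw [pull_eq_zero_iff] at hcon
  obtain ⟨i, j, hij⟩ : ∃ i j : Fin k, i ≠ j := ⟨⟨0, by omega⟩, ⟨1, by omega⟩, by simp⟩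
  have hli : LinearIndependent ℂ ![A i, A j] := by
    have := hA.comp ![i, j] (by
      intro a b
      fin_cases a <;> fin_cases b <;> simp [hij, hij.symm])
    convert this using 1
    ext a
    fin_cases a <;> rfl
  rw [LinearIndependent.pair_iff] at hli
  refine h.not_infinite (fun t : ℂ => A i + t • A j) (fun t => ⟨fun h0 => ?_, fun z => ?_⟩) ?_
  · exact one_ne_zero (hli 1 t (by rwa [one_smul])).1
  · have := hcon z (Pi.single i 1 + Pi.single j t)
    simpa [add_smul, Finset.sum_add_distrib, Pi.single_apply] using this
  · intro t t' hm
    obtain ⟨c, hc⟩ := Submodule.mem_span_singleton.1 hm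
    have := hli (c - 1) (c * t' - t) (by
      rw [← sub_eq_zero] at hc
      rw [← hc]
      module)
    have h1 := sub_eq_zero.1 this.1
    have h2 := this.2
    rw [h1] at h2
    linear_combination -h2

/-- A quartic with a double point: `e i + 2 ≤ 4`. -/
theorem TripleData.le_two_of_mem_support_dirDeriv (h : TripleData F) {k : ℕ}
    {A : Fin k → Fin 5 → ℂ} {i : Fin k} (hi : IsSing F (A i)) (z : Fin 5 → ℂ) {e : Fin k →₀ ℕ}
    (he : e ∈ (pull A (dirDeriv z F)).support) : e i ≤ 2 := by
  have := add_le_of_mem_support (k := 2)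
    (isHomogeneous_pull A (isHomogeneous_dirDeriv z h.hom)) (i := i)
    (pull_mem_pointIdeal_pow _ _ (dirDeriv_mem_pointIdeal_pow _ _ ?_)) he
  · omega
  · simpa [Pi.single_apply] using h.ord _ hi

/-- A quintic with a triple point: `e i + 3 ≤ 5`. -/
theorem TripleData.le_two_of_mem_support (h : TripleData F) {k : ℕ}
    {A : Fin k → Fin 5 → ℂ} {i : Fin k} (hi : IsSing F (A i)) {e : Fin k →₀ ℕ}
    (he : e ∈ (pull A F).support) : e i ≤ 2 := by
  have := add_le_of_mem_support (k := 3)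
    (isHomogeneous_pull A h.hom) (i := i) (pull_mem_pointIdeal_pow _ _ ?_) he
  · omega
  · simpa [Pi.single_apply] using h.ord _ hi

/-- The line through two triple points lies on the quintic. -/
theorem TripleData.eval_add_eq_zero (h : TripleData F) {v w : Fin 5 → ℂ} (hv : IsSing F v)
    (hw : IsSing F w) (a b : ℂ) : eval (a • v + b • w) F = 0 := by
  have h0 : pull ![v, w] F = 0 := by
    by_contra h0
    obtain ⟨e, he⟩ := Finset.nonempty_iff_ne_empty.2 (mt support_eq_empty.1 h0)
    have h1 := h.le_two_of_mem_support (A := ![v, w]) (i := 0) hv he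
    have h2 := h.le_two_of_mem_support (A := ![v, w]) (i := 1) hw he
    have h3 := degree_eq_of_mem_support (isHomogeneous_pull _ h.hom) he
    rw [Finsupp.degree_eq_sum, Fin.sum_univ_two] at h3
    omega
  have := (pull_eq_zero_iff _ _).1 h0 ![a, b]
  simpa [Fin.sum_univ_two] using this

/-- No three triple points are collinear. -/
theorem TripleData.not_isSing_add (h : TripleData F) {v w : Fin 5 → ℂ}
    (hli : LinearIndependent ℂ ![v, w]) (hv : IsSing F v) (hw : IsSing F w) {a b : ℂ}
    (ha : a ≠ 0) (hb : b ≠ 0) : ¬ IsSing F (a • v + b • w) := by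
  intro hs
  obtain ⟨z, hz⟩ := h.exists_pull_dirDeriv_ne_zero hli le_rfl
  -- A derivative restricts to a multiple of `y₀² y₁²`. A third singular point makes the multiple
  -- zero for every direction `z`.
  have hexp : ∀ e ∈ (pull ![v, w] (dirDeriv z F)).support, e 0 = 2 ∧ e 1 = 2 := by
    intro e he
    have h1 := h.le_two_of_mem_support_dirDeriv (A := ![v, w]) (i := 0) hv z he
    have h2 := h.le_two_of_mem_support_dirDeriv (A := ![v, w]) (i := 1) hw z he
    have h3 := degree_eq_of_mem_support (isHomogeneous_pull _ (isHomogeneous_dirDeriv z h.hom)) he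
    rw [Finsupp.degree_eq_sum, Fin.sum_univ_two] at h3
    omega
  have heval : ∀ y : Fin 2 → ℂ, eval y (pull ![v, w] (dirDeriv z F)) =
      (y 0 * y 1) ^ 2 * ∑ e ∈ (pull ![v, w] (dirDeriv z F)).support,
        coeff e (pull ![v, w] (dirDeriv z F)) := by
    intro y
    rw [eval_eq', Finset.mul_sum]
    refine Finset.sum_congr rfl fun e he => ?_
    rw [Fin.prod_univ_two, (hexp e he).1, (hexp e he).2]
    ring
  have h1 := heval ![a, b]
  rw [eval_pull, Fin.sum_univ_two] at h1
  have h2 := hs.2 z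
  simp only [Matrix.cons_val_zero, Matrix.cons_val_one] at h1
  rw [h2] at h1
  have h3 := (mul_eq_zero.1 h1.symm).resolve_left (by simp [ha, hb])
  refine hz (MvPolynomial.funext fun y => ?_)
  rw [heval, h3, mul_zero, map_zero]

/-- The only exponents of sum 5 with entries at most 2 are the permutations of `(1, 2, 2)`. -/
theorem exists_eval_eq_of_le_two {f : MvPolynomial (Fin 3) ℂ} (hf : f.IsHomogeneous 5)
    (h2 : ∀ e ∈ f.support, ∀ i, e i ≤ 2) : ∃ α β γ : ℂ, ∀ y : Fin 3 → ℂ,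
      eval y f = y 0 * y 1 * y 2 * (α * (y 1 * y 2) + β * (y 0 * y 2) + γ * (y 0 * y 1)) := by
  refine ⟨∑ e ∈ f.support, if e 0 = 1 then coeff e f else 0,
    ∑ e ∈ f.support, if e 1 = 1 then coeff e f else 0,
    ∑ e ∈ f.support, if e 2 = 1 then coeff e f else 0, fun y => ?_⟩
  rw [eval_eq', Finset.sum_mul, Finset.sum_mul, Finset.sum_mul, ← Finset.sum_add_distrib,
    ← Finset.sum_add_distrib, Finset.mul_sum]
  refine Finset.sum_congr rfl fun e h => ?_
  have hdeg := degree_eq_of_mem_support hf h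
  rw [Finsupp.degree_eq_sum, Fin.sum_univ_three] at hdeg
  have e0 := h2 e h 0
  have e1 := h2 e h 1
  have e2 := h2 e h 2
  rw [Fin.prod_univ_three]
  have hc : (e 0 = 1 ∧ e 1 = 2 ∧ e 2 = 2) ∨ (e 0 = 2 ∧ e 1 = 1 ∧ e 2 = 2) ∨
    (e 0 = 2 ∧ e 1 = 2 ∧ e 2 = 1) := by omega
  rcases hc with ⟨h0, h1, h2⟩ | ⟨h0, h1, h2⟩ | ⟨h0, h1, h2⟩
  all_goals
    simp only [h0, h1, h2, OfNat.ofNat_ne_one, if_true, if_false]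
    ring

/-- The hypothesis is the restriction of the plane quintic to the line joining the fourth triple
point to a vertex of the triangle. The parameters `s = x` and `s = 2 * x` avoid the zero of `x + s`.
-/
theorem eq_zero_of_forall_add_mul {x y z α B : ℂ} (hx : x ≠ 0) (hy : y ≠ 0) (hz : z ≠ 0)
    (h : ∀ s, (x + s) * (y * z) * (α * (y * z) + (x + s) * B) = 0) : α = 0 := by
  have h1 := (mul_eq_zero.1 (h x)).resolve_left
    (mul_ne_zero (by rw [← two_mul]; simpa using hx) (mul_ne_zero hy hz))
  have h2 := (mul_eq_zero.1 (h (2 * x))).resolve_left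
    (mul_ne_zero (by rw [show x + 2 * x = 3 * x by ring]; simpa using hx) (mul_ne_zero hy hz))
  refine (mul_eq_zero.1 ?_).resolve_right (mul_ne_zero hy hz)
  linear_combination 3 * h1 - 2 * h2

/-- A plane with four triple points lies on the quintic. -/
theorem TripleData.pull_eq_zero_of_four (h : TripleData F) {A : Fin 3 → Fin 5 → ℂ}
    (hA : ∀ i, IsSing F (A i)) {p : Fin 3 → ℂ} (hp : ∀ i, p i ≠ 0)
    (hs : IsSing F (∑ i, p i • A i)) : pull A F = 0 := by
  obtain ⟨α, β, γ, hf⟩ := exists_eval_eq_of_le_two (isHomogeneous_pull A h.hom)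
    fun e he i => h.le_two_of_mem_support (hA i) he
  have hline : ∀ (i : Fin 3) (s : ℂ), eval (p + s • Pi.single i 1) (pull A F) = 0 := by
    intro i s
    rw [eval_pull]
    have := h.eval_add_eq_zero hs (hA i) 1 s
    rw [one_smul] at this
    convert this using 2
    simp [add_smul, Finset.sum_add_distrib, Pi.single_apply]
  have p0 := hp 0
  have p1 := hp 1
  have p2 := hp 2
  have hα : α = 0 := by
    refine eq_zero_of_forall_add_mul p0 p1 p2 (B := β * p 2 + γ * p 1) fun s => ?_
    rw [← hline 0 s, hf]
    simp
    ring
  have hβ : β = 0 := by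
    refine eq_zero_of_forall_add_mul p1 p0 p2 (B := α * p 2 + γ * p 0) fun s => ?_
    rw [← hline 1 s, hf]
    simp
    ring
  have hγ : γ = 0 := by
    refine eq_zero_of_forall_add_mul p2 p0 p1 (B := α * p 1 + β * p 0) fun s => ?_
    rw [← hline 2 s, hf]
    simp
    ring
  refine MvPolynomial.funext fun y => ?_
  rw [hf, hα, hβ, hγ]
  simp

/-- A plane with three triple points whose intersection with some plane of the quintic is a line
away from these points lies on the quintic. -/
theorem TripleData.pull_eq_zero_of_line (h : TripleData F) {A : Fin 3 → Fin 5 → ℂ}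
    (hA : ∀ i, IsSing F (A i)) {a : Fin 3 → ℂ} (ha : ∀ i, a i ≠ 0)
    (hl : ∀ y : Fin 3 → ℂ, ∑ i, a i * y i = 0 → eval (∑ i, y i • A i) F = 0) :
    pull A F = 0 := by
  obtain ⟨α, β, γ, hf⟩ := exists_eval_eq_of_le_two (isHomogeneous_pull A h.hom)
    fun e he i => h.le_two_of_mem_support (hA i) he
  have a0 := ha 0
  have a1 := ha 1
  have a2 := ha 2
  -- The line is parametrized by `y i = p i / a i` with coordinate sum zero. Three of its points
  -- determine the residual conic.
  have key : ∀ p q r : ℂ, p ≠ 0 → q ≠ 0 → r ≠ 0 → p + q + r = 0 →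
      α * a 0 * (q * r) + β * a 1 * (p * r) + γ * a 2 * (p * q) = 0 := by
    intro p q r hp hq hr hpqr
    have h1 := hl ![p / a 0, q / a 1, r / a 2] (by
      rw [Fin.sum_univ_three]
      simp only [Matrix.cons_val]
      field_simp
      exact hpqr)
    rw [← eval_pull, hf] at h1
    simp only [Matrix.cons_val] at h1
    have h2 := (mul_eq_zero.1 h1).resolve_left (by simp [hp, hq, hr, a0, a1, a2])
    field_simp at h2
    linear_combination h2
  have h1 := key 1 1 (-2) (by norm_num) (by norm_num) (by norm_num) (by norm_num)
  have h2 := key 1 (-2) 1 (by norm_num) (by norm_num) (by norm_num) (by norm_num)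
  have h3 := key (-2) 1 1 (by norm_num) (by norm_num) (by norm_num) (by norm_num)
  have hα : α = 0 := by
    refine (mul_eq_zero.1 ?_).resolve_right a0
    linear_combination (-2 / 9) * h1 - 2 / 9 * h2 + 1 / 9 * h3
  have hβ : β = 0 := by
    refine (mul_eq_zero.1 ?_).resolve_right a1
    linear_combination (-2 / 9) * h1 + 1 / 9 * h2 - 2 / 9 * h3
  have hγ : γ = 0 := by
    refine (mul_eq_zero.1 ?_).resolve_right a2
    linear_combination 1 / 9 * h1 - 2 / 9 * h2 - 2 / 9 * h3
  refine MvPolynomial.funext fun y => ?_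
  rw [hf, hα, hβ, hγ]
  simp

/-- Five triple points are not coplanar. -/
theorem TripleData.false_of_five (h : TripleData F) {A : Fin 3 → Fin 5 → ℂ}
    (hli : LinearIndependent ℂ A) (hA : ∀ i, IsSing F (A i)) {p q : Fin 3 → ℂ}
    (hp0 : ∀ i, p i ≠ 0) (hq0 : ∀ i, q i ≠ 0) (hpq : p 0 * q 1 ≠ p 1 * q 0)
    (hp : IsSing F (∑ i, p i • A i)) (hq : IsSing F (∑ i, q i • A i)) : False := by
  -- All derivatives vanish on the Cremona image of the line that joins the inverses of `p` and `q`;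
  -- this image is the conic through the five points.
  have hzero : ∀ (s : ℂ) (z : Fin 5 → ℂ),
      eval (cremona ((fun i => (p i)⁻¹) + s • fun i => (q i)⁻¹)) (pull A (dirDeriv z F)) = 0 := by
    intro s z
    have hhom := isHomogeneous_pull A (isHomogeneous_dirDeriv z h.hom)
    obtain ⟨g, hg, -, hfg⟩ := exists_cremona_transform (by norm_num) hhom
      fun e he i => h.le_two_of_mem_support_dirDeriv (hA i) z he
    norm_num at hg
    have hord : ∀ r : Fin 3 → ℂ, (∀ i, r i ≠ 0) → IsSing F (∑ i, r i • A i) →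
        g ∈ pointIdeal (fun i => (r i)⁻¹) ^ 2 := by
      intro r hr hrs
      refine mem_pointIdeal_pow_of_cremona hfg (fun i => inv_ne_zero (hr i)) ?_
      rw [cremona_inv hr]
      refine pull_mem_pointIdeal_pow _ _ (dirDeriv_mem_pointIdeal_pow _ _ (h.ord _ ?_))
      simp only [Pi.smul_apply, smul_assoc, ← Finset.smul_sum]
      exact h.isSing_smul hrs (Finset.prod_ne_zero_iff.2 fun i _ => inv_ne_zero (hr i))
    -- The transform is a conic with two double points, hence invariant under translation along
    -- both. Its value on the joining line is its value at the origin.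
    have h0 := eval_add_smul_of_mem_pow hg (hord p hp0 hp) 0 1
    rw [zero_add, one_smul] at h0
    rw [eval_cremona hfg, eval_add_smul_of_mem_pow hg (hord q hq0 hq), h0]
    have : eval (0 : Fin 3 → ℂ) g = 0 := by
      have := IsHomogeneous.eval_smul hg 0 0
      simpa using this
    rw [this, mul_zero]
  set y : ℂ → Fin 3 → ℂ := fun s => (fun i => (p i)⁻¹) + s • fun i => (q i)⁻¹ with hy
  -- A coordinate of `y s` vanishes only at `s = -(q i) / p i`. Away from these parameters the
  -- Cremona map is injective.
  have hinf : {s : ℂ | ∀ i, y s i ≠ 0}.Infinite := by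
    refine (Set.finite_range fun i => -(q i) / p i).infinite_compl.mono ?_
    intro s hs i h0
    refine hs ⟨i, ?_⟩
    have := hp0 i
    have := hq0 i
    simp only [hy, Pi.add_apply, Pi.smul_apply, smul_eq_mul] at h0
    field_simp at h0 ⊢
    linear_combination -h0
  have := hinf.to_subtype
  refine h.not_infinite (fun t : {s : ℂ | ∀ i, y s i ≠ 0} => ∑ i, cremona (y t) i • A i)
    (fun t => ⟨fun h0 => ?_, fun z => ?_⟩) ?_
  · have h1 := Fintype.linearIndependent_iff.1 hli _ h0 0
    have h2 := mul_cremona (y t) 0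
    rw [h1, mul_zero] at h2
    exact Finset.prod_ne_zero_iff.2 (fun i _ => t.2 i) h2.symm
  · rw [← eval_pull]
    exact hzero t z
  · rintro ⟨t, ht⟩ ⟨t', ht'⟩ hm
    obtain ⟨c, hc⟩ := Submodule.mem_span_singleton.1 hm
    simp only at hc
    rw [Finset.smul_sum, ← sub_eq_zero, ← Finset.sum_sub_distrib] at hc
    simp only [smul_smul, ← sub_smul] at hc
    have h1 := Fintype.linearIndependent_iff.1 hli _ hc
    have e0 := mul_cremona (y t) 0
    have e1 := mul_cremona (y t) 1
    have e0' := mul_cremona (y t') 0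
    have e1' := mul_cremona (y t') 1
    have hP : ∏ i, y t i ≠ 0 := Finset.prod_ne_zero_iff.2 fun i _ => ht i
    -- Proportional images have inversely proportional coordinates, so the ratio of the first two
    -- coordinates of `y` is recovered. It determines `t` because `p 0 * q 1 ≠ p 1 * q 0`.
    have h2 : y t' 0 * y t 1 = y t' 1 * y t 0 := by
      refine mul_left_cancel₀ hP ?_
      linear_combination -(y t' 0 * y t 1) * e0 + (y t' 1 * y t 0) * e1
        - y t 0 * y t 1 * y t' 0 * h1 0 + y t 0 * y t 1 * y t' 1 * h1 1
        + y t 0 * y t 1 * c * (e0' - e1')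
    refine Subtype.ext (sub_eq_zero.1 ((mul_eq_zero.1 ?_).resolve_right (sub_ne_zero.2 hpq)))
    have := hp0 0
    have := hp0 1
    have := hq0 0
    have := hq0 1
    simp only [hy, Pi.add_apply, Pi.smul_apply, smul_eq_mul] at h2
    field_simp at h2
    linear_combination -h2

end Triple

/-! ### General position of triple points -/

section Position

variable {F : Poly}

theorem TripleData.notMem_span_pair (h : TripleData F) {u v w : Fin 5 → ℂ} (hu : IsSing F u)
    (hv : IsSing F v) (hw : IsSing F w) (huv : u ∉ Submodule.span ℂ {v})
    (huw : u ∉ Submodule.span ℂ {w}) (hvw : w ∉ Submodule.span ℂ {v}) :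
    u ∉ Submodule.span ℂ {v, w} := by
  intro hm
  obtain ⟨a, b, rfl⟩ := Submodule.mem_span_pair.1 hm
  have hli : LinearIndependent ℂ ![v, w] := by
    rw [LinearIndependent.pair_iff' hv.1]
    intro c hc
    exact hvw (Submodule.mem_span_singleton.2 ⟨c, hc⟩)
  refine h.not_isSing_add hli hv hw ?_ ?_ hu
  · rintro rfl
    refine huw (Submodule.mem_span_singleton.2 ⟨b, by simp⟩)
  · rintro rfl
    refine huv (Submodule.mem_span_singleton.2 ⟨a, by simp⟩)

theorem TripleData.linearIndependent (h : TripleData F) {v : Fin 3 → Fin 5 → ℂ}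
    (hv : ∀ i, IsSing F (v i)) (hne : ∀ i j, i ≠ j → v i ∉ Submodule.span ℂ {v j}) :
    LinearIndependent ℂ v := by
  have hv3 : v = Fin.cons (v 0) ![v 1, v 2] := by
    ext i
    fin_cases i <;> rfl
  rw [hv3, linearIndependent_finCons]
  constructor
  · rw [LinearIndependent.pair_iff' (hv 1).1]
    intro c hc
    exact hne 2 1 (by decide) (Submodule.mem_span_singleton.2 ⟨c, hc⟩)
  · have := h.notMem_span_pair (hv 0) (hv 1) (hv 2) (hne 0 1 (by decide)) (hne 0 2 (by decide))
      (hne 2 1 (by decide))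
    simpa [Matrix.range_cons, Set.pair_comm] using this

theorem exists_sum_smul_eq {V : Type*} [AddCommGroup V] [Module ℂ V] {k : ℕ} {A : Fin k → V}
    (hA : LinearIndependent ℂ A) {W : Submodule ℂ V} [FiniteDimensional ℂ W]
    (hAW : ∀ i, A i ∈ W) (hW : Module.finrank ℂ W = k) {x : V} (hx : x ∈ W) :
    ∃ p : Fin k → ℂ, ∑ i, p i • A i = x := by
  have h1 : Submodule.span ℂ (Set.range A) = W := by
    refine Submodule.eq_of_le_of_finrank_eq (Submodule.span_le.2 ?_) ?_
    · rintro _ ⟨i, rfl⟩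
      exact hAW i
    · rw [finrank_span_eq_card hA, Fintype.card_fin, hW]
  rw [← h1] at hx
  exact (Submodule.mem_span_range_iff_exists_fun ℂ).1 hx

theorem sum_mem_span_pair {V : Type*} [AddCommGroup V] [Module ℂ V] {A : Fin 3 → V}
    {p : Fin 3 → ℂ} {i : Fin 3} (hi : p i = 0) :
    ∃ j k, j ≠ k ∧ ∑ i, p i • A i ∈ Submodule.span ℂ {A j, A k} := by
  have key : ∀ j k : Fin 3, ∑ i, p i • A i = p j • A j + p k • A k →
      ∑ i, p i • A i ∈ Submodule.span ℂ {A j, A k} := fun j k h =>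
    Submodule.mem_span_pair.2 ⟨p j, p k, h.symm⟩
  fin_cases i
  · exact ⟨1, 2, by decide, key 1 2 (by simp_all [Fin.sum_univ_three])⟩
  · exact ⟨0, 2, by decide, key 0 2 (by simp_all [Fin.sum_univ_three])⟩
  · exact ⟨0, 1, by decide, key 0 1 (by simp_all [Fin.sum_univ_three])⟩

/-- A zero coordinate would put the point on a line through two of the `A j`. -/
theorem TripleData.coord_ne_zero (h : TripleData F) {A : Fin 3 → Fin 5 → ℂ} {p : Fin 3 → ℂ}
    (hA : ∀ i, IsSing F (A i)) (hne : ∀ i j, i ≠ j → A i ∉ Submodule.span ℂ {A j})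
    (hs : IsSing F (∑ i, p i • A i)) (hs' : ∀ j, ∑ i, p i • A i ∉ Submodule.span ℂ {A j})
    (i : Fin 3) : p i ≠ 0 := by
  intro hi
  obtain ⟨j, k, hjk, hm⟩ := sum_mem_span_pair (A := A) hi
  exact h.notMem_span_pair hs (hA j) (hA k) (hs' j) (hs' k) (hne k j hjk.symm) hm

/-- A family of singular points, no two of which coincide. -/
structure IsSingFamily (F : Poly) {ι : Type*} (v : ι → Fin 5 → ℂ) : Prop where
  sing : ∀ i, IsSing F (v i)
  ne : ∀ i j, i ≠ j → v i ∉ Submodule.span ℂ {v j}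

theorem IsSingFamily.comp {ι κ : Type*} {v : ι → Fin 5 → ℂ} (hv : IsSingFamily F v) {σ : κ → ι}
    (hσ : Function.Injective σ) : IsSingFamily F (v ∘ σ) :=
  ⟨fun _ => hv.sing _, fun _ _ hij => hv.ne _ _ (hσ.ne hij)⟩

theorem TripleData.not_five_coplanar (h : TripleData F) {v : Fin 5 → Fin 5 → ℂ}
    (hv : IsSingFamily F v) {E : Submodule ℂ (Fin 5 → ℂ)} (hE : Module.finrank ℂ E = 3)
    (hvE : ∀ i, v i ∈ E) : False := by
  let A : Fin 3 → Fin 5 → ℂ := ![v 0, v 1, v 2]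
  have hA' : A = v ∘ ![0, 1, 2] := by
    ext i
    fin_cases i <;> rfl
  have hA : IsSingFamily F A := by
    rw [hA']
    exact hv.comp (by decide)
  have hli := h.linearIndependent hA.sing hA.ne
  have hAE : ∀ i, A i ∈ E := fun i => by
    rw [hA']
    exact hvE _
  obtain ⟨p, hp⟩ := exists_sum_smul_eq hli hAE hE (hvE 3)
  obtain ⟨q, hq⟩ := exists_sum_smul_eq hli hAE hE (hvE 4)
  have hn : ∀ i : Fin 5, 3 ≤ i → ∀ j : Fin 3, v i ∉ Submodule.span ℂ {A j} := by
    intro i hi j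
    rw [hA']
    refine hv.ne _ _ ?_
    fin_cases j <;> simp <;> rintro rfl <;> simp at hi
  have hp0 := h.coord_ne_zero hA.sing hA.ne (p := p) (by rw [hp]; exact hv.sing 3)
    (fun j => by rw [hp]; exact hn 3 (by decide) j)
  have hq0 := h.coord_ne_zero hA.sing hA.ne (p := q) (by rw [hq]; exact hv.sing 4)
    (fun j => by rw [hq]; exact hn 4 (by decide) j)
  refine h.false_of_five hli hA.sing hp0 hq0 ?_ (by rw [hp]; exact hv.sing 3)
    (by rw [hq]; exact hv.sing 4)
  -- Equal ratios of the first two coordinates would make `v 3`, `v 4` and `v 2` collinear.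
  intro hpq
  refine h.notMem_span_pair (hv.sing 3) (hv.sing 4) (hv.sing 2) (hv.ne _ _ (by decide))
    (hv.ne _ _ (by decide)) (hv.ne _ _ (by decide)) ?_
  refine Submodule.mem_span_pair.2 ⟨p 0 / q 0, p 2 - p 0 / q 0 * q 2, ?_⟩
  have h0 := hq0 0
  rw [← hp, ← hq, Fin.sum_univ_three, Fin.sum_univ_three]
  have h1 : p 0 / q 0 * q 1 = p 1 := by
    field_simp
    rw [hpq, mul_comm]
  have h2 : p 0 / q 0 * q 0 = p 0 := by field_simp
  simp only [smul_add, smul_smul, h1, h2, sub_smul]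
  simp [A]

/-- Three of the points are independent since no three are collinear. The fourth lies in their
plane, on no side of the triangle. -/
theorem TripleData.vanishing_of_four_coplanar (h : TripleData F) {v : Fin 4 → Fin 5 → ℂ}
    (hv : IsSingFamily F v) (hli : ¬ LinearIndependent ℂ v) :
    ∃ A : Fin 3 → Fin 5 → ℂ, LinearIndependent ℂ A ∧
      (∀ i, A i ∈ Submodule.span ℂ (Set.range v)) ∧
      (∀ i, v i ∈ Submodule.span ℂ (Set.range A)) ∧ pull A F = 0 := by
  let A : Fin 3 → Fin 5 → ℂ := fun i => v i.castSucc
  have hA : IsSingFamily F A := hv.comp (Fin.castSucc_injective 3)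
  have hA3 := h.linearIndependent hA.sing hA.ne
  have hv4 : v = Fin.snoc A (v (Fin.last 3)) := by
    ext1 i
    refine Fin.lastCases ?_ (fun j => ?_) i
    · rw [Fin.snoc_last]
    · rw [Fin.snoc_castSucc]
  have hm : v (Fin.last 3) ∈ Submodule.span ℂ (Set.range A) := by
    by_contra hm
    rw [hv4] at hli
    exact hli (linearIndependent_finSnoc.2 ⟨hA3, hm⟩)
  obtain ⟨p, hp⟩ := (Submodule.mem_span_range_iff_exists_fun ℂ).1 hm
  refine ⟨A, hA3, fun i => Submodule.subset_span ⟨_, rfl⟩, fun i => ?_,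
    h.pull_eq_zero_of_four hA.sing (p := p) ?_ (by rw [hp]; exact hv.sing _)⟩
  · refine Fin.lastCases hm (fun j => Submodule.subset_span ⟨j, rfl⟩) i
  · refine h.coord_ne_zero hA.sing hA.ne (by rw [hp]; exact hv.sing _) fun j => ?_
    rw [hp]
    exact hv.ne _ _ (Fin.castSucc_lt_last j).ne'

/-- These two lemmas choose the four points whose independence is contradicted when a coordinate,
respectively a minor, vanishes. -/
theorem exists_injective_of_one : ∀ (m : Fin 6) (i : Fin 4), 4 ≤ m → ∃ j k l : Fin 4,
    Function.Injective ![i, j, k, l] ∧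
      Function.Injective ![m, j.castLE (show 4 ≤ 6 by decide), k.castLE (show 4 ≤ 6 by decide),
        l.castLE (show 4 ≤ 6 by decide)] := by
  decide

theorem exists_injective_of_two : ∀ i j : Fin 4, i ≠ j → ∃ k l : Fin 4,
    Function.Injective ![i, j, k, l] ∧
      Function.Injective ![4, 5, k.castLE (show 4 ≤ 6 by decide),
        l.castLE (show 4 ≤ 6 by decide)] := by
  decide

/-- If a hyperplane section has six triple points, then it contains a plane. -/
theorem TripleData.exists_plane_of_six (h : TripleData F) {v : Fin 6 → Fin 5 → ℂ}
    (hv : IsSingFamily F v) {W : Submodule ℂ (Fin 5 → ℂ)} (hW : Module.finrank ℂ W = 4)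
    (hvW : ∀ i, v i ∈ W) :
    ∃ E ≤ W, Module.finrank ℂ E = 3 ∧ ∀ x ∈ E, eval x F = 0 := by
  obtain ⟨A, hA, hAW, hAF⟩ : ∃ A : Fin 3 → Fin 5 → ℂ, LinearIndependent ℂ A ∧ (∀ i, A i ∈ W) ∧
      pull A F = 0 := by
    by_cases hcop : ∀ σ : Fin 4 → Fin 6, Function.Injective σ → LinearIndependent ℂ (v ∘ σ)
    · let B : Fin 4 → Fin 5 → ℂ := fun i => v (Fin.castLE (by omega) i)
      have hBinj := Fin.castLE_injective (show 4 ≤ 6 by omega)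
      have hB : LinearIndependent ℂ B := hcop _ hBinj
      obtain ⟨p, hp⟩ := exists_sum_smul_eq hB (fun i => hvW _) hW (hvW 4)
      obtain ⟨q, hq⟩ := exists_sum_smul_eq hB (fun i => hvW _) hW (hvW 5)
      have hBv : ∀ i : Fin 4, B i = v (Fin.castLE (by omega) i) := fun _ => rfl
      -- A vanishing coordinate would make `v m` coplanar with three of the basis points.
      have hone : ∀ (m : Fin 6) (r : Fin 4 → ℂ), 4 ≤ m → ∑ i, r i • B i = v m → ∀ i, r i ≠ 0 := by
        intro m r hm hr i hi
        obtain ⟨j, k, l, hσ, hτ⟩ : ∃ j k l : Fin 4, Function.Injective ![i, j, k, l] ∧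
            Function.Injective ![m, j.castLE (show 4 ≤ 6 by omega),
              k.castLE (show 4 ≤ 6 by omega), l.castLE (show 4 ≤ 6 by omega)] := by
          exact exists_injective_of_one m i hm
        have h1 := Fintype.linearIndependent_iff.1 (hcop _ hτ) ![1, -r j, -r k, -r l] (by
          rw [← Equiv.sum_comp (Equiv.ofBijective _
            ((Finite.injective_iff_bijective (α := Fin 4)).1 hσ))] at hr
          simp only [Equiv.ofBijective_apply, Fin.sum_univ_four, Matrix.cons_val, hi] at hr
          simp only [Fin.sum_univ_four, Matrix.cons_val, Function.comp_apply, ← hBv, ← hr]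
          module) 0
        simp at h1
      -- If this minor vanishes, `q j • v 4 - p j • v 5` has no component along `B i` and `B j`, so
      -- `v 4`, `v 5`, `B k`, `B l` are coplanar.
      have htwo : ∀ i j : Fin 4, i ≠ j → p i * q j ≠ p j * q i := by
        intro i j hij hpq
        obtain ⟨k, l, hσ, hτ⟩ : ∃ k l : Fin 4, Function.Injective ![i, j, k, l] ∧
            Function.Injective ![4, 5, k.castLE (show 4 ≤ 6 by omega),
              l.castLE (show 4 ≤ 6 by omega)] := by
          exact exists_injective_of_two i j hij
        have h1 := Fintype.linearIndependent_iff.1 (hcop _ hτ)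
          ![q j, -p j, p j * q k - q j * p k, p j * q l - q j * p l] (by
          have hp' := hp
          have hq' := hq
          rw [← Equiv.sum_comp (Equiv.ofBijective _
            ((Finite.injective_iff_bijective (α := Fin 4)).1 hσ))] at hp' hq'
          simp only [Equiv.ofBijective_apply, Fin.sum_univ_four, Matrix.cons_val] at hp' hq'
          simp only [Fin.sum_univ_four, Matrix.cons_val, Function.comp_apply, ← hBv, ← hp', ← hq']
          have h2 : (p i * q j - p j * q i) • B i = 0 := by rw [hpq, sub_self, zero_smul]
          rw [← h2]
          module) 0
        exact hone 5 q (by decide) hq j h1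
      have hord : ∀ y : Fin 4 → ℂ, IsSing F (∑ i, y i • B i) → ∀ c : ℂ, c ≠ 0 →
          pull B F ∈ pointIdeal (c • y) ^ 3 := by
        intro y hy c hc
        refine pull_mem_pointIdeal_pow _ _ (h.ord _ ?_)
        simp only [Pi.smul_apply, smul_assoc, ← Finset.smul_sum]
        exact h.isSing_smul hy hc
      -- Here `F` vanishes on all of `W`, so any plane of `W` will do.
      have h0 := eq_zero_of_six_triple_points (isHomogeneous_pull B h.hom) (fun i => by
          have := hord (Pi.single i 1) (by simpa [Pi.single_apply] using hv.sing _) 1 one_ne_zero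
          rwa [one_smul] at this)
        (hone 4 p (by decide) hp) (hone 5 q (by decide) hq) htwo
        (hord p (by rw [hp]; exact hv.sing _)) (hord q (by rw [hq]; exact hv.sing _))
      refine ⟨B ∘ Fin.castSucc, hB.comp _ (Fin.castSucc_injective 3), fun i => hvW _, ?_⟩
      rw [pull_eq_zero_iff] at h0 ⊢
      intro y
      have := h0 (Fin.snoc y 0)
      rw [Fin.sum_univ_castSucc, Fin.snoc_last, zero_smul, add_zero] at this
      simpa only [Fin.snoc_castSucc, Function.comp_apply] using this
    · push Not at hcop
      obtain ⟨σ, hσ, hli⟩ := hcop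
      obtain ⟨A, hA, hAs, -, hAF⟩ := h.vanishing_of_four_coplanar (hv.comp hσ) hli
      refine ⟨A, hA, fun i => ?_, hAF⟩
      refine Submodule.span_le.2 ?_ (hAs i)
      rintro _ ⟨i, rfl⟩
      exact hvW _
  refine ⟨Submodule.span ℂ (Set.range A), Submodule.span_le.2 ?_, ?_, ?_⟩
  · rintro _ ⟨i, rfl⟩
    exact hAW i
  · rw [finrank_span_eq_card hA, Fintype.card_fin]
  · intro x hx
    obtain ⟨y, rfl⟩ := (Submodule.mem_span_range_iff_exists_fun ℂ).1 hx
    exact (pull_eq_zero_iff _ _).1 hAF y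

end Position

/-! ### Zeros of a form on a line -/

section BinaryForms

variable {n : Type*}

theorem exists_polynomial_of_line (f : MvPolynomial n ℂ) (v x : n → ℂ) :
    ∃ p : Polynomial ℂ, ∀ t, p.eval t = eval (v + t • x) f := by
  refine ⟨aeval (fun i => Polynomial.C (v i) + Polynomial.C (x i) * Polynomial.X) f, fun t => ?_⟩
  have : (Polynomial.aeval t).comp
      (aeval (fun i => Polynomial.C (v i) + Polynomial.C (x i) * Polynomial.X)) =
      aeval (R := ℂ) (v + t • x) := by
    ext i
    simp only [AlgHom.comp_apply, aeval_X, map_add, map_mul, Polynomial.aeval_C,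
      Polynomial.aeval_X, Pi.add_apply, Pi.smul_apply, smul_eq_mul, Algebra.algebraMap_self,
      RingHom.id_apply, mul_comm]
  have := DFunLike.congr_fun this f
  rwa [AlgHom.comp_apply, Polynomial.coe_aeval_eq_eval, aeval_eq_eval] at this

/-- Exchanging the roles of `v` and `x` turns `a t ^ k` into `a s ^ (d - k)`, which vanishes at `s =
0`: the missing zeros lie at infinity. -/
theorem eval_eq_zero_of_monomial_on_line {f : MvPolynomial n ℂ} {d k : ℕ} (hf : f.IsHomogeneous d)
    (hk : k < d) {v x : n → ℂ} {a : ℂ} (h : ∀ t : ℂ, eval (v + t • x) f = a * t ^ k) :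
    eval x f = 0 := by
  obtain ⟨p, hp⟩ := exists_polynomial_of_line f x v
  have hpX : p = Polynomial.C a * Polynomial.X ^ (d - k) := by
    refine Polynomial.eq_of_infinite_eval_eq _ _
      ((Set.finite_singleton (0 : ℂ)).infinite_compl.mono ?_)
    intro s hs
    have hs : s ≠ 0 := hs
    rw [Set.mem_ofPred_eq, hp, Polynomial.eval_mul, Polynomial.eval_C, Polynomial.eval_X_pow,
      show x + s • v = s • (v + s⁻¹ • x) by rw [smul_add, smul_smul, mul_inv_cancel₀ hs, one_smul,
        add_comm], IsHomogeneous.eval_smul hf, h]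
    have : s ^ d = s ^ (d - k) * s ^ k := by rw [← pow_add]; congr 1; omega
    rw [this, inv_pow]
    field_simp
  have h0 := hp 0
  rw [zero_smul, add_zero, hpX] at h0
  rw [← h0]
  simp [(Nat.sub_pos_of_lt hk).ne']

/-- A form of positive degree vanishes somewhere on each line. -/
theorem exists_zero_on_line {f : MvPolynomial n ℂ} {d : ℕ} (hf : f.IsHomogeneous d)
    (hd : d ≠ 0) (v x : n → ℂ) : eval x f = 0 ∨ ∃ t : ℂ, eval (v + t • x) f = 0 := by
  obtain ⟨p, hp⟩ := exists_polynomial_of_line f v x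
  by_cases h : p.degree = 0
  · left
    rw [Polynomial.eq_C_of_degree_eq_zero h] at hp
    refine eval_eq_zero_of_monomial_on_line (k := 0) hf (Nat.pos_of_ne_zero hd) (v := v)
      (a := p.coeff 0) fun t => ?_
    rw [← hp t]
    simp
  · right
    obtain ⟨t, ht⟩ := IsAlgClosed.exists_root p h
    exact ⟨t, by rw [← hp t]; exact ht⟩

/-- A form with a zero of order exactly `k < d` on a line has another zero there. -/
theorem exists_other_zero_on_line {f : MvPolynomial n ℂ} {d k : ℕ} (hf : f.IsHomogeneous d)
    (hk : k < d) {v x : n → ℂ} (hv : f ∈ pointIdeal v ^ k) (hx : eval x (taylor v k f) ≠ 0) :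
    eval x f = 0 ∨ ∃ t : ℂ, t ≠ 0 ∧ eval (v + t • x) f = 0 := by
  rw [mem_pointIdeal_pow_iff] at hv
  let p : Polynomial ℂ :=
    ∑ j ∈ Finset.range (d + 1 - k), Polynomial.monomial j (eval x (taylor v (k + j) f))
  have hp : ∀ t, eval (v + t • x) f = t ^ k * p.eval t := by
    intro t
    rw [eval_add_eq_sum_taylor v (t • x) hf.totalDegree_le, Polynomial.eval_finsetSum,
      show d + 1 = k + (d + 1 - k) by omega, Finset.sum_range_add, Finset.sum_eq_zero, zero_add,
      Finset.mul_sum]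
    · refine Finset.sum_congr (by congr 1; omega) fun j _ => ?_
      rw [IsHomogeneous.eval_smul (isHomogeneous_taylor v _ f), Polynomial.eval_monomial, pow_add]
      ring
    · intro j hj
      rw [hv j (Finset.mem_range.1 hj), map_zero]
  have hp0 : p.eval 0 = eval x (taylor v k f) := by
    rw [Polynomial.eval_finsetSum, Finset.sum_eq_single 0]
    · simp
    · intro j _ hj
      simp [hj]
    · intro h
      exact absurd (Finset.mem_range.2 (by omega)) h
  by_cases h : p.degree = 0
  · left
    rw [Polynomial.eq_C_of_degree_eq_zero h] at hp
    refine eval_eq_zero_of_monomial_on_line hf hk (v := v) (a := p.coeff 0) fun t => ?_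
    rw [hp t, Polynomial.eval_C, mul_comm]
  · right
    obtain ⟨t, ht⟩ := IsAlgClosed.exists_root p h
    refine ⟨t, ?_, by rw [hp, show p.eval t = 0 from ht, mul_zero]⟩
    rintro rfl
    rw [Polynomial.IsRoot.def, hp0] at ht
    exact hx ht

end BinaryForms

/-! ### Two planes in a hyperplane section -/

section Planes

variable {F : Poly}

theorem eval_dirDeriv_eq_zero_of_sup {n : Type*} [Fintype n] {f : MvPolynomial n ℂ} {x u : n → ℂ}
    {W : Submodule ℂ (n → ℂ)} (hW : ∀ w ∈ W, eval x (dirDeriv w f) = 0)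
    (hu : eval x (dirDeriv u f) = 0) (htop : W ⊔ Submodule.span ℂ {u} = ⊤) (w : n → ℂ) :
    eval x (dirDeriv w f) = 0 := by
  refine eval_dirDeriv_eq_zero_of_mem_span (S := W ∪ {u}) ?_ ?_
  · rintro w (hw | rfl)
    exacts [hW w hw, hu]
  · rw [Submodule.span_union, Submodule.span_eq, htop]
    trivial

theorem eval_dirDeriv_eq_zero_of_mem_sup {n : Type*} [Fintype n] {f : MvPolynomial n ℂ}
    {x : n → ℂ} {E E' : Submodule ℂ (n → ℂ)} (hE : ∀ w ∈ E, eval x (dirDeriv w f) = 0)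
    (hE' : ∀ w ∈ E', eval x (dirDeriv w f) = 0) {w : n → ℂ} (hw : w ∈ E ⊔ E') :
    eval x (dirDeriv w f) = 0 := by
  refine eval_dirDeriv_eq_zero_of_mem_span (S := E ∪ E') ?_ ?_
  · rintro w (hw | hw)
    exacts [hE w hw, hE' w hw]
  · rwa [Submodule.span_union, Submodule.span_eq, Submodule.span_eq]

theorem exists_sup_span_eq_top {W : Submodule ℂ (Fin 5 → ℂ)} (hW : Module.finrank ℂ W = 4) :
    ∃ u, W ⊔ Submodule.span ℂ {u} = ⊤ := by
  obtain ⟨u, hu⟩ : ∃ u, u ∉ W := by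
    by_contra! hcon
    have : W = ⊤ := eq_top_iff.2 fun x _ => hcon x
    rw [this, finrank_top] at hW
    simp at hW
  refine ⟨u, Submodule.eq_top_of_finrank_eq (le_antisymm (Submodule.finrank_le _) ?_)⟩
  have hlt : W < W ⊔ Submodule.span ℂ {u} := by
    refine lt_of_le_of_ne le_sup_left fun heq => hu ?_
    rw [heq]
    exact Submodule.mem_sup_right (Submodule.mem_span_singleton_self u)
  have := Submodule.finrank_lt_finrank_of_lt hlt
  rw [Module.finrank_fin_fun]
  omega

/-- Two planes of a hyperplane section share two triple points. -/
theorem TripleData.exists_two_sing_of_planes (h : TripleData F) {W E E' : Submodule ℂ (Fin 5 → ℂ)}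
    (hW : Module.finrank ℂ W = 4) (hE : Module.finrank ℂ E = 3) (hE' : Module.finrank ℂ E' = 3)
    (hEW : E ≤ W) (hEW' : E' ≤ W) (hne : E ≠ E') (hF : ∀ x ∈ E, eval x F = 0)
    (hF' : ∀ x ∈ E', eval x F = 0) :
    ∃ v w, v ∈ E ⊓ E' ∧ w ∈ E ⊓ E' ∧ IsSing F v ∧ IsSing F w ∧ w ∉ Submodule.span ℂ {v} := by
  have hsup : E ⊔ E' = W := by
    refine Submodule.eq_of_le_of_finrank_le (sup_le hEW hEW') ?_
    have hlt : E < E ⊔ E' := by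
      refine lt_of_le_of_ne le_sup_left fun heq => hne ?_
      exact (Submodule.eq_of_le_of_finrank_eq (sup_eq_left.1 heq.symm) (by rw [hE, hE'])).symm
    have := Submodule.finrank_lt_finrank_of_lt hlt
    omega
  have hM : Module.finrank ℂ ↥(E ⊓ E') = 2 := by
    have := Submodule.finrank_sup_add_finrank_inf_eq E E'
    rw [hsup] at this
    omega
  obtain ⟨u, hu⟩ := exists_sup_span_eq_top hW
  let b := Module.finBasisOfFinrankEq ℂ _ hM
  let A : Fin 2 → Fin 5 → ℂ := fun i => b i
  have hA : LinearIndependent ℂ A :=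
    b.linearIndependent.map' (Submodule.subtype _) (Submodule.ker_subtype _)
  have hAM : ∀ i, A i ∈ E ⊓ E' := fun i => (b i).2
  -- Along the common line the differential of `F` is zero on both planes, hence on `W`. Only the
  -- direction `u` is left.
  have hgrad : ∀ x ∈ E ⊓ E', eval x (dirDeriv u F) = 0 → ∀ w, eval x (dirDeriv w F) = 0 := by
    intro x hx h0
    refine eval_dirDeriv_eq_zero_of_sup (fun w hw => ?_) h0 hu
    rw [← hsup] at hw
    exact eval_dirDeriv_eq_zero_of_mem_sup (fun w hw => eval_dirDeriv_of_vanishing hF hx.1 hw)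
      (fun w hw => eval_dirDeriv_of_vanishing hF' hx.2 hw) hw
  have hdeg := isHomogeneous_dirDeriv u h.hom
  obtain ⟨v, hv0, hvM, hv⟩ : ∃ v, v ≠ 0 ∧ v ∈ E ⊓ E' ∧ eval v (dirDeriv u F) = 0 := by
    obtain h1 | ⟨t, ht⟩ := exists_zero_on_line hdeg (by norm_num) (A 0) (A 1)
    · exact ⟨A 1, hA.ne_zero 1, hAM 1, h1⟩
    · refine ⟨A 0 + t • A 1, fun h0 => ?_, add_mem (hAM 0) (Submodule.smul_mem _ _ (hAM 1)), ht⟩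
      have := Fintype.linearIndependent_iff.1 hA ![1, t] (by simpa using h0) 0
      simp at this
  have hvs : IsSing F v := ⟨hv0, hgrad v hvM hv⟩
  obtain ⟨τ, hτM, hτ⟩ : ∃ τ ∈ E ⊓ E', τ ∉ Submodule.span ℂ {v} := by
    by_contra! hcon
    have := Submodule.finrank_mono (show E ⊓ E' ≤ Submodule.span ℂ {v} from hcon)
    rw [hM, finrank_span_singleton hv0] at this
    omega
  -- The tangent cone at `v` contains both planes. If also its `u`-derivative vanished at `τ`, then
  -- `τ` would be a singular point of the smooth cubic surface.
  have hτ2 : eval τ (taylor v 2 (dirDeriv u F)) ≠ 0 := by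
    intro h0
    rw [taylor_dirDeriv] at h0
    refine hτ (h.smooth v hvs τ (eval_dirDeriv_eq_zero_of_sup (fun w hw => ?_) h0 hu))
    rw [← hsup] at hw
    exact eval_dirDeriv_eq_zero_of_mem_sup
      (fun w hw => eval_dirDeriv_of_vanishing
        (fun y hy => eval_taylor_of_vanishing hF hvM.1 hy 3) hτM.1 hw)
      (fun w hw => eval_dirDeriv_of_vanishing
        (fun y hy => eval_taylor_of_vanishing hF' hvM.2 hy 3) hτM.2 hw) hw
  -- So the quartic has order exactly two at `v` and must have another zero on the line.
  obtain h1 | ⟨t, ht0, ht⟩ := exists_other_zero_on_line hdeg (k := 2) (by norm_num)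
    (dirDeriv_mem_pointIdeal_pow _ _ (h.ord v hvs)) hτ2
  · refine ⟨v, τ, hvM, hτM, hvs, ⟨?_, hgrad τ hτM h1⟩, hτ⟩
    rintro rfl
    exact hτ (zero_mem _)
  · have hm : v + t • τ ∉ Submodule.span ℂ {v} := by
      intro hm
      refine hτ ?_
      have h2 := (Submodule.add_mem_iff_right _ (Submodule.mem_span_singleton_self v)).1 hm
      exact (Submodule.smul_mem_iff _ ht0).1 h2
    have hmM : v + t • τ ∈ E ⊓ E' := add_mem hvM (Submodule.smul_mem _ _ hτM)
    refine ⟨v, v + t • τ, hvM, hmM, hvs, ⟨?_, hgrad _ hmM ht⟩, hm⟩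
    intro h0
    rw [h0] at hm
    exact hm (zero_mem _)

end Planes

/-! ### Counting triple points on planes and quadrics -/

section Sections

variable {F : Poly} {w : Fin 4 → Fin 5 → ℂ} {u : Fin 5 → ℂ}

theorem exists_coordinates (hw : LinearIndependent ℂ w) :
    ∃ ψ : (Fin 5 → ℂ) →ₗ[ℂ] (Fin 4 → ℂ), ∀ y : Fin 4 → ℂ, ψ (∑ i, y i • w i) = y := by
  obtain ⟨ψ, hψ⟩ := LinearMap.exists_leftInverse_of_injective (Fintype.linearCombination ℂ w)
    (LinearMap.ker_eq_bot.2 hw.fintypeLinearCombination_injective)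
  exact ⟨ψ, fun y => by
    have := LinearMap.congr_fun hψ y
    simpa [Fintype.linearCombination_apply] using this⟩

theorem exists_mem_notMem_span {V : Type*} [AddCommGroup V] [Module ℂ V] [FiniteDimensional ℂ V]
    {W : Submodule ℂ V} (s : Finset V) (hs : s.card < Module.finrank ℂ W) :
    ∃ x ∈ W, x ∉ Submodule.span ℂ (s : Set V) := by
  by_contra! hcon
  have h1 := Submodule.finrank_mono (show W ≤ Submodule.span ℂ (s : Set V) from hcon)
  have h2 := finrank_span_finset_le_card (R := ℂ) s
  rw [Set.finrank] at h2
  omega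

theorem sum_smul_ne_zero (hw : LinearIndependent ℂ w) {y : Fin 4 → ℂ} (hy : y ≠ 0) :
    ∑ i, y i • w i ≠ 0 := fun h0 => hy (funext (Fintype.linearIndependent_iff.1 hw y h0))

theorem eval_dirDeriv_eq_zero_of_frame {f : Poly} {x : Fin 5 → ℂ}
    (htop : Submodule.span ℂ (Set.range w) ⊔ Submodule.span ℂ {u} = ⊤)
    (hw : ∀ i, eval x (dirDeriv (w i) f) = 0) (hu : eval x (dirDeriv u f) = 0) (z : Fin 5 → ℂ) :
    eval x (dirDeriv z f) = 0 := by
  refine eval_dirDeriv_eq_zero_of_sup (fun z hz => ?_) hu htop z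
  refine eval_dirDeriv_eq_zero_of_mem_span ?_ hz
  rintro _ ⟨i, rfl⟩
  exact hw i

/-- Two surfaces in the hyperplane meet in infinitely many points, which would all be singular on
the quintic. -/
theorem TripleData.false_of_common_zeros (h : TripleData F) (hw : LinearIndependent ℂ w)
    {q c : MvPolynomial (Fin 4) ℂ} {d₁ d₂ : ℕ} (hqh : q.IsHomogeneous d₁)
    (hch : c.IsHomogeneous d₂) (hd₁ : d₁ ≠ 0) (hd₂ : d₂ ≠ 0) (hq : Prime q)
    (hs : ∀ y ≠ 0, eval y q = 0 → eval y c = 0 → IsSing F (∑ i, y i • w i)) : False := by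
  classical
  obtain ⟨ψ, hψ⟩ := exists_coordinates hw
  obtain ⟨s, hs'⟩ := h.fin
  obtain ⟨y, hy, hyq, hyc, hys⟩ := exists_common_zero_notMem hqh hch hd₁ hd₂ hq (s.image ψ)
  obtain ⟨v, hv, hm⟩ := hs' _ (hs y hy hyq hyc)
  obtain ⟨a, ha⟩ := Submodule.mem_span_singleton.1 hm
  have hya : a • ψ v = y := by rw [← map_smul, ha, hψ]
  refine hys (ψ v) (Finset.mem_image_of_mem _ hv) ?_ (Submodule.mem_span_singleton.2 ⟨a, hya⟩)
  intro h0
  rw [h0, smul_zero] at hya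
  exact hy hya.symm

theorem mul_le_four_mul_card_of_frame (hw : LinearIndependent ℂ w)
    {q c g : MvPolynomial (Fin 4) ℂ} {d₁ d₂ d₃ : ℕ}
    (hqh : q.IsHomogeneous d₁) (hch : c.IsHomogeneous d₂) (hgh : g.IsHomogeneous d₃)
    (hq : Prime q) (hqc : ¬ q ∣ c) (T : Finset (Fin 5 → ℂ))
    (hT : ∀ y ≠ 0, eval y q = 0 → eval y c = 0 → eval y g = 0 →
      ∃ x ∈ T, ∑ i, y i • w i ∈ Submodule.span ℂ {x})
    (hloc : ∀ x ∈ T, ∃ v : Fin 4 → ℂ, ∑ i, v i • w i = x ∧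
      MultiplicityLeFour (Ideal.span {q, c, g}) v) :
    d₁ * d₂ * d₃ ≤ 4 * T.card := by
  classical
  obtain ⟨ψ, hψ⟩ := exists_coordinates hw
  refine (mul_le_four_mul_card hqh hch hgh hq hqc (T.image ψ) ?_ ?_).trans
    (Nat.mul_le_mul_left 4 Finset.card_image_le)
  · intro y hy h1 h2 h3
    obtain ⟨x, hx, hm⟩ := hT y hy h1 h2 h3
    obtain ⟨a, ha⟩ := Submodule.mem_span_singleton.1 hm
    refine ⟨ψ x, Finset.mem_image_of_mem _ hx, Submodule.mem_span_singleton.2 ⟨a, ?_⟩⟩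
    rw [← map_smul, ha, hψ]
  · intro v hv
    obtain ⟨x, hx, rfl⟩ := Finset.mem_image.1 hv
    obtain ⟨v, rfl, hm⟩ := hloc x hx
    rwa [hψ]

/-- At a triple point, the multiplicity of the intersection of the derivative transversal to a
hyperplane with two suitable surfaces in this hyperplane is at most four. -/
theorem TripleData.multiplicityLeFour (h : TripleData F) (hw : LinearIndependent ℂ w)
    (htop : Submodule.span ℂ (Set.range w) ⊔ Submodule.span ℂ {u} = ⊤)
    {I : Ideal (MvPolynomial (Fin 4) ℂ)} (hI : ContainsComponents I)
    (hg : pull w (dirDeriv u F) ∈ I) {u₁ u₂ : MvPolynomial (Fin 4) ℂ} {d₁ d₂ : ℕ}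
    (hu₁ : u₁.IsHomogeneous d₁) (hu₂ : u₂.IsHomogeneous d₂) (hd₁ : 1 ≤ d₁) (hd₂ : 2 ≤ d₂)
    (hI₁ : u₁ ∈ I) (hI₂ : u₂ ∈ I) {v : Fin 4 → ℂ} (hv : IsSing F (∑ i, v i • w i))
    (ho₁ : u₁ ∈ pointIdeal v ^ 1) (ho₂ : u₂ ∈ pointIdeal v ^ 2) (hlin : taylor v 1 u₁ ≠ 0)
    (hz : ∀ z, eval z (taylor v 1 u₁) = 0 → eval z (taylor v 2 u₂) = 0 →
      ∀ i, eval z (pderiv i (taylor v 3 (pull w F))) = 0) : MultiplicityLeFour I v := by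
  have hv0 : v ≠ 0 := by
    rintro rfl
    exact hv.1 (by simp)
  refine multiplicityLeFour_of_taylor hI hv0 hu₁ hu₂
    (isHomogeneous_pull w (isHomogeneous_dirDeriv u h.hom)) hd₁ hd₂ (by norm_num) hI₁ hI₂ hg ho₁ ho₂
    (pull_mem_pointIdeal_pow _ _ (dirDeriv_mem_pointIdeal_pow _ _ (h.ord _ hv))) hlin ?_
  intro z h1 h2 h3
  obtain ⟨ψ, hψ⟩ := exists_coordinates hw
  have hm := h.smooth _ hv (∑ i, z i • w i) (eval_dirDeriv_eq_zero_of_frame htop (fun i => ?_) ?_)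
  · obtain ⟨a, ha⟩ := Submodule.mem_span_singleton.1 hm
    refine Submodule.mem_span_singleton.2 ⟨a, ?_⟩
    have := congr_arg ψ ha
    rwa [map_smul, hψ, hψ] at this
  · have := hz z h1 h2 i
    rwa [taylor_pull, pderiv_pull, eval_pull] at this
  · rwa [taylor_pull, taylor_dirDeriv, eval_pull] at h3

/-- A plane on the quintic contains four triple points. -/
theorem TripleData.four_le_card_of_plane (h : TripleData F) {E : Submodule ℂ (Fin 5 → ℂ)}
    (hE : Module.finrank ℂ E = 3) (hF : ∀ x ∈ E, eval x F = 0) (T : Finset (Fin 5 → ℂ))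
    (hT : ∀ x ∈ T, IsSing F x ∧ x ∈ E)
    (hT' : ∀ v, IsSing F v → v ∈ E → ∃ x ∈ T, v ∈ Submodule.span ℂ {x}) : 4 ≤ T.card := by
  let b := Module.finBasisOfFinrankEq ℂ _ hE
  let A : Fin 3 → Fin 5 → ℂ := fun i => b i
  have hA : LinearIndependent ℂ A :=
    b.linearIndependent.map' (Submodule.subtype _) (Submodule.ker_subtype _)
  obtain ⟨e, -, hw⟩ := exists_linearIndependent_snoc hA (W := ⊤) (by
    rw [finrank_top, Module.finrank_fin_fun]
    norm_num)
  set w : Fin 4 → Fin 5 → ℂ := Fin.snoc A e with hwdef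
  have hw3 : w 3 = e := Fin.snoc_last (n := 3) (α := fun _ => Fin 5 → ℂ) _ _
  have hwA : ∀ i : Fin 3, w i.castSucc = A i := fun i => by rw [hwdef, Fin.snoc_castSucc]
  obtain ⟨u, hu⟩ := exists_sup_span_eq_top (W := Submodule.span ℂ (Set.range w)) (by
    rw [finrank_span_eq_card hw, Fintype.card_fin])
  have hmem : ∀ y : Fin 4 → ℂ, y 3 = 0 → ∑ i, y i • w i ∈ E := by
    intro y hy
    rw [Fin.sum_univ_castSucc, show y (Fin.last 3) = 0 from hy, zero_smul, add_zero]
    refine Submodule.sum_mem _ fun i _ => Submodule.smul_mem _ _ ?_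
    rw [hwA]
    exact (b i).2
  have hcoord : ∀ x ∈ E, ∃ y : Fin 4 → ℂ, y 3 = 0 ∧ ∑ i, y i • w i = x := by
    intro x hx
    refine ⟨Fin.snoc (b.repr ⟨x, hx⟩) 0, Fin.snoc_last (n := 3) (α := fun _ => ℂ) _ _, ?_⟩
    rw [Fin.sum_univ_castSucc, Fin.snoc_last, zero_smul, add_zero]
    simp only [Fin.snoc_castSucc, hwA]
    have := congr_arg E.subtype (b.sum_repr ⟨x, hx⟩)
    rw [map_sum] at this
    simpa only [map_smul, Submodule.subtype_apply] using this
  set q : MvPolynomial (Fin 4) ℂ := X 3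
  set c := pull w (dirDeriv e F)
  set g := pull w (dirDeriv u F)
  have hqh : q.IsHomogeneous 1 := isHomogeneous_X _ _
  have hch : c.IsHomogeneous 4 := isHomogeneous_pull _ (isHomogeneous_dirDeriv e h.hom)
  have hgh : g.IsHomogeneous 4 := isHomogeneous_pull _ (isHomogeneous_dirDeriv u h.hom)
  have hq : Prime q := MvPolynomial.X_prime
  -- A form vanishing on `E` has zero derivatives along `E`, so within the hyperplane only the
  -- direction `e` matters. This is needed both for `F` and for its tangent cones.
  have hgrad : ∀ {f : Poly}, (∀ x ∈ E, eval x f = 0) → ∀ y : Fin 4 → ℂ, eval y q = 0 →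
      eval y (pull w (dirDeriv e f)) = 0 → ∀ i, eval (∑ i, y i • w i) (dirDeriv (w i) f) = 0 := by
    intro f hf y hyq hyc i
    have hy := hmem y (by simpa [q] using hyq)
    refine Fin.lastCases ?_ (fun j => ?_) i
    · rw [eval_pull] at hyc
      rw [← hyc]
      exact congr_arg (fun z => eval (∑ i, y i • w i) (dirDeriv z f)) hw3
    · rw [hwA]
      exact eval_dirDeriv_of_vanishing hf hy (b j).2
  have hsing : ∀ y ≠ 0, eval y q = 0 → eval y c = 0 → eval y g = 0 →
      IsSing F (∑ i, y i • w i) := fun y hy hyq hyc hyg =>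
    ⟨sum_smul_ne_zero hw hy, eval_dirDeriv_eq_zero_of_frame hu (hgrad hF y hyq hyc)
      (by rwa [eval_pull] at hyg)⟩
  have hqc : ¬ q ∣ c := by
    rintro ⟨r, hr⟩
    refine h.false_of_common_zeros hw hqh hgh one_ne_zero (by norm_num) hq fun y hy hyq hyg => ?_
    refine hsing y hy hyq ?_ hyg
    rw [hr, map_mul, hyq, zero_mul]
  have := mul_le_four_mul_card_of_frame hw hqh hch hgh hq hqc T
    (fun y hy hyq hyc hyg => hT' _ (hsing y hy hyq hyc hyg) (hmem y (by simpa [q] using hyq)))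
    (fun x hx => ?_)
  · omega
  · obtain ⟨hxs, hxE⟩ := hT x hx
    obtain ⟨v, hv3, rfl⟩ := hcoord x hxE
    -- The last coordinate vanishes at `v`, so this linear form is its own expansion.
    have hq1 : taylor v 1 q = q := by
      simp only [taylor, translate, q, aeval_X, map_add, hv3]
      rw [homogeneousComponent_of_mem (isHomogeneous_X _ _)]
      simp
    refine ⟨v, rfl, h.multiplicityLeFour hw hu (containsComponents_span_triple hqh hch hgh)
      (Ideal.subset_span (Or.inr (Or.inr rfl))) hqh hch le_rfl (by norm_num) (Ideal.subset_span (by simp))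
      (Ideal.subset_span (by simp)) hxs ?_
      (pull_mem_pointIdeal_pow _ _ (dirDeriv_mem_pointIdeal_pow _ _ (h.ord _ hxs)))
      (by rw [hq1]; exact hq.ne_zero) ?_⟩
    · rw [pow_one, mem_pointIdeal_iff]
      simpa [q] using hv3
    · intro z hz1 hz2 i
      rw [taylor_pull, pderiv_pull, eval_pull]
      rw [hq1] at hz1
      rw [taylor_pull, taylor_dirDeriv] at hz2
      exact hgrad (fun y hy => eval_taylor_of_vanishing hF hxE hy 3) z hz1 hz2 i

/-- Along a double component all derivatives inside the hyperplane vanish, and the one remaining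
derivative cuts out a curve of singular points. -/
theorem TripleData.not_sq_dvd (h : TripleData F) (hw : LinearIndependent ℂ w)
    {q : MvPolynomial (Fin 4) ℂ} {d : ℕ} (hqh : q.IsHomogeneous d) (hd : d ≠ 0) (hq : Prime q) :
    ¬ q * q ∣ pull w F := by
  rintro ⟨c, hc⟩
  obtain ⟨u, hu⟩ := exists_sup_span_eq_top (W := Submodule.span ℂ (Set.range w)) (by
    rw [finrank_span_eq_card hw, Fintype.card_fin])
  refine h.false_of_common_zeros hw hqh (isHomogeneous_pull w (isHomogeneous_dirDeriv u h.hom)) hd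
    (by norm_num) hq fun y hy hyq hyg => ⟨sum_smul_ne_zero hw hy, ?_⟩
  refine eval_dirDeriv_eq_zero_of_frame hu (fun i => ?_) (by rwa [eval_pull] at hyg)
  rw [← eval_pull, ← pderiv_pull, hc]
  simp [hyq]

/-- A quadric surface on the quintic contains six triple points. -/
theorem TripleData.six_le_card_of_quadric (h : TripleData F) (hw : LinearIndependent ℂ w)
    {q : MvPolynomial (Fin 4) ℂ} (hqh : q.IsHomogeneous 2) (hq : Prime q) (hqF : q ∣ pull w F)
    (T : Finset (Fin 5 → ℂ))
    (hT : ∀ x ∈ T, IsSing F x ∧ ∃ v, eval v q = 0 ∧ ∑ i, v i • w i = x)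
    (hT' : ∀ v, IsSing F (∑ i, v i • w i) → eval v q = 0 →
      ∃ x ∈ T, ∑ i, v i • w i ∈ Submodule.span ℂ {x}) : 6 ≤ T.card := by
  obtain ⟨u, hu⟩ := exists_sup_span_eq_top (W := Submodule.span ℂ (Set.range w)) (by
    rw [finrank_span_eq_card hw, Fintype.card_fin])
  obtain ⟨c, hc⟩ := hqF
  have hf0 : pull w F ≠ 0 := by
    intro h0
    exact h.not_sq_dvd hw hqh two_ne_zero hq (by rw [h0]; exact dvd_zero _)
  have hch : c.IsHomogeneous 3 := by
    obtain ⟨a, b, hab, ha, hb⟩ := exists_isHomogeneous_of_mul (isHomogeneous_pull w h.hom) hf0 hc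
    have := ha.inj_right hqh hq.ne_zero
    rwa [show b = 3 by omega] at hb
  have hqc : ¬ q ∣ c := by
    rintro ⟨r, rfl⟩
    exact h.not_sq_dvd hw hqh two_ne_zero hq ⟨r, by rw [hc, mul_assoc]⟩
  set g := pull w (dirDeriv u F) with hgdef
  have hgh : g.IsHomogeneous 4 := isHomogeneous_pull _ (isHomogeneous_dirDeriv u h.hom)
  have hsing : ∀ y ≠ 0, eval y q = 0 → eval y c = 0 → eval y g = 0 →
      IsSing F (∑ i, y i • w i) := fun y hy hyq hyc hyg => by
    refine ⟨sum_smul_ne_zero hw hy, eval_dirDeriv_eq_zero_of_frame hu (fun i => ?_)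
      (by rwa [eval_pull] at hyg)⟩
    rw [← eval_pull, ← pderiv_pull, hc]
    simp [hyq, hyc]
  have := mul_le_four_mul_card_of_frame hw hqh hch hgh hq hqc T
    (fun y hy hyq hyc hyg => hT' _ (hsing y hy hyq hyc hyg) hyq) (fun x hx => ?_)
  · omega
  obtain ⟨hxs, v, hvq, rfl⟩ := hT x hx
  refine ⟨v, rfl, ?_⟩
  have hI := containsComponents_span_triple hqh hch hgh
  have hord : q * c ∈ pointIdeal v ^ 3 := by
    rw [← hc]
    exact pull_mem_pointIdeal_pow _ _ (h.ord _ hxs)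
  have hord' := (mem_pointIdeal_pow_iff _ _ _).1 hord
  have hq1 : q ∈ pointIdeal v ^ 1 := by rwa [pow_one, mem_pointIdeal_iff]
  have hc0 : c ∈ pointIdeal v ^ 0 := by simp
  have succ : ∀ {r : MvPolynomial (Fin 4) ℂ} {k : ℕ}, r ∈ pointIdeal v ^ k → taylor v k r = 0 →
      r ∈ pointIdeal v ^ (k + 1) := by
    intro r k hr h0
    rw [mem_pointIdeal_pow_iff] at hr ⊢
    intro j hj
    rcases Nat.lt_succ_iff_lt_or_eq.1 hj with hj | rfl
    exacts [hr j hj, h0]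
  -- The tangent cone restricts to the product of the leading forms of `q` and `c`. One of them is
  -- linear and the other quadratic, depending on whether `v` is a vertex of the quadric.
  by_cases hT1 : taylor v 1 q = 0
  · have hq2 := succ hq1 hT1
    have hT2 : taylor v 2 q ≠ 0 := by
      intro h2
      have h3 := (mem_pointIdeal_pow_iff _ _ _).1 (succ hq2 h2)
      refine hq.ne_zero (MvPolynomial.funext fun y => ?_)
      have := eval_add_eq_sum_taylor v (y - v) hqh.totalDegree_le
      rw [add_sub_cancel, Finset.sum_eq_zero fun k hk => by
        rw [h3 k (Finset.mem_range.1 hk), map_zero]] at this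
      rw [this, map_zero]
    have hc1 : c ∈ pointIdeal v ^ 1 := by
      refine succ hc0 ((mul_eq_zero.1 ?_).resolve_left hT2)
      rw [← taylor_mul hq2 hc0]
      exact hord' 2 (by norm_num)
    have hf3 : taylor v 3 (pull w F) = taylor v 2 q * taylor v 1 c := by
      rw [hc, ← taylor_mul hq2 hc1]
    refine h.multiplicityLeFour hw hu hI (Ideal.subset_span (Or.inr (Or.inr rfl))) hch hqh (by norm_num) le_rfl
      (Ideal.subset_span (by simp)) (Ideal.subset_span (by simp)) hxs hc1 hq2 ?_ ?_
    -- If `c` had no linear term, the tangent cone would vanish on `W`. A zero in `W` of its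
    -- `u`-derivative, outside the line of `x`, would then be a singular point of the cubic surface.
    · intro hcl
      rw [hcl, mul_zero] at hf3
      classical
      set x := ∑ i, v i • w i
      have hWfin : Module.finrank ℂ (Submodule.span ℂ (Set.range w)) = 4 := by
        rw [finrank_span_eq_card hw, Fintype.card_fin]
      obtain ⟨a, haW, ha⟩ := exists_mem_notMem_span (W := Submodule.span ℂ (Set.range w)) {x} (by
        simp [hWfin])
      obtain ⟨b, hbW, hb⟩ := exists_mem_notMem_span (W := Submodule.span ℂ (Set.range w)) {x, a} (by
        have := Finset.card_le_two (a := x) (b := a)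
        omega)
      rw [Finset.coe_singleton] at ha
      rw [Finset.coe_pair] at hb
      have hle : Submodule.span ℂ {x} ≤ Submodule.span ℂ {x, a} := Submodule.span_mono (by simp)
      obtain ⟨τ, hτW, hτx, hτ⟩ : ∃ τ ∈ Submodule.span ℂ (Set.range w),
          τ ∉ Submodule.span ℂ {x} ∧ eval τ (dirDeriv u (taylor x 3 F)) = 0 := by
        obtain h1 | ⟨t, ht⟩ := exists_zero_on_line
          (isHomogeneous_dirDeriv u (isHomogeneous_taylor x 3 F)) two_ne_zero a b
        · exact ⟨b, hbW, fun hm => hb (hle hm), h1⟩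
        · refine ⟨a + t • b, add_mem haW (Submodule.smul_mem _ _ hbW), fun hm => ?_, ht⟩
          by_cases ht0 : t = 0
          · rw [ht0, zero_smul, add_zero] at hm
            exact ha hm
          · refine hb ((Submodule.smul_mem_iff _ ht0).1
              ((Submodule.add_mem_iff_right _ ?_).1 (hle hm)))
            exact Submodule.subset_span (by simp)
      obtain ⟨z, rfl⟩ := (Submodule.mem_span_range_iff_exists_fun ℂ).1 hτW
      refine hτx (h.smooth x hxs _ (eval_dirDeriv_eq_zero_of_frame hu (fun i => ?_) hτ))
      rw [← eval_pull, ← pderiv_pull, ← taylor_pull, hf3, map_zero, map_zero]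
    · intro z hz1 hz2 i
      rw [hf3]
      simp [hz1, hz2]
  -- At a smooth point of the quadric, order three of the product forces order two of `c`.
  · have hc1 : c ∈ pointIdeal v ^ 1 := by
      refine succ hc0 ((mul_eq_zero.1 ?_).resolve_left hT1)
      rw [← taylor_mul hq1 hc0]
      exact hord' 1 (by norm_num)
    have hc2 : c ∈ pointIdeal v ^ 2 := by
      refine succ hc1 ((mul_eq_zero.1 ?_).resolve_left hT1)
      rw [← taylor_mul hq1 hc1]
      exact hord' 2 (by norm_num)
    refine h.multiplicityLeFour hw hu hI (Ideal.subset_span (Or.inr (Or.inr rfl))) hqh hch (by norm_num)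
      (by norm_num) (Ideal.subset_span (by simp)) (Ideal.subset_span (by simp)) hxs hq1 hc2 hT1 ?_
    intro z hz1 hz2 i
    rw [hc, show 3 = 1 + 2 from rfl, taylor_mul hq1 hc2]
    simp [hz1, hz2]

end Sections

/-! ### Configurations of triple points and planes -/

section Counting

variable {F : Poly}

theorem exists_injective_mem {α : Type*} {k : ℕ} {T : Finset α} (hk : k ≤ T.card) :
    ∃ v : Fin k → α, Function.Injective v ∧ ∀ i, v i ∈ T :=
  ⟨fun i => T.equivFin.symm (Fin.castLE hk i),
    Subtype.val_injective.comp (T.equivFin.symm.injective.comp (Fin.castLE_injective hk)),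
    fun i => (T.equivFin.symm (Fin.castLE hk i)).2⟩

theorem rep_notMem_span {P Q : P4} (h : P ≠ Q) : P.rep ∉ Submodule.span ℂ {Q.rep} := by
  intro hm
  obtain ⟨a, ha⟩ := Submodule.mem_span_singleton.1 hm
  refine h ?_
  rw [← P.mk_rep, ← Q.mk_rep, Projectivization.mk_eq_mk_iff']
  exact ⟨a, ha⟩

theorem isSingFamily_rep {k : ℕ} {v : Fin k → P4} (hv : Function.Injective v)
    (hs : ∀ i, IsSing F (v i).rep) : IsSingFamily F fun i => (v i).rep :=
  ⟨hs, fun _ _ hij => rep_notMem_span (hv.ne hij)⟩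

open Classical in
/-- The points of a finite set that lie on a linear subspace. -/
noncomputable def pointsOn (S : Finset P4) (W : Submodule ℂ (Fin 5 → ℂ)) : Finset P4 :=
  S.filter fun P => P.rep ∈ W

theorem mem_pointsOn {S : Finset P4} {W : Submodule ℂ (Fin 5 → ℂ)} {P : P4} :
    P ∈ pointsOn S W ↔ P ∈ S ∧ P.rep ∈ W := by
  classical
  exact Finset.mem_filter

theorem pointsOn_mono (S : Finset P4) {W W' : Submodule ℂ (Fin 5 → ℂ)} (h : W ≤ W') :
    pointsOn S W ⊆ pointsOn S W' := fun P hP => by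
  rw [mem_pointsOn] at hP ⊢
  exact ⟨hP.1, h hP.2⟩

theorem pointsOn_inf [DecidableEq P4] (S : Finset P4) (W W' : Submodule ℂ (Fin 5 → ℂ)) :
    pointsOn S (W ⊓ W') = pointsOn S W ∩ pointsOn S W' := by
  ext P
  simp only [mem_pointsOn, Finset.mem_inter, Submodule.mem_inf]
  tauto

variable {S : Finset P4} {W E E' : Submodule ℂ (Fin 5 → ℂ)}

theorem exists_mem_of_isSing (hS : ∀ P, P ∈ S ↔ IsSing F P.rep) (h : TripleData F)
    {v : Fin 5 → ℂ} (hv : IsSing F v) :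
    ∃ P ∈ S, P.rep ∈ Submodule.span ℂ {v} ∧ v ∈ Submodule.span ℂ {P.rep} := by
  obtain ⟨a, ha⟩ := Projectivization.exists_smul_eq_mk_rep ℂ v hv.1
  have ha' : (a : ℂ) • v = (Projectivization.mk ℂ v hv.1).rep := ha
  have h1 : (Projectivization.mk ℂ v hv.1).rep ∈ Submodule.span ℂ {v} :=
    Submodule.mem_span_singleton.2 ⟨a, ha'⟩
  refine ⟨Projectivization.mk ℂ v hv.1, (hS _).2 ?_, h1,
    mem_span_singleton_symm (Projectivization.rep_nonzero _) h1⟩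
  rw [← ha']
  exact h.isSing_smul hv a.ne_zero

theorem TripleData.card_pointsOn_line_le (h : TripleData F) (hS : ∀ P, P ∈ S ↔ IsSing F P.rep)
    (hW : Module.finrank ℂ W ≤ 2) : (pointsOn S W).card ≤ 2 := by
  by_contra! hcon
  obtain ⟨v, hv, hvm⟩ := exists_injective_mem (show 3 ≤ _ from hcon)
  have hfam := isSingFamily_rep (F := F) hv fun i => (hS _).1 (mem_pointsOn.1 (hvm i)).1
  have hli := h.linearIndependent hfam.sing hfam.ne
  have := Submodule.finrank_mono (show Submodule.span ℂ (Set.range fun i => (v i).rep) ≤ W from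
    Submodule.span_le.2 (by
      rintro _ ⟨i, rfl⟩
      exact (mem_pointsOn.1 (hvm i)).2))
  rw [finrank_span_eq_card hli, Fintype.card_fin] at this
  omega

theorem TripleData.card_pointsOn_plane_le (h : TripleData F) (hS : ∀ P, P ∈ S ↔ IsSing F P.rep)
    (hE : Module.finrank ℂ E = 3) : (pointsOn S E).card ≤ 4 := by
  by_contra! hcon
  obtain ⟨v, hv, hvm⟩ := exists_injective_mem (show 5 ≤ _ from hcon)
  exact h.not_five_coplanar
    (isSingFamily_rep (F := F) hv fun i => (hS _).1 (mem_pointsOn.1 (hvm i)).1) hE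
    fun i => (mem_pointsOn.1 (hvm i)).2

theorem TripleData.vanishing_of_four_le_card (h : TripleData F)
    (hS : ∀ P, P ∈ S ↔ IsSing F P.rep) (hE : Module.finrank ℂ E = 3)
    (h4 : 4 ≤ (pointsOn S E).card) : ∀ x ∈ E, eval x F = 0 := by
  obtain ⟨v, hv, hvm⟩ := exists_injective_mem h4
  have hfam := isSingFamily_rep (F := F) hv fun i => (hS _).1 (mem_pointsOn.1 (hvm i)).1
  have hle : Submodule.span ℂ (Set.range fun i => (v i).rep) ≤ E := Submodule.span_le.2 (by
    rintro _ ⟨i, rfl⟩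
    exact (mem_pointsOn.1 (hvm i)).2)
  obtain ⟨A, hA, hAE, -, hAF⟩ := h.vanishing_of_four_coplanar hfam (by
    intro hli
    have := Submodule.finrank_mono hle
    rw [finrank_span_eq_card hli, Fintype.card_fin] at this
    omega)
  intro x hx
  obtain ⟨p, rfl⟩ := exists_sum_smul_eq hA (fun i => hle (hAE i)) hE hx
  exact (pull_eq_zero_iff _ _).1 hAF p

theorem TripleData.card_pointsOn_eq_four (h : TripleData F) (hS : ∀ P, P ∈ S ↔ IsSing F P.rep)
    (hE : Module.finrank ℂ E = 3) (hF : ∀ x ∈ E, eval x F = 0) : (pointsOn S E).card = 4 := by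
  classical
  refine le_antisymm (h.card_pointsOn_plane_le hS hE) ?_
  refine (h.four_le_card_of_plane hE hF ((pointsOn S E).image Projectivization.rep) ?_ ?_).trans
    Finset.card_image_le
  · intro x hx
    obtain ⟨P, hP, rfl⟩ := Finset.mem_image.1 hx
    rw [mem_pointsOn, hS] at hP
    exact hP
  · intro v hv hvE
    obtain ⟨P, hP, hPv, hvP⟩ := exists_mem_of_isSing hS h hv
    refine ⟨P.rep, Finset.mem_image_of_mem _ (mem_pointsOn.2 ⟨hP, ?_⟩), hvP⟩
    exact (Submodule.span_singleton_le_iff_mem _ _).2 hvE hPv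

theorem TripleData.two_le_card_of_planes (h : TripleData F) (hS : ∀ P, P ∈ S ↔ IsSing F P.rep)
    (hW : Module.finrank ℂ W = 4) (hE : Module.finrank ℂ E = 3) (hE' : Module.finrank ℂ E' = 3)
    (hEW : E ≤ W) (hEW' : E' ≤ W) (hne : E ≠ E') (hF : ∀ x ∈ E, eval x F = 0)
    (hF' : ∀ x ∈ E', eval x F = 0) : 2 ≤ (pointsOn S (E ⊓ E')).card := by
  obtain ⟨v, w, hv, hw, hvs, hws, hvw⟩ :=
    h.exists_two_sing_of_planes hW hE hE' hEW hEW' hne hF hF'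
  obtain ⟨P, hP, hPv, hvP⟩ := exists_mem_of_isSing hS h hvs
  obtain ⟨Q, hQ, hQw, hwQ⟩ := exists_mem_of_isSing hS h hws
  refine Finset.one_lt_card.2 ⟨P, mem_pointsOn.2 ⟨hP, ?_⟩, Q, mem_pointsOn.2 ⟨hQ, ?_⟩, ?_⟩
  · exact (Submodule.span_singleton_le_iff_mem _ _).2 hv hPv
  · exact (Submodule.span_singleton_le_iff_mem _ _).2 hw hQw
  · rintro rfl
    exact hvw ((Submodule.span_singleton_le_iff_mem _ _).2 hPv hwQ)

theorem finrank_inf_le_two (hE : Module.finrank ℂ E = 3) (hE' : Module.finrank ℂ E' = 3)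
    (hne : E ≠ E') : Module.finrank ℂ ↥(E ⊓ E') ≤ 2 := by
  have hlt : E ⊓ E' < E := by
    refine lt_of_le_of_ne inf_le_left fun heq => hne ?_
    exact Submodule.eq_of_le_of_finrank_eq (inf_eq_left.1 heq) (by rw [hE, hE'])
  have := Submodule.finrank_lt_finrank_of_lt hlt
  omega

theorem TripleData.card_pointsOn_inf (h : TripleData F) (hS : ∀ P, P ∈ S ↔ IsSing F P.rep)
    (hW : Module.finrank ℂ W = 4) (hE : Module.finrank ℂ E = 3) (hE' : Module.finrank ℂ E' = 3)
    (hEW : E ≤ W) (hEW' : E' ≤ W) (hne : E ≠ E') (hF : ∀ x ∈ E, eval x F = 0)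
    (hF' : ∀ x ∈ E', eval x F = 0) : (pointsOn S (E ⊓ E')).card = 2 :=
  le_antisymm (h.card_pointsOn_line_le hS (finrank_inf_le_two hE hE' hne))
    (h.two_le_card_of_planes hS hW hE hE' hEW hEW' hne hF hF')

theorem TripleData.exists_plane_of_six_le_card (h : TripleData F)
    (hS : ∀ P, P ∈ S ↔ IsSing F P.rep) (hW : Module.finrank ℂ W = 4)
    (h6 : 6 ≤ (pointsOn S W).card) :
    ∃ E ≤ W, Module.finrank ℂ E = 3 ∧ ∀ x ∈ E, eval x F = 0 := by
  obtain ⟨v, hv, hvm⟩ := exists_injective_mem h6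
  exact h.exists_plane_of_six
    (isSingFamily_rep (F := F) hv fun i => (hS _).1 (mem_pointsOn.1 (hvm i)).1) hW
    fun i => (mem_pointsOn.1 (hvm i)).2

/-- A hyperplane contains at most six triple points. -/
theorem TripleData.card_pointsOn_hyperplane_le (h : TripleData F)
    (hS : ∀ P, P ∈ S ↔ IsSing F P.rep) (hW : Module.finrank ℂ W = 4) :
    (pointsOn S W).card ≤ 6 := by
  classical
  by_contra! hcon
  obtain ⟨E, hEW, hE, hF⟩ := h.exists_plane_of_six_le_card hS hW hcon.le
  have h1 := Finset.card_sdiff_add_card_eq_card (pointsOn_mono S hEW)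
  have h2 := h.card_pointsOn_plane_le hS hE
  -- At most four of the seven points lie on `E`; three others span a second plane `E'`.
  obtain ⟨v, hv, hvm⟩ := exists_injective_mem (k := 3) (T := pointsOn S W \ pointsOn S E) (by omega)
  have hvS : ∀ i, v i ∈ S ∧ (v i).rep ∈ W ∧ (v i).rep ∉ E := fun i => by
    have := hvm i
    rw [Finset.mem_sdiff, mem_pointsOn, mem_pointsOn] at this
    tauto
  set A : Fin 3 → Fin 5 → ℂ := fun i => (v i).rep with hAdef
  have hfam : IsSingFamily F A := isSingFamily_rep hv fun i => (hS _).1 (hvS i).1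
  have hli := h.linearIndependent hfam.sing hfam.ne
  set E' := Submodule.span ℂ (Set.range A)
  have hAE' : ∀ i, A i ∈ E' := fun i => Submodule.subset_span ⟨i, rfl⟩
  have hE' : Module.finrank ℂ E' = 3 := by rw [finrank_span_eq_card hli, Fintype.card_fin]
  have hEW' : E' ≤ W := Submodule.span_le.2 (by
    rintro _ ⟨i, rfl⟩
    exact (hvS i).2.1)
  have hne : E ≠ E' := fun heq => (hvS 0).2.2 (heq ▸ hAE' 0)
  -- This functional cuts out `E` in `W`, so it is nonzero at each of the three points: the line `E
  -- ⊓ E'` misses them.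
  obtain ⟨ℓ, hℓ0, hℓE⟩ := Submodule.exists_le_ker_of_notMem (hvS 0).2.2
  have hker : LinearMap.ker ℓ ⊓ W = E := by
    symm
    refine Submodule.eq_of_le_of_finrank_le (le_inf hℓE hEW) ?_
    have hlt : LinearMap.ker ℓ ⊓ W < W := by
      refine lt_of_le_of_ne inf_le_right fun heq => hℓ0 ?_
      exact (heq.symm ▸ (hvS 0).2.1 : (v 0).rep ∈ LinearMap.ker ℓ ⊓ W).1
    have := Submodule.finrank_lt_finrank_of_lt hlt
    omega
  have hF' : ∀ x ∈ E', eval x F = 0 := by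
    have h0 : pull A F = 0 := by
      refine h.pull_eq_zero_of_line hfam.sing (a := fun i => ℓ (A i)) (fun i h0 => ?_) fun y hy => ?_
      · refine (hvS i).2.2 ?_
        rw [← hker]
        exact ⟨h0, (hvS i).2.1⟩
      · refine hF _ ?_
        rw [← hker]
        refine ⟨?_, Submodule.sum_mem _ fun i _ => Submodule.smul_mem _ _ (hEW' (hAE' i))⟩
        rw [SetLike.mem_coe, LinearMap.mem_ker, map_sum, ← hy]
        simp [mul_comm]
    intro x hx
    obtain ⟨p, rfl⟩ := (Submodule.mem_span_range_iff_exists_fun ℂ).1 hx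
    exact (pull_eq_zero_iff _ _).1 h0 p
  -- The second plane also lies on the quintic. It contains the three points and two more on the
  -- common line, one too many.
  have h3 := h.two_le_card_of_planes hS hW hE hE' hEW hEW' hne hF hF'
  have h4 := h.card_pointsOn_plane_le hS hE'
  have h5 : Disjoint (pointsOn S (E ⊓ E')) (Finset.univ.image v) := by
    rw [Finset.disjoint_left]
    intro P hP hP'
    obtain ⟨i, -, rfl⟩ := Finset.mem_image.1 hP'
    exact (hvS i).2.2 (mem_pointsOn.1 hP).2.1
  have h6 : pointsOn S (E ⊓ E') ∪ Finset.univ.image v ⊆ pointsOn S E' := by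
    refine Finset.union_subset (pointsOn_mono S inf_le_right) fun P hP => ?_
    obtain ⟨i, -, rfl⟩ := Finset.mem_image.1 hP
    exact mem_pointsOn.2 ⟨(hvS i).1, hAE' i⟩
  have h7 := Finset.card_le_card h6
  rw [Finset.card_union_of_disjoint h5, Finset.card_image_of_injective _ hv, Finset.card_univ,
    Fintype.card_fin] at h7
  omega

/-- The complements would be disjoint pairs in a set of six elements, of which there are at most
three. Concretely, `T 2` and `T 3` both equal the complement of `T 0 ∩ T 1`. -/
theorem false_of_four_subsets {α : Type*} [DecidableEq α] {A : Finset α} (hA : A.card ≤ 6)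
    {T : Fin 4 → Finset α} (hT : ∀ i, (T i).card = 4) (hTA : ∀ i, T i ⊆ A)
    (h2 : ∀ i j, i ≠ j → (T i ∩ T j).card = 2) : False := by
  have h01 := Finset.card_union_add_card_inter (T 0) (T 1)
  rw [hT, hT, h2 0 1 (by decide)] at h01
  have hunion : T 0 ∪ T 1 = A :=
    Finset.eq_of_subset_of_card_le (Finset.union_subset (hTA 0) (hTA 1)) (by omega)
  have key : ∀ i, i ≠ 0 → i ≠ 1 → T i = A \ (T 0 ∩ T 1) := by
    intro i h0 h1
    have e1 := Finset.card_union_add_card_inter (T i ∩ T 0) (T i ∩ T 1)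
    rw [h2 i 0 h0, h2 i 1 h1, ← Finset.inter_union_distrib_left, hunion,
      Finset.inter_eq_left.2 (hTA i), hT] at e1
    have e2 : T i ∩ T 0 ∩ (T i ∩ T 1) = ∅ := Finset.card_eq_zero.1 (by omega)
    refine Finset.eq_of_subset_of_card_le (fun x hx => ?_) ?_
    · refine Finset.mem_sdiff.2 ⟨hTA i hx, fun hx' => ?_⟩
      have : x ∈ T i ∩ T 0 ∩ (T i ∩ T 1) := by
        simp only [Finset.mem_inter] at hx' ⊢
        tauto
      rw [e2] at this
      simp at this
    · have e3 := Finset.card_sdiff_add_card_eq_card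
        (show T 0 ∩ T 1 ⊆ A from Finset.inter_subset_left.trans (hTA 0))
      rw [h2 0 1 (by decide)] at e3
      rw [hT]
      omega
  have h23 := h2 2 3 (by decide)
  rw [key 2 (by decide) (by decide), key 3 (by decide) (by decide), Finset.inter_self,
    ← key 2 (by decide) (by decide), hT] at h23
  omega

/-- A hyperplane section does not contain four planes. -/
theorem TripleData.false_of_four_planes (h : TripleData F) (hS : ∀ P, P ∈ S ↔ IsSing F P.rep)
    (hW : Module.finrank ℂ W = 4) {E : Fin 4 → Submodule ℂ (Fin 5 → ℂ)}
    (hE : ∀ i, Module.finrank ℂ (E i) = 3) (hEW : ∀ i, E i ≤ W) (hinj : Function.Injective E)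
    (hF : ∀ i, ∀ x ∈ E i, eval x F = 0) : False := by
  classical
  refine false_of_four_subsets (h.card_pointsOn_hyperplane_le hS hW) (T := fun i => pointsOn S (E i))
    (fun i => h.card_pointsOn_eq_four hS (hE i) (hF i)) (fun i => pointsOn_mono S (hEW i))
    fun i j hij => ?_
  rw [← pointsOn_inf]
  exact h.card_pointsOn_inf hS hW (hE i) (hE j) (hEW i) (hEW j) (hinj.ne hij) (hF i) (hF j)

/-- Three planes on the quintic do not share a line. -/
theorem TripleData.finrank_inf_le_one (h : TripleData F) (hS : ∀ P, P ∈ S ↔ IsSing F P.rep)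
    {E : Fin 3 → Submodule ℂ (Fin 5 → ℂ)} (hE : ∀ i, Module.finrank ℂ (E i) = 3)
    (hinj : Function.Injective E) (hF : ∀ i, ∀ x ∈ E i, eval x F = 0) :
    Module.finrank ℂ ↥(E 0 ⊓ E 1 ⊓ E 2) ≤ 1 := by
  classical
  by_contra! hcon
  set M := E 0 ⊓ E 1 ⊓ E 2
  have hME : ∀ i, M ≤ E i := by
    intro i
    fin_cases i
    exacts [inf_le_left.trans inf_le_left, inf_le_left.trans inf_le_right, inf_le_right]
  have hMij : ∀ i j, i ≠ j → E i ⊓ E j = M := fun i j hij => by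
    symm
    refine Submodule.eq_of_le_of_finrank_le (le_inf (hME i) (hME j)) ?_
    exact (finrank_inf_le_two (hE i) (hE j) (hinj.ne hij)).trans hcon
  have hM2 : Module.finrank ℂ M = 2 := by
    refine le_antisymm ?_ hcon
    rw [← hMij 0 1 (by decide)]
    exact finrank_inf_le_two (hE 0) (hE 1) (hinj.ne (by decide))
  have hsup : Module.finrank ℂ ↥(E 0 ⊔ E 1) = 4 := by
    have := Submodule.finrank_sup_add_finrank_inf_eq (E 0) (E 1)
    rw [hMij 0 1 (by decide), hE, hE, hM2] at this
    omega
  -- Inside a hyperplane, three planes through a common line would carry `2 + 3 · 2 = 8` triple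
  -- points. Otherwise the planes span the whole space, and all derivatives vanish along the line.
  by_cases h2 : E 2 ≤ E 0 ⊔ E 1
  · have hEW : ∀ i, E i ≤ E 0 ⊔ E 1 := by
      intro i
      fin_cases i
      exacts [le_sup_left, le_sup_right, h2]
    have hcard : ∀ i j, i ≠ j → (pointsOn S (E i) ∩ pointsOn S (E j)).card = 2 := fun i j hij => by
      rw [← pointsOn_inf]
      exact h.card_pointsOn_inf hS hsup (hE i) (hE j) (hEW i) (hEW j) (hinj.ne hij) (hF i) (hF j)
    have h4 := fun i => h.card_pointsOn_eq_four hS (hE i) (hF i)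
    have e1 := Finset.card_union_add_card_inter (pointsOn S (E 0)) (pointsOn S (E 1))
    rw [h4, h4, hcard 0 1 (by decide)] at e1
    have e2 := Finset.card_union_add_card_inter (pointsOn S (E 0) ∪ pointsOn S (E 1))
      (pointsOn S (E 2))
    rw [h4, Finset.union_inter_distrib_right, ← pointsOn_inf, ← pointsOn_inf, hMij 0 2 (by decide),
      hMij 1 2 (by decide), Finset.union_self, ← hMij 0 1 (by decide), pointsOn_inf,
      hcard 0 1 (by decide)] at e2
    have e3 := Finset.card_le_card (Finset.union_subset (Finset.union_subset
      (pointsOn_mono S (hEW 0)) (pointsOn_mono S (hEW 1))) (pointsOn_mono S (hEW 2)))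
    have e4 := h.card_pointsOn_hyperplane_le hS hsup
    omega
  · have htop : E 0 ⊔ E 1 ⊔ E 2 = ⊤ := by
      refine Submodule.eq_top_of_finrank_eq (le_antisymm (Submodule.finrank_le _) ?_)
      have hlt : E 0 ⊔ E 1 < E 0 ⊔ E 1 ⊔ E 2 :=
        lt_of_le_of_ne le_sup_left fun heq => h2 (sup_eq_left.1 heq.symm)
      have := Submodule.finrank_lt_finrank_of_lt hlt
      rw [Module.finrank_fin_fun]
      omega
    let b := Module.finBasisOfFinrankEq ℂ _ hM2
    have hA : LinearIndependent ℂ fun i => (b i : Fin 5 → ℂ) :=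
      b.linearIndependent.map' (Submodule.subtype _) (Submodule.ker_subtype _)
    obtain ⟨z, hz⟩ := h.exists_pull_dirDeriv_ne_zero hA le_rfl
    refine hz ((pull_eq_zero_iff _ _).2 fun y => ?_)
    have hm : ∑ i, y i • (b i : Fin 5 → ℂ) ∈ M :=
      Submodule.sum_mem _ fun i _ => Submodule.smul_mem _ _ (b i).2
    have hd := fun i (w) (hw : w ∈ E i) => eval_dirDeriv_of_vanishing (hF i) (hME i hm) hw
    exact eval_dirDeriv_eq_zero_of_mem_sup
      (fun w hw => eval_dirDeriv_eq_zero_of_mem_sup (hd 0) (hd 1) hw) (hd 2)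
      (show z ∈ E 0 ⊔ E 1 ⊔ E 2 by rw [htop]; trivial)

end Counting

/-! ### Factorization of hyperplane sections -/

section HyperplaneSections

variable {F : Poly} {w : Fin 4 → Fin 5 → ℂ} {W : Submodule ℂ (Fin 5 → ℂ)}

theorem exists_frame (hW : Module.finrank ℂ W = 4) : ∃ w : Fin 4 → Fin 5 → ℂ,
    LinearIndependent ℂ w ∧ Submodule.span ℂ (Set.range w) = W := by
  let b := Module.finBasisOfFinrankEq ℂ _ hW
  have hw : LinearIndependent ℂ fun i => (b i : Fin 5 → ℂ) :=
    b.linearIndependent.map' (Submodule.subtype _) (Submodule.ker_subtype _)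
  refine ⟨_, hw, Submodule.eq_of_le_of_finrank_eq (Submodule.span_le.2 ?_) ?_⟩
  · rintro _ ⟨i, rfl⟩
    exact (b i).2
  · rw [finrank_span_eq_card hw, Fintype.card_fin, hW]

theorem pull_surjective (hw : LinearIndependent ℂ w) : Function.Surjective (pull w) := by
  obtain ⟨ψ, hψ⟩ := exists_coordinates hw
  intro g
  refine ⟨pull (fun i => ψ (Pi.single i 1)) g, MvPolynomial.funext fun y => ?_⟩
  rw [eval_pull, eval_pull]
  refine congr_arg (fun z => eval z g) ?_
  conv_rhs => rw [← hψ y]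
  rw [LinearMap.pi_apply_eq_sum_univ ψ (∑ i, y i • w i)]
  refine Finset.sum_congr rfl fun i _ => ?_
  congr 2
  ext j
  simp [Pi.single_apply, eq_comm]

theorem pull_eq_zero_iff_mem_vanishingIdeal (hwW : Submodule.span ℂ (Set.range w) = W) (f : Poly) :
    pull w f = 0 ↔ f ∈ vanishingIdeal ℂ (W : Set (Fin 5 → ℂ)) := by
  rw [pull_eq_zero_iff, mem_vanishingIdeal_iff]
  constructor
  · intro h x hx
    rw [SetLike.mem_coe, ← hwW] at hx
    obtain ⟨y, rfl⟩ := (Submodule.mem_span_range_iff_exists_fun ℂ).1 hx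
    rw [aeval_eq_eval]
    exact h y
  · intro h y
    have := h (∑ i, y i • w i) (by
      rw [SetLike.mem_coe, ← hwW]
      exact (Submodule.mem_span_range_iff_exists_fun ℂ).2 ⟨y, rfl⟩)
    rwa [aeval_eq_eval] at this

/-- `pull w` is surjective with kernel the ideal of `W`. In coordinates on `W` the section ideal is
therefore principal, and radicality and primality become properties of one form. -/
theorem mem_sectionIdeal_iff (hw : LinearIndependent ℂ w)
    (hwW : Submodule.span ℂ (Set.range w) = W) (F f : Poly) :
    f ∈ sectionIdeal F W ↔ pull w F ∣ pull w f := by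
  constructor
  · intro hf
    obtain ⟨a, ha, b, hb, rfl⟩ := Submodule.mem_sup.1 hf
    rw [map_add, (pull_eq_zero_iff_mem_vanishingIdeal hwW b).2 hb, add_zero]
    exact map_dvd (pull w) (Ideal.mem_span_singleton.1 ha)
  · rintro ⟨g, hg⟩
    obtain ⟨G, rfl⟩ := pull_surjective hw g
    refine Submodule.mem_sup.2 ⟨F * G, Ideal.mem_span_singleton.2 ⟨G, rfl⟩, f - F * G, ?_, by ring⟩
    rw [← pull_eq_zero_iff_mem_vanishingIdeal hwW, map_sub, map_mul, hg, sub_self]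

theorem isRadical_sectionIdeal (hw : LinearIndependent ℂ w)
    (hwW : Submodule.span ℂ (Set.range w) = W) (hF : Squarefree (pull w F)) :
    (sectionIdeal F W).IsRadical := by
  rintro f ⟨k, hk⟩
  rw [mem_sectionIdeal_iff hw hwW] at hk ⊢
  rw [map_pow] at hk
  exact hF.isRadical k _ hk

theorem prime_pull_of_isPrime (hw : LinearIndependent ℂ w)
    (hwW : Submodule.span ℂ (Set.range w) = W) {q : Poly}
    (hq0 : q ∉ vanishingIdeal ℂ (W : Set (Fin 5 → ℂ))) (hq : (sectionIdeal q W).IsPrime) :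
    Prime (pull w q) := by
  refine ⟨mt (pull_eq_zero_iff_mem_vanishingIdeal hwW q).1 hq0, fun hu => hq.ne_top ?_, ?_⟩
  · rw [Ideal.eq_top_iff_one, mem_sectionIdeal_iff hw hwW]
    exact hu.dvd
  · intro a b hab
    obtain ⟨a, rfl⟩ := pull_surjective hw a
    obtain ⟨b, rfl⟩ := pull_surjective hw b
    rw [← map_mul, ← mem_sectionIdeal_iff hw hwW] at hab
    rw [← mem_sectionIdeal_iff hw hwW, ← mem_sectionIdeal_iff hw hwW]
    exact hq.mem_or_mem hab

/-- Hilbert's Nullstellensatz for a prime hypersurface. -/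
theorem dvd_of_zeros {n : Type*} [Finite n] {q f : MvPolynomial n ℂ} (hq : Prime q)
    (h : ∀ y, eval y q = 0 → eval y f = 0) : q ∣ f := by
  have h1 : (Ideal.span {q}).IsPrime := (Ideal.span_singleton_prime hq.ne_zero).2 hq
  rw [← Ideal.mem_span_singleton, ← h1.radical, ← vanishingIdeal_zeroLocus_eq_radical (K := ℂ),
    mem_vanishingIdeal_iff]
  intro y hy
  have := (mem_zeroLocus_iff.1 hy) q (Ideal.mem_span_singleton_self q)
  rw [aeval_eq_eval] at this ⊢
  exact h y this

theorem ne_zero_of_isHomogeneous_of_not_isUnit {n : Type*} {f : MvPolynomial n ℂ} {d : ℕ}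
    (hf : f.IsHomogeneous d) (hf0 : f ≠ 0) (hu : ¬ IsUnit f) : d ≠ 0 := by
  rintro rfl
  rw [← totalDegree_zero_iff_isHomogeneous, totalDegree_eq_zero_iff_eq_C] at hf
  rw [hf] at hu hf0
  refine hu (IsUnit.map C (isUnit_iff_ne_zero.2 fun h0 => hf0 ?_))
  rw [h0, map_zero]

theorem TripleData.pull_ne_zero (h : TripleData F) (hw : LinearIndependent ℂ w) :
    pull w F ≠ 0 := fun h0 =>
  h.not_sq_dvd hw (isHomogeneous_X ℂ 0) one_ne_zero X_prime (by rw [h0]; exact dvd_zero _)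

theorem TripleData.squarefree_pull (h : TripleData F) (hw : LinearIndependent ℂ w) :
    Squarefree (pull w F) := by
  intro x hx
  by_contra hu
  have hf0 := h.pull_ne_zero hw
  have hx0 : x ≠ 0 := by
    rintro rfl
    rw [zero_mul, zero_dvd_iff] at hx
    exact hf0 hx
  obtain ⟨p, hp, hpx⟩ := WfDvdMonoid.exists_irreducible_factor hu hx0
  have hpp := (mul_dvd_mul hpx hpx).trans hx
  obtain ⟨d, hd⟩ := exists_isHomogeneous_of_dvd (isHomogeneous_pull w h.hom) hf0
    ((dvd_mul_right p p).trans hpp)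
  exact h.not_sq_dvd hw hd (ne_zero_of_isHomogeneous_of_not_isUnit hd hp.ne_zero hp.not_isUnit)
    hp.prime hpp

theorem exists_plane_of_linear_dvd (hw : LinearIndependent ℂ w)
    (hwW : Submodule.span ℂ (Set.range w) = W) {l : MvPolynomial (Fin 4) ℂ}
    (hl : l.IsHomogeneous 1) (hl0 : l ≠ 0) (hlF : l ∣ pull w F) :
    ∃ E ≤ W, Module.finrank ℂ E = 3 ∧ ∀ x ∈ E, eval x F = 0 := by
  obtain ⟨c, rfl⟩ := exists_eq_sum_of_isHomogeneous_one hl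
  let lam : (Fin 4 → ℂ) →ₗ[ℂ] ℂ := ∑ i, c i • LinearMap.proj i
  have hlam : ∀ y, lam y = eval y (∑ i, C (c i) * X i) := fun y => by simp [lam]
  have hlam0 : lam ≠ 0 := by
    intro h0
    refine hl0 (MvPolynomial.funext fun y => ?_)
    rw [← hlam, h0, map_zero, LinearMap.zero_apply]
  have hker : Module.finrank ℂ (LinearMap.ker lam) = 3 := by
    have h1 := LinearMap.finrank_range_add_finrank_ker lam
    rw [LinearMap.range_eq_top.2 (LinearMap.surjective hlam0), finrank_top, Module.finrank_self,
      Module.finrank_fin_fun] at h1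
    omega
  have hinj := hw.fintypeLinearCombination_injective
  refine ⟨(LinearMap.ker lam).map (Fintype.linearCombination ℂ w), ?_, ?_, ?_⟩
  · rintro _ ⟨y, -, rfl⟩
    rw [← hwW]
    exact (Submodule.mem_span_range_iff_exists_fun ℂ).2 ⟨y, rfl⟩
  · rw [← hker]
    exact (LinearEquiv.finrank_eq (Submodule.equivMapOfInjective _ hinj _)).symm
  · rintro _ ⟨y, hy, rfl⟩
    obtain ⟨g, hg⟩ := hlF
    rw [Fintype.linearCombination_apply, ← eval_pull, hg, map_mul, ← hlam,
      LinearMap.mem_ker.1 hy, zero_mul]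

variable {S : Finset P4}

theorem TripleData.card_points_quadric (h : TripleData F) (hS : ∀ P, P ∈ S ↔ IsSing F P.rep)
    (hw : LinearIndependent ℂ w) (hwW : Submodule.span ℂ (Set.range w) = W) {q : Poly}
    (hqh : q.IsHomogeneous 2) (hq : Prime (pull w q)) (hqF : pull w q ∣ pull w F) {T : Finset P4}
    (hT : ∀ P, P ∈ T ↔ P ∈ pointsOn S W ∧ eval P.rep q = 0) : T.card = 6 := by
  classical
  have hW : Module.finrank ℂ W = 4 := by
    rw [← hwW, finrank_span_eq_card hw, Fintype.card_fin]
  refine le_antisymm ((Finset.card_le_card fun P hP => ((hT P).1 hP).1).trans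
    (h.card_pointsOn_hyperplane_le hS hW)) ?_
  refine (h.six_le_card_of_quadric hw (isHomogeneous_pull w hqh) hq hqF
    (T.image Projectivization.rep) ?_ ?_).trans Finset.card_image_le
  · intro x hx
    obtain ⟨P, hP, rfl⟩ := Finset.mem_image.1 hx
    rw [hT, mem_pointsOn, hS] at hP
    refine ⟨hP.1.1, ?_⟩
    have := hP.1.2
    rw [← hwW] at this
    obtain ⟨y, hy⟩ := (Submodule.mem_span_range_iff_exists_fun ℂ).1 this
    exact ⟨y, by rw [eval_pull, hy, hP.2], hy⟩
  · intro v hv hvq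
    obtain ⟨P, hP, hPv, hvP⟩ := exists_mem_of_isSing hS h hv
    refine ⟨P.rep, Finset.mem_image_of_mem _ ?_, hvP⟩
    rw [hT, mem_pointsOn]
    refine ⟨⟨hP, ?_⟩, ?_⟩
    · refine (Submodule.span_singleton_le_iff_mem _ _).2 ?_ hPv
      rw [← hwW]
      exact (Submodule.mem_span_range_iff_exists_fun ℂ).2 ⟨v, rfl⟩
    · obtain ⟨a, ha⟩ := Submodule.mem_span_singleton.1 hPv
      rw [← ha, IsHomogeneous.eval_smul hqh, ← eval_pull, hvq, mul_zero]

/-- An irreducible quadric carries six triple points, which force a plane in the hyperplane; a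
reducible one has a linear factor. -/
theorem TripleData.exists_plane_of_quadric_dvd (h : TripleData F)
    (hS : ∀ P, P ∈ S ↔ IsSing F P.rep) (hw : LinearIndependent ℂ w)
    (hwW : Submodule.span ℂ (Set.range w) = W) {q : MvPolynomial (Fin 4) ℂ}
    (hqh : q.IsHomogeneous 2) (hqF : q ∣ pull w F) :
    ∃ E ≤ W, Module.finrank ℂ E = 3 ∧ ∀ x ∈ E, eval x F = 0 := by
  classical
  have hq0 : q ≠ 0 := by
    rintro rfl
    exact h.pull_ne_zero hw (zero_dvd_iff.1 hqF)
  by_cases hq : Irreducible q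
  · have hW : Module.finrank ℂ W = 4 := by
      rw [← hwW, finrank_span_eq_card hw, Fintype.card_fin]
    obtain ⟨Q, rfl⟩ := pull_surjective hw q
    refine h.exists_plane_of_six_le_card hS hW ?_
    -- The lift `Q` need not be homogeneous, but its quadratic part has the same restriction.
    have hQ : pull w (homogeneousComponent 2 Q) = pull w Q := by
      rw [← homogeneousComponent_pull, homogeneousComponent_of_mem hqh, if_pos rfl]
    rw [← h.card_points_quadric hS hw hwW (homogeneousComponent_isHomogeneous 2 Q)
      (by rw [hQ]; exact hq.prime) (by rwa [hQ]) fun P => Finset.mem_filter]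
    exact Finset.card_le_card (Finset.filter_subset _ _)
  · have hqu : ¬ IsUnit q := by
      intro hu
      have h0 := (MvPolynomial.isUnit_iff_eq_C_of_isReduced.1 hu)
      obtain ⟨r, -, hr⟩ := h0
      have : (C r : MvPolynomial (Fin 4) ℂ).IsHomogeneous 0 := isHomogeneous_C _ _
      rw [← hr] at this
      exact absurd (this.inj_right hqh hq0) (by norm_num)
    rw [irreducible_iff] at hq
    push Not at hq
    obtain ⟨a, b, hab, ha, hb⟩ := hq hqu
    obtain ⟨d, e, hde, hd, he⟩ := exists_isHomogeneous_of_mul hqh hq0 hab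
    have ha0 : a ≠ 0 := by
      rintro rfl
      exact hq0 (by rw [hab, zero_mul])
    have hb0 : b ≠ 0 := by
      rintro rfl
      exact hq0 (by rw [hab, mul_zero])
    have := ne_zero_of_isHomogeneous_of_not_isUnit hd ha0 ha
    have := ne_zero_of_isHomogeneous_of_not_isUnit he hb0 hb
    rw [show d = 1 by omega] at hd
    exact exists_plane_of_linear_dvd hw hwW hd ha0 ((Dvd.intro b hab.symm).trans hqF)

/-- A proper factorization of a quintic form contains a factor of degree one or two. -/
theorem TripleData.exists_plane_of_not_irreducible (h : TripleData F)
    (hS : ∀ P, P ∈ S ↔ IsSing F P.rep) (hw : LinearIndependent ℂ w)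
    (hwW : Submodule.span ℂ (Set.range w) = W) (hirr : ¬ Irreducible (pull w F)) :
    ∃ E ≤ W, Module.finrank ℂ E = 3 ∧ ∀ x ∈ E, eval x F = 0 := by
  have hf0 := h.pull_ne_zero hw
  have hfh := isHomogeneous_pull w h.hom
  have hfu : ¬ IsUnit (pull w F) := by
    intro hu
    obtain ⟨r, -, hr⟩ := MvPolynomial.isUnit_iff_eq_C_of_isReduced.1 hu
    have : (C r : MvPolynomial (Fin 4) ℂ).IsHomogeneous 0 := isHomogeneous_C _ _
    rw [← hr] at this
    exact absurd (this.inj_right hfh hf0) (by norm_num)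
  rw [irreducible_iff] at hirr
  push Not at hirr
  obtain ⟨a, b, hab, ha, hb⟩ := hirr hfu
  obtain ⟨d, e, hde, hd, he⟩ := exists_isHomogeneous_of_mul hfh hf0 hab
  have ha0 : a ≠ 0 := by
    rintro rfl
    exact hf0 (by rw [hab, zero_mul])
  have hb0 : b ≠ 0 := by
    rintro rfl
    exact hf0 (by rw [hab, mul_zero])
  have hd0 := ne_zero_of_isHomogeneous_of_not_isUnit hd ha0 ha
  have he0 := ne_zero_of_isHomogeneous_of_not_isUnit he hb0 hb
  have haF : a ∣ pull w F := Dvd.intro b hab.symm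
  have hbF : b ∣ pull w F := Dvd.intro_left a hab.symm
  obtain rfl | rfl | rfl | rfl : d = 1 ∨ d = 2 ∨ d = 3 ∨ d = 4 := by omega
  · exact exists_plane_of_linear_dvd hw hwW hd ha0 haF
  · exact h.exists_plane_of_quadric_dvd hS hw hwW hd haF
  · rw [show e = 2 by omega] at he
    exact h.exists_plane_of_quadric_dvd hS hw hwW he hbF
  · rw [show e = 1 by omega] at he
    exact exists_plane_of_linear_dvd hw hwW he hb0 hbF

end HyperplaneSections

/-! ### From vectors to projective points -/

section Projective

variable {F : Poly} {W E : Submodule ℂ (Fin 5 → ℂ)}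

theorem mem_linearSet_iff {P : P4} : P ∈ linearSet W ↔ P.rep ∈ W := by
  rw [linearSet, Set.mem_ofPred_eq, Projectivization.submodule_eq,
    Submodule.span_singleton_le_iff_mem]

theorem mem_hypersurface_iff {d : ℕ} (hF : F.IsHomogeneous d) {P : P4} :
    P ∈ hypersurface F ↔ eval P.rep F = 0 := by
  rw [hypersurface, zeroSet, Set.mem_ofPred_eq, Projectivization.submodule_eq]
  constructor
  · intro h
    exact h _ (Submodule.mem_span_singleton_self _) F rfl
  · rintro h v hv f rfl
    obtain ⟨a, rfl⟩ := Submodule.mem_span_singleton.1 hv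
    rw [IsHomogeneous.eval_smul hF, h, mul_zero]

theorem eval_dirDeriv {n : Type*} [Fintype n] (f : MvPolynomial n ℂ) (x w : n → ℂ) :
    eval x (dirDeriv w f) = ∑ i, w i * eval x (pderiv i f) := by
  simp [dirDeriv]

theorem forall_eval_dirDeriv_eq_zero_iff {n : Type*} [Fintype n] {f : MvPolynomial n ℂ}
    {x : n → ℂ} : (∀ w, eval x (dirDeriv w f) = 0) ↔ ∀ i, eval x (pderiv i f) = 0 := by
  classical
  constructor
  · intro h i
    have := h (Pi.single i 1)
    rw [eval_dirDeriv] at this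
    simpa [Pi.single_apply] using this
  · intro h w
    rw [eval_dirDeriv]
    exact Finset.sum_eq_zero fun i _ => by rw [h, mul_zero]

theorem mem_singularLocus_iff (hF : F.IsHomogeneous 5) {P : P4} :
    P ∈ singularLocus F ↔ IsSing F P.rep := by
  rw [singularLocus, Set.mem_ofPred_eq, mem_hypersurface_iff hF, IsSing,
    forall_eval_dirDeriv_eq_zero_iff, Projectivization.submodule_eq]
  constructor
  · rintro ⟨-, h⟩
    exact ⟨P.rep_nonzero, h _ (Submodule.mem_span_singleton_self _)⟩
  · rintro ⟨-, h⟩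
    constructor
    · have h1 := congr_arg (eval P.rep) hF.sum_X_mul_pderiv
      rw [map_sum, Finset.sum_eq_zero fun i _ => by rw [map_mul, h, mul_zero]] at h1
      simpa using h1
    · intro v hv i
      obtain ⟨a, rfl⟩ := Submodule.mem_span_singleton.1 hv
      rw [IsHomogeneous.eval_smul hF.pderiv, h, mul_zero]

theorem tripleData_of_isOrdinaryTriplePoint (hF : F.IsHomogeneous 5)
    (hfin : (singularLocus F).Finite) (hsing : ∀ P ∈ singularLocus F, IsOrdinaryTriplePoint F P) :
    TripleData F := by
  classical
  have key : ∀ v, IsSing F v → ∃ P ∈ singularLocus F, P.submodule = Submodule.span ℂ {v} := by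
    intro v hv
    refine ⟨Projectivization.mk ℂ v hv.1, ?_, Projectivization.submodule_mk v hv.1⟩
    rw [mem_singularLocus_iff hF]
    obtain ⟨a, ha⟩ := Projectivization.exists_smul_eq_mk_rep ℂ v hv.1
    refine ⟨Projectivization.rep_nonzero _, fun z => ?_⟩
    rw [← ha, Units.smul_def, IsHomogeneous.eval_smul (isHomogeneous_dirDeriv z hF), hv.2, mul_zero]
  refine ⟨hF, fun v hv => ?_, fun v hv x hx => ?_, hfin.toFinset.image Projectivization.rep, ?_⟩
  · obtain ⟨P, hP, hPv⟩ := key v hv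
    rw [mem_pointIdeal_pow_iff]
    exact (hsing P hP v (by rw [hPv]; exact Submodule.mem_span_singleton_self v) hv.1).1
  · obtain ⟨P, hP, hPv⟩ := key v hv
    rw [← hPv]
    refine (hsing P hP v (by rw [hPv]; exact Submodule.mem_span_singleton_self v) hv.1).2.2 x ?_
    exact forall_eval_dirDeriv_eq_zero_iff.1 hx
  · intro v hv
    obtain ⟨P, hP, hPv⟩ := key v hv
    refine ⟨P.rep, Finset.mem_image_of_mem _ (hfin.mem_toFinset.2 hP), ?_⟩
    rw [← Projectivization.submodule_eq, hPv]
    exact Submodule.mem_span_singleton_self v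

theorem exists_rep_of_ne_zero {v : Fin 5 → ℂ} (hv : v ≠ 0) : ∃ P : P4, ∃ a : ℂ, a ≠ 0 ∧
    a • v = P.rep := by
  obtain ⟨a, ha⟩ := Projectivization.exists_smul_eq_mk_rep ℂ v hv
  exact ⟨_, a, a.ne_zero, ha⟩

theorem linearSet_subset_hypersurface_iff (hF : F.IsHomogeneous 5) :
    linearSet E ⊆ hypersurface F ↔ ∀ x ∈ E, eval x F = 0 := by
  constructor
  · intro h x hx
    by_cases hx0 : x = 0
    · subst hx0
      simpa using IsHomogeneous.eval_smul hF 0 0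
    · obtain ⟨P, a, ha, hP⟩ := exists_rep_of_ne_zero hx0
      have h1 := (mem_hypersurface_iff hF).1
        (h (mem_linearSet_iff.2 (hP ▸ E.smul_mem a hx) : P ∈ linearSet E))
      rw [← hP, IsHomogeneous.eval_smul hF] at h1
      exact (mul_eq_zero.1 h1).resolve_left (pow_ne_zero _ ha)
  · intro h P hP
    exact (mem_hypersurface_iff hF).2 (h _ (mem_linearSet_iff.1 hP))

theorem linearSet_subset_linearSet_iff : linearSet E ⊆ linearSet W ↔ E ≤ W := by
  constructor
  · intro h x hx
    by_cases hx0 : x = 0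
    · rw [hx0]
      exact W.zero_mem
    · obtain ⟨P, a, ha, hP⟩ := exists_rep_of_ne_zero hx0
      have h1 := mem_linearSet_iff.1 (h (mem_linearSet_iff.2 (hP ▸ E.smul_mem a hx) : P ∈ linearSet E))
      rw [← hP] at h1
      exact (W.smul_mem_iff ha).1 h1
  · intro h P hP
    exact mem_linearSet_iff.2 (h (mem_linearSet_iff.1 hP))

theorem encard_singularLocus_inter {S : Finset P4} (hS : ∀ P, P ∈ S ↔ IsSing F P.rep)
    (hF : F.IsHomogeneous 5) :
    (singularLocus F ∩ linearSet W).encard = (pointsOn S W).card := by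
  rw [← Set.encard_coe_eq_coe_finsetCard]
  congr 1
  ext P
  rw [Finset.mem_coe, mem_pointsOn, Set.mem_inter_iff, mem_singularLocus_iff hF, mem_linearSet_iff,
    hS]

/-- For an irreducible equation, choose for each closed part an equation that does not vanish on the
whole section. The product vanishes on the section, so the Nullstellensatz and primality make one
factor vanish there, a contradiction. -/
theorem not_irreducible_of_isReducible (hF : F.IsHomogeneous 5) {w : Fin 4 → Fin 5 → ℂ}
    (hw : LinearIndependent ℂ w) (hwW : Submodule.span ℂ (Set.range w) = W)
    (hred : IsReducible (hypersurface F ∩ linearSet W)) : ¬ Irreducible (pull w F) := by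
  intro hirr
  obtain ⟨A, B, ⟨T, -, rfl⟩, ⟨T', -, rfl⟩, hA, hB, hAB⟩ := hred
  have hmem : ∀ {P : P4} {v : Fin 5 → ℂ}, P ∈ hypersurface F ∩ linearSet W → v ∈ P.submodule →
      ∃ y : Fin 4 → ℂ, ∑ i, y i • w i = v ∧ eval y (pull w F) = 0 := by
    intro P v hP hv
    have hvW : v ∈ W := hP.2 hv
    rw [← hwW] at hvW
    obtain ⟨y, rfl⟩ := (Submodule.mem_span_range_iff_exists_fun ℂ).1 hvW
    exact ⟨y, rfl, by rw [eval_pull]; exact hP.1 _ hv F rfl⟩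
  have hex : ∀ T T' : Set Poly, hypersurface F ∩ linearSet W = zeroSet T ∪ zeroSet T' →
      zeroSet T ≠ hypersurface F ∩ linearSet W →
      ∃ P ∈ hypersurface F ∩ linearSet W, P ∈ zeroSet T' ∧
        ∃ v ∈ P.submodule, ∃ a ∈ T, eval v a ≠ 0 := by
    intro T T' hU hT
    obtain ⟨P, hP, hPT⟩ : ∃ P ∈ hypersurface F ∩ linearSet W, P ∉ zeroSet T := by
      by_contra! hcon
      exact hT (Set.Subset.antisymm (hU ▸ Set.subset_union_left) hcon)
    have hPU : P ∈ zeroSet T ∪ zeroSet T' := hU ▸ hP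
    refine ⟨P, hP, hPU.resolve_left hPT, ?_⟩
    rw [zeroSet, Set.mem_ofPred_eq] at hPT
    push Not at hPT
    exact hPT
  obtain ⟨P, hP, hPB, v, hv, a, ha, hav⟩ := hex T T' hAB hA
  obtain ⟨Q, hQ, hQA, v', hv', b, hb, hbv⟩ := hex T' T (by rw [hAB, Set.union_comm]) hB
  have hdvd : pull w F ∣ pull w a * pull w b := by
    refine dvd_of_zeros hirr.prime fun y hy => ?_
    rw [map_mul, eval_pull, eval_pull]
    by_cases hy0 : y = 0
    · have := hQA 0 (zero_mem _) a ha
      simp only [hy0, Pi.zero_apply, zero_smul, Finset.sum_const_zero, this, zero_mul]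
    · have hx0 := sum_smul_ne_zero hw hy0
      have hsub := Projectivization.submodule_mk (K := ℂ) _ hx0
      have hR : Projectivization.mk ℂ _ hx0 ∈ hypersurface F ∩ linearSet W := by
        constructor
        · intro x hx f hf
          rw [hsub] at hx
          obtain ⟨c, rfl⟩ := Submodule.mem_span_singleton.1 hx
          rw [Set.mem_singleton_iff.1 hf, IsHomogeneous.eval_smul hF, ← eval_pull, hy, mul_zero]
        · rw [linearSet, Set.mem_ofPred_eq, hsub, Submodule.span_singleton_le_iff_mem, ← hwW]
          exact (Submodule.mem_span_range_iff_exists_fun ℂ).2 ⟨y, rfl⟩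
      have hself : ∑ i, y i • w i ∈ (Projectivization.mk ℂ _ hx0).submodule := by
        rw [hsub]
        exact Submodule.mem_span_singleton_self _
      rw [hAB] at hR
      rcases hR with hR | hR
      · rw [hR _ hself a ha, zero_mul]
      · rw [hR _ hself b hb, mul_zero]
  rcases hirr.prime.dvd_or_dvd hdvd with ⟨g, hg⟩ | ⟨g, hg⟩
  · obtain ⟨y, rfl, hy⟩ := hmem hP hv
    exact hav (by rw [← eval_pull, hg, map_mul, hy, zero_mul])
  · obtain ⟨y, rfl, hy⟩ := hmem hQ hv'
    exact hbv (by rw [← eval_pull, hg, map_mul, hy, zero_mul])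

end Projective

end TripleQuintic

/-! ### The proposition -/

open TripleQuintic

theorem proposition3p1 (F : Poly) (hF : F.IsHomogeneous 5) (hF0 : F ≠ 0)
    (hfin : (singularLocus F).Finite)
    (hsing : ∀ P ∈ singularLocus F, IsOrdinaryTriplePoint F P) :
    -- the line through two triple points lies on the quintic
    (∀ P ∈ singularLocus F, ∀ Q ∈ singularLocus F, P ≠ Q →
      lineThrough P Q ⊆ hypersurface F) ∧
    -- no three triple points are collinear
    (∀ P ∈ singularLocus F, ∀ Q ∈ singularLocus F,
      ∀ R ∈ singularLocus F, P ≠ Q → P ≠ R → Q ≠ R →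
      ¬ ∃ ℓ : Set P4, IsLinearOfDim 1 ℓ ∧ P ∈ ℓ ∧ Q ∈ ℓ ∧ R ∈ ℓ) ∧
    -- a plane contains at most four triple points
    (∀ E : Set P4, IsLinearOfDim 2 E →
      (singularLocus F ∩ E).encard ≤ 4) ∧
    -- and exactly four if and only if it lies on the quintic
    (∀ E : Set P4, IsLinearOfDim 2 E →
      ((singularLocus F ∩ E).encard = 4 ↔ E ⊆ hypersurface F)) ∧
    -- a hyperplane contains at most six; if exactly six, then the section contains a plane
    (∀ H : Set P4, IsLinearOfDim 3 H →
      (singularLocus F ∩ H).encard ≤ 6 ∧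
      ((singularLocus F ∩ H).encard = 6 →
        (planesIn (hypersurface F ∩ H)).Nonempty)) ∧
    -- three distinct planes on the quintic have a finite intersection
    (∀ E₁ ∈ planesIn (hypersurface F),
      ∀ E₂ ∈ planesIn (hypersurface F),
      ∀ E₃ ∈ planesIn (hypersurface F),
      E₁ ≠ E₂ → E₁ ≠ E₃ → E₂ ≠ E₃ → (E₁ ∩ E₂ ∩ E₃).Finite) ∧
    -- an irreducible quadric surface on the quintic contains exactly six triple points,
    -- and if there is one, then the quintic contains a plane
    (∀ S : Set P4, IsIrreducibleQuadricSurface S →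
      S ⊆ hypersurface F →
      (singularLocus F ∩ S).encard = 6 ∧
      (planesIn (hypersurface F)).Nonempty) ∧
    -- hyperplane sections are reduced; a reducible one contains between one and three planes
    (∀ W : Submodule ℂ (Fin 5 → ℂ), Module.finrank ℂ W = 4 →
      IsReducedSection F W ∧
      (IsReducible (hypersurface F ∩ linearSet W) →
        1 ≤ (planesIn
          (hypersurface F ∩ linearSet W)).encard ∧
        (planesIn
          (hypersurface F ∩ linearSet W)).encard ≤ 3)) := by
  classical
  have h := tripleData_of_isOrdinaryTriplePoint hF hfin hsing
  have hS : ∀ P, P ∈ hfin.toFinset ↔ IsSing F P.rep := fun P => by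
    rw [hfin.mem_toFinset, mem_singularLocus_iff hF]
  have hcard := fun W => encard_singularLocus_inter (W := W) hS hF
  refine ⟨?_, ?_, ?_, ?_, ?_, ?_, ?_, ?_⟩
  · intro P hP Q hQ _
    rw [lineThrough, linearSet_subset_hypersurface_iff hF]
    intro x hx
    rw [P.submodule_eq, Q.submodule_eq, ← Submodule.span_insert] at hx
    obtain ⟨a, b, rfl⟩ := Submodule.mem_span_pair.1 hx
    exact h.eval_add_eq_zero ((mem_singularLocus_iff hF).1 hP) ((mem_singularLocus_iff hF).1 hQ) a b
  · rintro P hP Q hQ R hR hPQ hPR hQR ⟨_, ⟨W, hW, rfl⟩, hPW, hQW, hRW⟩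
    have h1 := h.card_pointsOn_line_le hS hW.le
    have h2 : {P, Q, R} ⊆ pointsOn hfin.toFinset W := by
      intro A hA
      rw [mem_pointsOn, hfin.mem_toFinset, ← mem_linearSet_iff]
      simp only [Finset.mem_insert, Finset.mem_singleton] at hA
      rcases hA with rfl | rfl | rfl
      exacts [⟨hP, hPW⟩, ⟨hQ, hQW⟩, ⟨hR, hRW⟩]
    have h3 := Finset.card_le_card h2
    rw [Finset.card_eq_three.2 ⟨P, Q, R, hPQ, hPR, hQR, rfl⟩] at h3
    omega
  · rintro _ ⟨W, hW, rfl⟩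
    rw [hcard]
    exact_mod_cast h.card_pointsOn_plane_le hS hW
  · rintro _ ⟨W, hW, rfl⟩
    rw [hcard, linearSet_subset_hypersurface_iff hF]
    constructor
    · intro h4
      exact h.vanishing_of_four_le_card hS hW (by exact_mod_cast h4.ge)
    · intro h0
      exact_mod_cast h.card_pointsOn_eq_four hS hW h0
  · rintro _ ⟨W, hW, rfl⟩
    rw [hcard]
    refine ⟨by exact_mod_cast h.card_pointsOn_hyperplane_le hS hW, fun h6 => ?_⟩
    obtain ⟨E, hEW, hE, h0⟩ := h.exists_plane_of_six_le_card hS hW (by exact_mod_cast h6.ge)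
    exact ⟨linearSet E, ⟨E, hE, rfl⟩, Set.subset_inter
      ((linearSet_subset_hypersurface_iff hF).2 h0) (linearSet_subset_linearSet_iff.2 hEW)⟩
  · rintro _ ⟨⟨W₁, h₁, rfl⟩, hX₁⟩ _ ⟨⟨W₂, h₂, rfl⟩, hX₂⟩ _ ⟨⟨W₃, h₃, rfl⟩, hX₃⟩ h12 h13 h23
    rw [linearSet_subset_hypersurface_iff hF] at hX₁ hX₂ hX₃
    have h1 := h.finrank_inf_le_one hS (E := ![W₁, W₂, W₃])
      (by intro i; fin_cases i; exacts [h₁, h₂, h₃])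
      (by
        have e12 : W₁ ≠ W₂ := fun e => h12 (e ▸ rfl)
        have e13 : W₁ ≠ W₃ := fun e => h13 (e ▸ rfl)
        have e23 : W₂ ≠ W₃ := fun e => h23 (e ▸ rfl)
        intro i j hij
        fin_cases i <;> fin_cases j <;> simp_all [eq_comm])
      (by intro i; fin_cases i; exacts [hX₁, hX₂, hX₃])
    -- The three linear subspaces meet in dimension at most one, which leaves room for a single
    -- projective point.
    refine Set.Subsingleton.finite fun P hP Q hQ => ?_
    by_contra hne
    have hm : ∀ {R : P4}, R ∈ linearSet W₁ ∩ linearSet W₂ ∩ linearSet W₃ →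
        R.rep ∈ W₁ ⊓ W₂ ⊓ W₃ := fun hR =>
      ⟨⟨mem_linearSet_iff.1 hR.1.1, mem_linearSet_iff.1 hR.1.2⟩, mem_linearSet_iff.1 hR.2⟩
    have hspan : Submodule.span ℂ {Q.rep} = W₁ ⊓ W₂ ⊓ W₃ := by
      refine Submodule.eq_of_le_of_finrank_le
        ((Submodule.span_singleton_le_iff_mem _ _).2 (hm hQ)) ?_
      rw [finrank_span_singleton Q.rep_nonzero]
      exact h1
    exact rep_notMem_span hne (hspan ▸ hm hP)
  · rintro _ ⟨W, q, hW, hqh, hq0, hqp, rfl⟩ hX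
    obtain ⟨w, hw, hwW⟩ := exists_frame hW
    have hq := prime_pull_of_isPrime hw hwW hq0 hqp
    -- The geometric inclusion becomes a divisibility by the Nullstellensatz, since the quadratic
    -- form is prime on the hyperplane.
    have hqF : pull w q ∣ pull w F := by
      refine dvd_of_zeros hq fun y hy => ?_
      rw [eval_pull] at hy ⊢
      by_cases hx : ∑ i, y i • w i = 0
      · rw [hx]
        simpa using IsHomogeneous.eval_smul hF 0 0
      · obtain ⟨P, a, ha, hP⟩ := exists_rep_of_ne_zero hx
        have h1 := (mem_hypersurface_iff hF).1 (@hX P ⟨?_, ?_⟩)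
        · rw [← hP, IsHomogeneous.eval_smul hF] at h1
          exact (mul_eq_zero.1 h1).resolve_left (pow_ne_zero _ ha)
        · rw [mem_hypersurface_iff hqh, ← hP, IsHomogeneous.eval_smul hqh, hy, mul_zero]
        · rw [mem_linearSet_iff, ← hP, ← hwW]
          exact Submodule.smul_mem _ _ ((Submodule.mem_span_range_iff_exists_fun ℂ).2 ⟨y, rfl⟩)
    have h6 := h.card_points_quadric hS hw hwW hqh hq hqF fun P => Finset.mem_filter
    constructor
    · refine Eq.trans ?_ (congr_arg (Nat.cast : ℕ → ℕ∞) h6)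
      rw [← Set.encard_coe_eq_coe_finsetCard]
      congr 1
      ext P
      rw [Finset.mem_coe, Finset.mem_filter, mem_pointsOn, hfin.mem_toFinset, Set.mem_inter_iff,
        Set.mem_inter_iff, mem_hypersurface_iff hqh, mem_linearSet_iff]
      tauto
    · obtain ⟨E, -, hE, h0⟩ := h.exists_plane_of_six_le_card hS hW
        (h6.symm.le.trans (Finset.card_le_card (Finset.filter_subset _ _)))
      exact ⟨linearSet E, ⟨E, hE, rfl⟩, (linearSet_subset_hypersurface_iff hF).2 h0⟩
  · intro W hW
    obtain ⟨w, hw, hwW⟩ := exists_frame hW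
    refine ⟨isRadical_sectionIdeal hw hwW (h.squarefree_pull hw), fun hred => ⟨?_, ?_⟩⟩
    · obtain ⟨E, hEW, hE, h0⟩ := h.exists_plane_of_not_irreducible hS hw hwW
        (not_irreducible_of_isReducible hF hw hwW hred)
      rw [Set.one_le_encard_iff_nonempty]
      exact ⟨linearSet E, ⟨E, hE, rfl⟩, Set.subset_inter
        ((linearSet_subset_hypersurface_iff hF).2 h0) (linearSet_subset_linearSet_iff.2 hEW)⟩
    -- More than three planes, possibly infinitely many, contain a subset of exactly four, which the
    -- count of triple points excludes.
    · by_contra hcon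
      have h4 : (4 : ℕ∞) ≤ (planesIn (hypersurface F ∩ linearSet W)).encard :=
        Order.add_one_le_of_lt (not_le.1 hcon)
      obtain ⟨T, hT, hT4⟩ := Set.exists_subset_encard_eq h4
      have hTfin : T.Finite := Set.finite_of_encard_eq_coe hT4
      obtain ⟨v, hv, hvT⟩ := exists_injective_mem (k := 4) (T := hTfin.toFinset) (by
        rw [hTfin.encard_eq_coe_toFinset_card] at hT4
        exact_mod_cast hT4.ge)
      have hvT' := fun i => hT (hTfin.mem_toFinset.1 (hvT i))
      choose E hE hvE using fun i => (hvT' i).1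
      refine h.false_of_four_planes hS hW hE (fun i => ?_) (fun i j hij => hv ?_) (fun i => ?_)
      · rw [← linearSet_subset_linearSet_iff, ← hvE]
        exact (hvT' i).2.trans Set.inter_subset_right
      · rw [hvE, hvE, hij]
      · rw [← linearSet_subset_hypersurface_iff hF, ← hvE]
        exact (hvT' i).2.trans Set.inter_subset_left
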